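/- Let $\mathbb{H}$ be the hexagonal (honeycomb) lattice. For a vertex $v$ of $\mathbb{H}$ and $n\ge 0$ let $c_n$ be the number of $n$-step self-avoiding walks on $\mathbb{H}$ (walks that visit every vertex at most once) starting at $v$. Then, whatever the choice of $v$, the limit $\mu=\lim_{n\to\infty}c_n^{1/n}$, called the connective constant of $\mathbb{H}$, exists and $$\mu=\sqrt{2+\sqrt2}.$$ Moreover, call the centre of an edge of $\mathbb{H}$ a mid-edge. For a mid-edge $a$ consider the self-avoiding walks $\gamma$ on $\mathbb{H}$ that start at $a$ and end at an arbitrary mid-edge, that is, the alternating sequences $e_0=a,v_1,e_1,v_2,\dots,v_\ell,e_\ell$ ($\ell\ge 0$) of mid-edges $e_i$ and pairwise distinct vertices $v_i$ such that $e_{i-1}$ and $e_i$ are the centres of two different edges incident to $v_i$ for every $i$. Let $\ell(\gamma)=\ell$ be the number of vertices visited by $\gamma$, and for real $x\ge 0$ let $Z(x)=\sum_{\gamma}x^{\ell(\gamma)}\in[0,+\infty]$, with the convention $0^0=1$. Then, for every mid-edge $a$, $Z(x)=+\infty$ for all $x\ge x_c:=1/\sqrt{2+\sqrt2}$, and $Z(x)<+\infty$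 for all $0\le x<x_c$. -/

import Mathlib

open Filter Topology
open scoped NNReal ENNReal

/-- Vertices of the hexagonal lattice: two for each cell of a triangular Bravais lattice,
distinguished by the Boolean (the colour of the vertex). With `j = exp (2 * π * I / 3)`, the vertex
`(a, b, false)` is the point `a * (1 - j) + b * (1 - j⁻¹)` of the complex plane, and
`(a, b, true)` is the point `a * (1 - j) + b * (1 - j⁻¹) + 1`. -/
abbrev HexVertex : Type := ℤ × ℤ × Bool

/-- The hexagonal lattice (mesh size one). The neighbours of `(a, b, false)` are `(a, b, true)`,
`(a - 1, b, true)` and `(a, b - 1, true)`; in the plane they lie at the displacements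
`1`, `j` and `j⁻¹` from it. -/
def hexLattice : SimpleGraph HexVertex :=
  SimpleGraph.fromRel fun u v =>
    u.2.2 = false ∧ v.2.2 = true ∧
      ((v.1 = u.1 ∧ v.2.1 = u.2.1) ∨ (v.1 = u.1 - 1 ∧ v.2.1 = u.2.1) ∨
        (v.1 = u.1 ∧ v.2.1 = u.2.1 - 1))

/-- The number `c_n` of `n`-step self-avoiding walks on the hexagonal lattice that start at `v`
(with an arbitrary end-point). -/
noncomputable def hexSAWCount (v : HexVertex) (n : ℕ) : ℕ :=
  Set.ncard {p : Σ w : HexVertex, hexLattice.Walk v w | p.2.IsPath ∧ p.2.length = n}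

/-- A self-avoiding walk between mid-edges of the hexagonal lattice that starts at the mid-edge `a`
(a mid-edge is identified with its edge). It runs through
`midEdge 0, vertex 0, midEdge 1, vertex 1, …, vertex (length - 1), midEdge length`:
it enters each vertex along one edge, leaves it along another one, and visits every vertex at
most once. Its length is the number of vertices visited; the trivial walk has length zero. -/
structure MidEdgeSAW (a : hexLattice.edgeSet) where
  /-- The number of vertices visited. -/
  length : ℕ
  /-- The vertices visited, in order. -/
  vertex : Fin length → HexVertex
  /-- The mid-edges visited, in order. -/
  midEdge : Fin (length + 1) → hexLattice.edgeSet
  midEdge_zero : midEdge 0 = a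
  mem_castSucc : ∀ i : Fin length, vertex i ∈ (midEdge i.castSucc : Sym2 HexVertex)
  mem_succ : ∀ i : Fin length, vertex i ∈ (midEdge i.succ : Sym2 HexVertex)
  castSucc_ne_succ : ∀ i : Fin length, midEdge i.castSucc ≠ midEdge i.succ
  vertex_injective : Function.Injective vertex

/-- The partition function `Z(x) = ∑_γ x ^ ℓ(γ)` over all self-avoiding walks `γ` from the
mid-edge `a` to an arbitrary mid-edge, as an element of `[0, ∞]`. -/
noncomputable def hexPartition (a : hexLattice.edgeSet) (x : ℝ≥0) : ℝ≥0∞ :=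
  ∑' γ : MidEdgeSAW a, (x : ℝ≥0∞) ^ γ.length

/-!
A self-avoiding walk between mid-edges is determined by its first step and its list of left and
right turns, so the proof works with lists of Booleans: `turning` is the total turning in units of
`π / 3`, `visited` lists the vertices where the walk turns, as Eisenstein integers, and `wt S x` is
the generating function of a set `S` of lists. Let `x_c = 1 / (2 cos (π / 8)) = 1 / √(2 + √2)`.

*The exit identity.* Weigh a walk `l` by `obs x l = cos (π / 8 * turning l) * x ^ l.length`; this
is the real part of the parafermionic observable of Duminil-Copin and Smirnov, paired with the
direction of the last step. At `x = x_c` the weights of the two one-step continuations of `l` add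
up to the weight of `l` (`obs_add_obs`). In a domain `Ω` in the half-plane `0 < Re z`, a walk can
be continued in `Ω`, or its last step leaves `Ω`, or it has run into a vertex that it visited
before. Walks of the last kind cancel in pairs, given by the two orientations of the terminal loop
(`sum_trappedN`). By induction on the number of vertices, the total weight of the walks that have
left `Ω`, plus that of the walks with `n` vertices in `Ω`, is always `1` (`sum_exitN_add`).

*Total turning.* The cancellation and the weights of the exiting walks require that the turning be
known exactly, as an integer, and not modulo `6`. For this Hopf's proof of the Umlaufsatz is
discretised: two disjoint edges of the lattice are far enough apart for the angles between their
four end-points to satisfy an exchange relation, so the turning of a walk telescopes into the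
angles that the walk sweeps as seen from its two ends (`IsTrail.turning_eq`). A walk that ends at
an extremal point of a half-plane turns by at most `3` (`IsTrail.abs_turning_le`), and a terminal
loop turns by `-5` times the turn at which it starts, since it does not wind around the vertices
visited before (`IsTrail.turning_loop`).

*The critical point.* In a strip that consists of `k` columns, the walks that exit are the arches
(turning `±3`, weight `cos (3 * π / 8)`) and the bridges (turning `0`, weight `1`). Truncating the
strip to finite trapezoids gives `wt (bridges k) x_c ≤ 1`. If `wt saws x_c` were finite, the
identity would hold exactly in every strip; since an arch that leaves a narrower strip splits into
two bridges, the numbers `b k = wt (bridges k) x_c` would satisfy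
`b k ≤ b (k + 1) + C * b (k + 1) ^ 2`, which is incompatible with `∑ b k ≤ wt saws x_c < ∞`. Hence
`wt saws x_c = ∞` (`wt_saws_critical`).

*Below the critical point.* There `wt (bridges k) x ≤ (x / x_c) ^ k`. As in the theorem of
Hammersley and Welsh, walks are cut at the last visit to their rightmost vertices (`exists_cut`).
This bounds the walks in wider strips by the walks in narrower ones with a factor
`1 + C * (x / x_c) ^ k`, and then all walks by half-plane walks, so `wt saws x < ∞`
(`wt_saws_subcritical`).

*The lattice.* Walks from a mid-edge are lists of turns up to the choice of one of two directions
of the starting edge, so `wt saws ≤ hexPartition a ≤ 2 * wt saws`. Likewise `hexSAWCount v n`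
agrees with the number of self-avoiding lists of `n + 1` turns up to factors of `2`. The latter
numbers are submultiplicative, and by Fekete's lemma their growth rate is the inverse of the radius
of convergence.
-/

namespace Honeycomb

open scoped QuadraticAlgebra

/-! ### Eisenstein integers and the six lattice directions -/

/-- The Eisenstein integers `ℤ[ζ]`, where `ζ = exp (π * I / 3)` satisfies `ζ ^ 2 = ζ - 1`.
The element `⟨m, n⟩` stands for `m + n * ζ`. -/
abbrev Eis : Type := QuadraticAlgebra ℤ (-1) 1

/-- The primitive sixth root of unity, as a unit of `Eis`. -/
def zeta : Eisˣ where
  val := ⟨0, 1⟩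
  inv := ⟨1, -1⟩
  val_inv := by ext <;> simp
  inv_val := by ext <;> simp

/-- The direction `ζ ^ k`. The exponent is an integer, not a residue, so that it can record the
total turning of a walk. -/
def dir (k : ℤ) : Eis := ((zeta ^ k : Eisˣ) : Eis)

@[simp] lemma dir_zero : dir 0 = 1 := by simp [dir]

lemma dir_add (k l : ℤ) : dir (k + l) = dir k * dir l := by simp [dir, zpow_add]

@[simp] lemma dir_one : dir 1 = ⟨0, 1⟩ := by simp [dir, zeta]

@[simp] lemma dir_two : dir 2 = ⟨-1, 1⟩ := by
  rw [show (2 : ℤ) = 1 + 1 by norm_num, dir_add, dir_one]; ext <;> simp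

@[simp] lemma dir_three : dir 3 = -1 := by
  rw [show (3 : ℤ) = 2 + 1 by norm_num, dir_add, dir_one, dir_two]; ext <;> simp

lemma dir_add_three (k : ℤ) : dir (k + 3) = -dir k := by simp [dir_add]

lemma dir_sub_three (k : ℤ) : dir (k - 3) = -dir k := by
  have := dir_add_three (k - 3)
  rw [sub_add_cancel] at this
  rw [this, neg_neg]

lemma dir_mul_neg (k : ℤ) : dir k * dir (-k) = 1 := by rw [← dir_add]; simp

lemma dir_ne_zero (k : ℤ) : dir k ≠ 0 := (zeta ^ k).ne_zero

lemma dir_mul_left_injective (k : ℤ) : Function.Injective (fun z => dir k * z) := by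
  exact fun x y h => (Units.mul_right_inj (zeta ^ k)).1 h

lemma dir_affine_injective (p : Eis) (k : ℤ) : Function.Injective (fun z => p + dir k * z) :=
  (add_right_injective p).comp (dir_mul_left_injective k)

lemma dir_add_six_mul (k n : ℤ) : dir (k + 6 * n) = dir k := by
  have h6 : (zeta ^ (6 : ℤ) : Eisˣ) = 1 := by
    ext1
    change dir 6 = 1
    rw [show (6 : ℤ) = 3 + 3 by norm_num, dir_add, dir_three]; simp
  simp [dir, zpow_add, zpow_mul, h6]

lemma dir_emod (k : ℤ) : dir k = dir (k % 6) := by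
  conv_lhs => rw [← Int.emod_add_mul_ediv k 6]
  exact dir_add_six_mul _ _

/-- The six directions in coordinates. -/
lemma dir_cases (k : ℤ) :
    (k % 6 = 0 ∧ dir k = ⟨1, 0⟩) ∨ (k % 6 = 1 ∧ dir k = ⟨0, 1⟩) ∨ (k % 6 = 2 ∧ dir k = ⟨-1, 1⟩) ∨
    (k % 6 = 3 ∧ dir k = ⟨-1, 0⟩) ∨ (k % 6 = 4 ∧ dir k = ⟨0, -1⟩) ∨
    (k % 6 = 5 ∧ dir k = ⟨1, -1⟩) := by
  have h4 : dir 4 = ⟨0, -1⟩ := by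
    rw [show (4 : ℤ) = 1 + 3 by norm_num, dir_add_three, dir_one]; ext <;> simp
  have h5 : dir 5 = ⟨1, -1⟩ := by
    rw [show (5 : ℤ) = 2 + 3 by norm_num, dir_add_three, dir_two]; ext <;> simp
  rw [dir_emod]
  have h := Int.emod_nonneg k (show (6 : ℤ) ≠ 0 by norm_num)
  have h' := Int.emod_lt_of_pos k (show (0 : ℤ) < 6 by norm_num)
  generalize k % 6 = r at *
  interval_cases r
  · left; exact ⟨rfl, by rw [dir_zero]; rfl⟩
  · right; left; exact ⟨rfl, dir_one⟩
  · right; right; left; exact ⟨rfl, dir_two⟩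
  · right; right; right; left; exact ⟨rfl, by rw [dir_three]; ext <;> simp⟩
  · right; right; right; right; left; exact ⟨rfl, h4⟩
  · right; right; right; right; right; exact ⟨rfl, h5⟩

lemma norm_eq (z : Eis) : z.norm = z.re * z.re + z.re * z.im + z.im * z.im := by
  rw [QuadraticAlgebra.norm_def]; ring

@[simp] lemma norm_dir (k : ℤ) : (dir k).norm = 1 := by
  rcases dir_cases k with h | h | h | h | h | h <;> rw [h.2, norm_eq] <;> simp

/-- The elements of norm one are the six directions; `k` may be prescribed up to six values. -/
lemma exists_dir_of_norm_eq_one {z : Eis} (h : z.norm = 1) (k : ℤ) :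
    ∃ r : ℤ, -2 ≤ r ∧ r ≤ 3 ∧ z = dir (k + r) := by
  have key : ∃ s : ℤ, z = dir s := by
    obtain ⟨m, n⟩ := z
    rw [norm_eq] at h
    simp only at h
    have h1 : 3 * m ^ 2 ≤ 4 := by nlinarith [sq_nonneg (m + 2 * n)]
    have h2 : 3 * n ^ 2 ≤ 4 := by nlinarith [sq_nonneg (2 * m + n)]
    have hm : -1 ≤ m ∧ m ≤ 1 := ⟨by nlinarith, by nlinarith⟩
    have hn : -1 ≤ n ∧ n ≤ 1 := ⟨by nlinarith, by nlinarith⟩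
    obtain ⟨hm1, hm2⟩ := hm
    obtain ⟨hn1, hn2⟩ := hn
    have c4 := dir_cases 4
    have c5 := dir_cases 5
    norm_num at c4 c5
    interval_cases m <;> interval_cases n <;> norm_num at h
    · exact ⟨3, by rw [dir_three]; ext <;> simp⟩
    · exact ⟨2, dir_two.symm⟩
    · exact ⟨4, c4.symm⟩
    · exact ⟨1, dir_one.symm⟩
    · exact ⟨5, c5.symm⟩
    · exact ⟨0, by rw [dir_zero]; rfl⟩
  obtain ⟨s, rfl⟩ := key
  refine ⟨(s - k + 2) % 6 - 2, by omega, by omega, ?_⟩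
  rw [dir_emod s, dir_emod (k + _)]
  congr 1
  omega

/-- The residue modulo three that distinguishes the two colours of vertices: honeycomb vertices
have residue `0` or `1`, centres of faces have residue `2`. -/
def colour (z : Eis) : ℤ := (z.re - z.im) % 3

lemma colour_add_dir (z : Eis) (k : ℤ) :
    colour (z + dir k) = (colour z + (if k % 2 = 0 then 1 else 2)) % 3 := by
  unfold colour
  rcases dir_cases k with h | h | h | h | h | h <;> split_ifs <;>
    simp only [h.2, QuadraticAlgebra.re_add, QuadraticAlgebra.im_add] <;> omega

lemma colour_dir_mul (z : Eis) (k : ℤ) :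
    colour (dir k * z) = if k % 2 = 0 then colour z else (- colour z) % 3 := by
  unfold colour
  rcases dir_cases k with h | h | h | h | h | h <;> split_ifs <;>
    simp only [h.2, QuadraticAlgebra.re_mul, QuadraticAlgebra.im_mul] <;> omega

/-- Twice the real part of `m + n * ζ`. -/
def abscissa (z : Eis) : ℤ := 2 * z.re + z.im

@[simp] lemma abscissa_zero : abscissa 0 = 0 := rfl
@[simp] lemma abscissa_one : abscissa 1 = 2 := rfl

@[simp] lemma abscissa_add (z w : Eis) : abscissa (z + w) = abscissa z + abscissa w := by
  simp [abscissa]; ring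

@[simp] lemma abscissa_sub (z w : Eis) : abscissa (z - w) = abscissa z - abscissa w := by
  simp [abscissa]; ring

@[simp] lemma abscissa_neg (z : Eis) : abscissa (-z) = -abscissa z := by
  simp [abscissa]; ring

lemma abscissa_emod (z : Eis) : abscissa z % 3 = (2 * colour z) % 3 := by
  unfold abscissa colour; omega

lemma abscissa_dir (k : ℤ) :
    (k % 6 = 0 ∧ abscissa (dir k) = 2) ∨ (k % 6 = 1 ∧ abscissa (dir k) = 1) ∨
    (k % 6 = 2 ∧ abscissa (dir k) = -1) ∨ (k % 6 = 3 ∧ abscissa (dir k) = -2) ∨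
    (k % 6 = 4 ∧ abscissa (dir k) = -1) ∨ (k % 6 = 5 ∧ abscissa (dir k) = 1) := by
  unfold abscissa
  rcases dir_cases k with h | h | h | h | h | h <;> simp [h.1, h.2]

/-! ### Walks as lists of turns -/

/-- The angle, in units of `π / 3`, of a turn: `true` is a left turn, `false` a right turn. -/
def sgn (t : Bool) : ℤ := if t then 1 else -1

@[simp] lemma sgn_true : sgn true = 1 := rfl
@[simp] lemma sgn_false : sgn false = -1 := rfl
@[simp] lemma sgn_not (t : Bool) : sgn (!t) = -sgn t := by cases t <;> rfl

lemma sgn_cases (t : Bool) : sgn t = 1 ∨ sgn t = -1 := by cases t <;> simp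

/-- The total turning of a list of turns, in units of `π / 3`. -/
def turning : List Bool → ℤ
  | [] => 0
  | t :: l => sgn t + turning l

/-- The last vertex visited by a walk given by its turns. The walk starts from `0` in the direction
`1`, performs its first turn at the vertex `1`, and so on; `0` itself does not count as visited, but
is the value at the empty list. -/
def pt : List Bool → Eis
  | [] => 0
  | t :: l => 1 + dir (sgn t) * pt l

/-- The vertices visited by a walk given by its turns: those where it turns. -/
def visited : List Bool → List Eis
  | [] => []
  | t :: l => 1 :: (visited l).map (fun z => 1 + dir (sgn t) * z)

/-- The vertex that the walk is about to visit after its last turn. -/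
def head (l : List Bool) : Eis := pt l + dir (turning l)

/-- A list of turns is self-avoiding if the vertices visited are distinct. The vertex `0` in front
of the first one and the vertex `head l` behind the last one are not taken into account. -/
def SAW (l : List Bool) : Prop := (visited l).Nodup

/-- The turns of the reversed walk. -/
def rev (l : List Bool) : List Bool := (l.map not).reverse

@[simp] lemma turning_nil : turning [] = 0 := rfl
@[simp] lemma turning_cons (t : Bool) (l : List Bool) : turning (t :: l) = sgn t + turning l := rfl
@[simp] lemma pt_nil : pt [] = 0 := rfl
lemma pt_cons (t : Bool) (l : List Bool) : pt (t :: l) = 1 + dir (sgn t) * pt l := rfl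
@[simp] lemma visited_nil : visited [] = [] := rfl
lemma visited_cons (t : Bool) (l : List Bool) :
    visited (t :: l) = 1 :: (visited l).map (fun z => 1 + dir (sgn t) * z) := rfl
@[simp] lemma head_nil : head [] = 1 := by simp [head]
@[simp] lemma saw_nil : SAW [] := List.nodup_nil
@[simp] lemma pt_singleton (t : Bool) : pt [t] = 1 := by simp [pt]

@[simp] lemma turning_append (l m : List Bool) : turning (l ++ m) = turning l + turning m := by
  induction l with
  | nil => simp
  | cons t l ih => simp [ih]; ring

lemma pt_append (l m : List Bool) : pt (l ++ m) = pt l + dir (turning l) * pt m := by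
  induction l with
  | nil => simp
  | cons t l ih => simp [pt_cons, ih, dir_add]; ring

lemma pt_concat (l : List Bool) (t : Bool) : pt (l ++ [t]) = head l := by
  simp [pt_append, head]

lemma head_append (l m : List Bool) : head (l ++ m) = pt l + dir (turning l) * head m := by
  simp [head, pt_append, dir_add]; ring

@[simp] lemma length_visited (l : List Bool) : (visited l).length = l.length := by
  induction l with
  | nil => rfl
  | cons t l ih => simp [visited_cons, ih]

lemma visited_append (l m : List Bool) :
    visited (l ++ m) = visited l ++ (visited m).map (fun z => pt l + dir (turning l) * z) := by
  induction l with
  | nil => simp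
  | cons t l ih =>
    simp only [List.cons_append, visited_cons, ih, List.map_append, List.map_map, pt_cons,
      turning_cons]
    congr 3
    funext z
    simp [dir_add]; ring

lemma visited_singleton (t : Bool) : visited [t] = [1] := by simp [visited_cons]

lemma visited_concat (l : List Bool) (t : Bool) : visited (l ++ [t]) = visited l ++ [head l] := by
  simp [visited_append, visited_singleton, head]

lemma visited_subset_append (l m : List Bool) : visited l ⊆ visited (l ++ m) := by
  rw [visited_append]; exact List.subset_append_left _ _

/-- The visited vertices are the values of `pt` at the nonempty prefixes. -/
lemma mem_visited_iff {l : List Bool} {z : Eis} :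
    z ∈ visited l ↔ ∃ l₁ t l₂, l = l₁ ++ t :: l₂ ∧ z = head l₁ := by
  induction l using List.reverseRecOn with
  | nil => simp
  | append_singleton l s ih =>
    rw [visited_concat, List.mem_append, ih, List.mem_singleton]
    constructor
    · rintro (⟨l₁, t, l₂, rfl, rfl⟩ | rfl)
      · exact ⟨l₁, t, l₂ ++ [s], by simp, rfl⟩
      · exact ⟨l, s, [], rfl, rfl⟩
    · rintro ⟨l₁, t, l₂, h, rfl⟩
      rcases List.eq_nil_or_concat l₂ with rfl | ⟨l₃, u, rfl⟩
      · right
        exact congrArg head (List.append_inj' h (by simp)).1.symm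
      · left
        have : l ++ [s] = (l₁ ++ t :: l₃) ++ [u] := by simpa using h
        exact ⟨l₁, t, l₃, (List.append_inj' this (by simp)).1, rfl⟩

lemma saw_append_iff {l m : List Bool} : SAW (l ++ m) ↔ SAW l ∧ SAW m ∧
    ∀ z ∈ visited l, ∀ w ∈ visited m, z ≠ pt l + dir (turning l) * w := by
  unfold SAW
  rw [visited_append, List.nodup_append, List.nodup_map_iff (dir_affine_injective _ _)]
  simp only [List.mem_map, ne_eq, forall_exists_index, and_imp, forall_apply_eq_imp_iff₂]

lemma SAW.left {l m : List Bool} (h : SAW (l ++ m)) : SAW l := (saw_append_iff.1 h).1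

lemma SAW.right {l m : List Bool} (h : SAW (l ++ m)) : SAW m := (saw_append_iff.1 h).2.1

lemma saw_concat_iff {l : List Bool} {t : Bool} : SAW (l ++ [t]) ↔ SAW l ∧ head l ∉ visited l := by
  unfold SAW
  rw [visited_concat, List.nodup_append]
  simp only [List.nodup_cons, List.not_mem_nil, not_false_eq_true, List.nodup_nil, and_self,
    List.mem_cons, or_false, forall_eq, true_and, ne_eq, and_congr_right_iff]
  intro _
  constructor
  · intro h hm; exact h _ hm rfl
  · rintro h a ha rfl; exact h ha

@[simp] lemma rev_nil : rev [] = [] := rfl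
@[simp] lemma rev_cons (t : Bool) (l : List Bool) : rev (t :: l) = rev l ++ [!t] := by simp [rev]
@[simp] lemma rev_append (l m : List Bool) : rev (l ++ m) = rev m ++ rev l := by simp [rev]
@[simp] lemma rev_rev (l : List Bool) : rev (rev l) = l := by
  simp [rev, List.map_reverse, Bool.involutive_not.comp_self]
@[simp] lemma length_rev (l : List Bool) : (rev l).length = l.length := by simp [rev]

@[simp] lemma turning_rev (l : List Bool) : turning (rev l) = -turning l := by
  induction l with
  | nil => simp
  | cons t l ih => simp [ih]

lemma pt_rev (l : List Bool) : head l - dir (turning l) * pt (rev l) = 1 := by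
  induction l with
  | nil => simp
  | cons t l ih =>
    have h1 : head (t :: l) = 1 + dir (sgn t) * head l := by simp [head, pt_cons, dir_add]; ring
    have h2 : head (rev l) = pt (rev l) + dir (-turning l) := by rw [head, turning_rev]
    rw [rev_cons, pt_concat, turning_cons, dir_add, h1, h2]
    linear_combination dir (sgn t) * ih - dir (sgn t) * dir_mul_neg (turning l)

/-- The reversed walk, placed so that it starts against the last step of `l`, visits the same
vertices. -/
lemma visited_rev (l : List Bool) :
    (visited (rev l)).map (fun z => head l - dir (turning l) * z) = (visited l).reverse := by
  induction l with
  | nil => simp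
  | cons t l ih =>
    have h1 : head (t :: l) = 1 + dir (sgn t) * head l := by simp [head, pt_cons, dir_add]; ring
    rw [rev_cons, visited_concat, visited_cons, List.map_append, List.reverse_cons,
      ← List.map_reverse, ← ih, List.map_map]
    congr 1
    · apply List.map_congr_left
      intro z _
      simp [h1, dir_add]; ring
    · have := pt_rev l
      simp only [List.map_cons, List.map_nil, List.cons.injEq, and_true, head, turning_rev]
      rw [← head, h1, turning_cons, dir_add]
      linear_combination dir (sgn t) * this - dir (sgn t) * dir_mul_neg (turning l)

lemma saw_rev_iff {l : List Bool} : SAW (rev l) ↔ SAW l := by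
  unfold SAW
  rw [← List.nodup_reverse (l := visited l), ← visited_rev, List.nodup_map_iff]
  intro x y h
  exact dir_mul_left_injective _ (sub_right_injective h)

lemma mem_visited_rev {l : List Bool} {z : Eis} :
    z ∈ visited (rev l) ↔ head l - dir (turning l) * z ∈ visited l := by
  rw [← List.mem_reverse (as := visited l), ← visited_rev, List.mem_map_of_injective]
  intro x y h
  exact dir_mul_left_injective _ (sub_right_injective h)

lemma turning_emod_two (l : List Bool) : turning l % 2 = l.length % 2 := by
  induction l with
  | nil => rfl
  | cons t l ih =>
    rcases sgn_cases t with h | h <;> simp only [turning_cons, List.length_cons, h] <;> omega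

lemma colour_pt (l : List Bool) : colour (pt l) = l.length % 2 := by
  induction l using List.reverseRecOn with
  | nil => rfl
  | append_singleton l t ih =>
    have := turning_emod_two l
    rw [pt_concat, head, colour_add_dir, ih]
    simp only [List.length_append, List.length_singleton]
    split_ifs <;> omega

lemma colour_head (l : List Bool) : colour (head l) = (l.length + 1) % 2 := by
  rw [← pt_concat l true, colour_pt]; simp

lemma colour_of_mem_visited {l : List Bool} {z : Eis} (h : z ∈ visited l) :
    colour z = 0 ∨ colour z = 1 := by
  obtain ⟨l₁, t, l₂, rfl, rfl⟩ := mem_visited_iff.1 h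
  rw [colour_head]; omega

lemma abscissa_head_emod (l : List Bool) :
    abscissa (head l) % 3 = if turning l % 2 = 0 then 2 else 0 := by
  have h1 := abscissa_emod (head l)
  have h2 := colour_head l
  have h3 := turning_emod_two l
  split_ifs <;> omega

lemma abscissa_pt_emod (l : List Bool) :
    abscissa (pt l) % 3 = if turning l % 2 = 0 then 0 else 2 := by
  have h1 := abscissa_emod (pt l)
  have h2 := colour_pt l
  have h3 := turning_emod_two l
  split_ifs <;> omega

/-! ### Angles in the plane -/

/-- The embedding of the Eisenstein integers into the complex plane. -/
noncomputable def toC : Eis →+* ℂ where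
  toFun z := ⟨z.re + z.im / 2, z.im * (Real.sqrt 3 / 2)⟩
  map_one' := by apply Complex.ext <;> simp
  map_zero' := by apply Complex.ext <;> simp
  map_add' z w := by apply Complex.ext <;> simp <;> ring
  map_mul' z w := by
    have h3 : Real.sqrt 3 * Real.sqrt 3 = 3 := Real.mul_self_sqrt (by norm_num)
    apply Complex.ext
    · simp; linear_combination (z.im * w.im / 4 : ℝ) * h3
    · simp; ring

lemma toC_re (z : Eis) : (toC z).re = (abscissa z : ℝ) / 2 := by
  simp [toC, abscissa]; ring

lemma normSq_toC (z : Eis) : Complex.normSq (toC z) = (z.norm : ℝ) := by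
  have h3 : Real.sqrt 3 * Real.sqrt 3 = 3 := Real.mul_self_sqrt (by norm_num)
  rw [norm_eq, Complex.normSq_apply]
  simp [toC]
  linear_combination (z.im * z.im / 4 : ℝ) * h3

lemma norm_nonneg' (z : Eis) : 0 ≤ z.norm := by
  rw [norm_eq]; nlinarith [sq_nonneg (z.re + z.im), sq_nonneg z.re, sq_nonneg z.im]

lemma norm_eq_zero' {z : Eis} (h : z.norm = 0) : z = 0 := by
  rw [norm_eq] at h
  have h1 : z.re = 0 := by
    have : 3 * z.re ^ 2 ≤ 0 := by nlinarith [sq_nonneg (z.re + 2 * z.im)]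
    exact pow_eq_zero_iff (two_ne_zero) |>.1 (le_antisymm (by linarith) (sq_nonneg _))
  have h2 : z.im = 0 := by
    rw [h1] at h
    have : z.im ^ 2 = 0 := by linarith
    exact pow_eq_zero_iff (two_ne_zero) |>.1 this
  ext <;> simp [h1, h2]

lemma toC_eq_zero {z : Eis} : toC z = 0 ↔ z = 0 := by
  constructor
  · intro h
    apply norm_eq_zero'
    have := normSq_toC z
    rw [h, map_zero] at this
    exact_mod_cast this.symm
  · rintro rfl; exact map_zero _

lemma toC_ne_zero {z : Eis} (h : z ≠ 0) : toC z ≠ 0 := mt toC_eq_zero.1 h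

lemma toC_dir_one : toC (dir 1) = Complex.exp ((Real.pi / 3 : ℝ) * Complex.I) := by
  rw [Complex.exp_mul_I, ← Complex.ofReal_cos, ← Complex.ofReal_sin, Real.cos_pi_div_three,
    Real.sin_pi_div_three, dir_one]
  apply Complex.ext <;> simp [toC]

/-- The oriented angle from `x` to `y`, in `(-π, π]`. -/
noncomputable def angle (x y : Eis) : ℝ := (toC y / toC x).arg

lemma angle_neg_neg (x y : Eis) : angle (-x) (-y) = angle x y := by
  simp [angle, neg_div_neg_eq]

lemma angle_dir_add_one (k : ℤ) : angle (dir k) (dir (k + 1)) = Real.pi / 3 := by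
  have hk := toC_ne_zero (dir_ne_zero k)
  rw [angle, dir_add, map_mul, mul_div_assoc, mul_comm, div_mul_cancel₀ _ hk, toC_dir_one,
    Complex.arg_exp_mul_I, toIocMod_eq_self]
  constructor <;> linarith [Real.pi_pos]

lemma angle_dir_sub_one (k : ℤ) : angle (dir k) (dir (k - 1)) = -(Real.pi / 3) := by
  have h := angle_dir_add_one (k - 1)
  rw [sub_add_cancel] at h
  unfold angle at *
  rw [← inv_div, Complex.arg_inv, h, if_neg]
  linarith [Real.pi_pos]

lemma angle_dir_add_sgn {k s : ℤ} (hs : s = 1 ∨ s = -1) :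
    angle (dir k) (dir (k + s)) = s * (Real.pi / 3) := by
  rcases hs with rfl | rfl
  · rw [angle_dir_add_one]; push_cast; ring
  · rw [← sub_eq_add_neg, angle_dir_sub_one]; push_cast; ring

/-- The half-plane `{z | 0 < Re (z / u)}` does not surround the origin, so there the angle is the
difference of two arguments. One of the two vectors may even lie on the boundary. -/
lemma angle_eq_sub_aux {u : ℂ} (hu : u ≠ 0) {x y : Eis} (hx0 : x ≠ 0) (hy0 : y ≠ 0)
    (hx : 0 ≤ (toC x / u).re) (hy : 0 ≤ (toC y / u).re)
    (h : 0 < (toC x / u).re ∨ 0 < (toC y / u).re) :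
    angle x y = (toC y / u).arg - (toC x / u).arg := by
  have hx1 := Complex.abs_arg_le_pi_div_two_iff.2 hx
  have hy1 := Complex.abs_arg_le_pi_div_two_iff.2 hy
  have hx2 : toC x / u ≠ 0 := div_ne_zero (toC_ne_zero hx0) hu
  have hy2 : toC y / u ≠ 0 := div_ne_zero (toC_ne_zero hy0) hu
  have hxy : toC y / toC x = (toC y / u) / (toC x / u) := by
    field_simp [hu, toC_ne_zero hx0]
  rw [abs_le] at hx1 hy1
  have hpi := Real.pi_pos
  have hmem : (toC y / u).arg - (toC x / u).arg ∈ Set.Ioc (-Real.pi) Real.pi := by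
    refine ⟨?_, by linarith [hx1.1, hy1.2]⟩
    rcases h with h | h
    · have := abs_lt.1 (Complex.abs_arg_lt_pi_div_two_iff.2 (Or.inl h))
      linarith [hy1.1, this.2]
    · have := abs_lt.1 (Complex.abs_arg_lt_pi_div_two_iff.2 (Or.inl h))
      linarith [hx1.2, this.1]
  have hco := Complex.arg_div_coe_angle hy2 hx2
  rw [angle, hxy]
  rw [← Real.Angle.coe_sub] at hco
  have h3 := congrArg Real.Angle.toReal hco
  rwa [Complex.arg_coe_angle_toReal_eq_arg, Real.Angle.toReal_coe_eq_self_iff.2 hmem] at h3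

lemma angle_eq_sub {u : ℂ} {x y : Eis} (hx : 0 < (toC x / u).re) (hy : 0 < (toC y / u).re) :
    angle x y = (toC y / u).arg - (toC x / u).arg := by
  have hu : u ≠ 0 := by rintro rfl; simp at hx
  refine angle_eq_sub_aux hu ?_ ?_ hx.le hy.le (Or.inl hx)
  · rintro rfl; simp at hx
  · rintro rfl; simp at hy

/-- The angles of a triangle whose sides include two consecutive steps of a walk. -/
lemma angle_add_angle_step {k s : ℤ} (hs : s = 1 ∨ s = -1) :
    angle (dir k) (dir k + dir (k + s)) + angle (dir k + dir (k + s)) (dir (k + s)) =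
      s * (Real.pi / 3) ∧
    angle (dir k + dir (k + s)) (dir (k + s)) - angle (dir k + dir (k + s)) (dir k) =
      s * (Real.pi / 3) := by
  have hk := toC_ne_zero (dir_ne_zero k)
  have hs' : 0 < (toC (dir s)).re := by
    rw [toC_re]
    have : abscissa (dir s) = 1 := by
      rcases abscissa_dir s with h | h | h | h | h | h <;> first | exact h.2 | omega
    rw [this]; norm_num
  have e1 : toC (dir k) / toC (dir k) = 1 := div_self hk
  have e2 : toC (dir (k + s)) / toC (dir k) = toC (dir s) := by
    rw [dir_add, map_mul, mul_div_cancel_left₀ _ hk]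
  have p1 : 0 < (toC (dir k) / toC (dir k)).re := by rw [e1]; simp
  have p2 : 0 < (toC (dir (k + s)) / toC (dir k)).re := by rwa [e2]
  have p3 : 0 < (toC (dir k + dir (k + s)) / toC (dir k)).re := by
    rw [map_add, add_div, Complex.add_re]; linarith
  rw [← angle_dir_add_sgn (k := k) hs, angle_eq_sub p1 p3, angle_eq_sub p3 p2, angle_eq_sub p1 p2,
    angle_eq_sub p3 p1]
  constructor <;> ring

lemma norm_parallelogram (z w : Eis) :
    (z + w).norm + (z - w).norm = 2 * z.norm + 2 * w.norm := by
  simp only [norm_eq, QuadraticAlgebra.re_add, QuadraticAlgebra.im_add, QuadraticAlgebra.re_sub,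
    QuadraticAlgebra.im_sub]
  ring

/-- Distinct vertices of the same colour are at distance at least `√3`. -/
lemma three_le_norm_sub {z w : Eis} (h : colour z = colour w) (hne : z ≠ w) :
    3 ≤ (z - w).norm := by
  have h1 : (z - w).norm ≠ 0 := fun h0 => hne (sub_eq_zero.1 (norm_eq_zero' h0))
  have h2 := norm_nonneg' (z - w)
  obtain ⟨c, hc⟩ : ∃ c, (z - w).re = (z - w).im + 3 * c := by
    unfold colour at h
    refine ⟨((z - w).re - (z - w).im) / 3, ?_⟩
    simp only [QuadraticAlgebra.re_sub, QuadraticAlgebra.im_sub]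
    omega
  have h3 : (z - w).norm = 3 * ((z - w).im ^ 2 + 3 * c * (z - w).im + 3 * c ^ 2) := by
    rw [norm_eq, hc]; ring
  omega

lemma colour_ne_of_norm_sub {z w : Eis} (h : (z - w).norm = 1) : colour z ≠ colour w := by
  intro hc
  have hne : z ≠ w := by rintro rfl; simp at h
  have := three_le_norm_sub hc hne
  omega

lemma colour_lt_three (z : Eis) : 0 ≤ colour z ∧ colour z < 3 := by
  unfold colour; omega

/-- The midpoints of two disjoint edges of the honeycomb are at distance more than one. -/
lemma four_lt_norm_of_disjoint {p p' q q' : Eis} (hp : (p' - p).norm = 1)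
    (hq : (q' - q).norm = 1) (cp : colour p ≠ 2) (cp' : colour p' ≠ 2) (cq : colour q ≠ 2)
    (cq' : colour q' ≠ 2) (h1 : p ≠ q) (h2 : p ≠ q') (h3 : p' ≠ q) (h4 : p' ≠ q') :
    4 < (q + q' - (p + p')).norm := by
  have key : ∀ {a a' b b' : Eis}, colour a = colour b → colour a' = colour b' → a ≠ b → a' ≠ b' →
      (a' - a).norm = 1 → (b' - b).norm = 1 → 4 < (b + b' - (a + a')).norm := by
    intro a a' b b' c c' n n' e e'
    have i1 := three_le_norm_sub c.symm n.symm
    have i2 := three_le_norm_sub c'.symm n'.symm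
    have i3 := norm_parallelogram (b - a) (b' - a')
    have i4 := norm_parallelogram (b' - b) (a' - a)
    have i5 := norm_nonneg' ((b' - b) + (a' - a))
    have i6 : (b - a - (b' - a')).norm = (b' - b - (a' - a)).norm := by
      rw [← QuadraticAlgebra.norm_neg]; congr 1; ring
    have i7 : b + b' - (a + a') = b - a + (b' - a') := by ring
    rw [i7]
    linarith
  have c1 := colour_ne_of_norm_sub hp
  have c2 := colour_ne_of_norm_sub hq
  have b1 := colour_lt_three p
  have b2 := colour_lt_three p'
  have b3 := colour_lt_three q
  have b4 := colour_lt_three q'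
  by_cases hc : colour p = colour q
  · exact key hc (by omega) h1 h4 hp hq
  · have := key (a := p) (a' := p') (b := q') (b' := q) (by omega) (by omega) h2 h3 hp
      (by rw [← QuadraticAlgebra.norm_neg, neg_sub]; exact hq)
    rwa [add_comm q' q] at this

/-- If one end of a vector moves along an edge of the honeycomb, and the other end along a disjoint
edge, the vector does not turn around the origin. -/
lemma angle_exchange {p p' q q' : Eis} (hp : (p' - p).norm = 1)
    (hq : (q' - q).norm = 1) (cp : colour p ≠ 2) (cp' : colour p' ≠ 2) (cq : colour q ≠ 2)
    (cq' : colour q' ≠ 2) (h1 : p ≠ q) (h2 : p ≠ q') (h3 : p' ≠ q) (h4 : p' ≠ q') :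
    angle (q - p) (q' - p) + angle (q' - p) (q' - p') =
      angle (q - p) (q - p') + angle (q - p') (q' - p') := by
  have hD := four_lt_norm_of_disjoint hp hq cp cp' cq cq' h1 h2 h3 h4
  set D := q + q' - (p + p') with hDdef
  -- All four vectors lie in the half-plane centred at `D`, the sum of two opposite ones.
  have hnorm : ∀ e : Eis, e.norm = 1 → ‖toC e‖ = 1 := by
    intro e he
    have h := normSq_toC e
    rw [he, Complex.normSq_eq_norm_sq] at h
    exact (pow_eq_one_iff_of_nonneg (norm_nonneg _) two_ne_zero).1 (by simpa using h)
  have hDn : 2 < ‖toC D‖ := by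
    have h := normSq_toC D
    rw [Complex.normSq_eq_norm_sq] at h
    have h4' : (4 : ℝ) < (D.norm : ℝ) := by exact_mod_cast hD
    nlinarith [norm_nonneg (toC D)]
  have hD0 : toC D ≠ 0 := by intro h; rw [h, norm_zero] at hDn; linarith
  have main : ∀ z e e' : Eis, e.norm = 1 → e'.norm = 1 → 2 * z = D + e + e' →
      0 < (toC z / toC D).re := by
    intro z e e' he he' hz
    have hz' : 2 * toC z = toC D + toC e + toC e' := by
      have := congrArg toC hz
      simpa only [map_add, map_mul, map_ofNat] using this
    have hdiv : toC z / toC D = 1 / 2 + (toC e + toC e') / (2 * toC D) := by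
      field_simp
      linear_combination hz'
    have hle : ‖(toC e + toC e') / (2 * toC D)‖ < 1 / 2 := by
      rw [norm_div, norm_mul, div_lt_iff₀ (by simp; exact hD0)]
      have := norm_add_le (toC e) (toC e')
      rw [hnorm e he, hnorm e' he'] at this
      simp
      linarith
    have hre := (abs_le.1 (Complex.abs_re_le_norm ((toC e + toC e') / (2 * toC D)))).1
    rw [hdiv, Complex.add_re]
    norm_num
    linarith
  have hpn : (p - p').norm = 1 := by rw [← QuadraticAlgebra.norm_neg, neg_sub]; exact hp
  have hqn : (q - q').norm = 1 := by rw [← QuadraticAlgebra.norm_neg, neg_sub]; exact hq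
  have r1 := main (q - p) (q - q') (p' - p) hqn hp (by rw [hDdef]; ring)
  have r2 := main (q' - p) (q' - q) (p' - p) hq hp (by rw [hDdef]; ring)
  have r3 := main (q - p') (q - q') (p - p') hqn hpn (by rw [hDdef]; ring)
  have r4 := main (q' - p') (q' - q) (p - p') hq hpn (by rw [hDdef]; ring)
  rw [angle_eq_sub r1 r2, angle_eq_sub r2 r4, angle_eq_sub r1 r3, angle_eq_sub r3 r4]
  ring

/-! ### The total turning of a self-avoiding walk -/

/-- `IsTrail w k N`: the points `w 0, …, w (N + 1)` are consecutive vertices of a walk on the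
honeycomb, and `k i` is the direction of the step from `w i` to `w (i + 1)`, lifted to the integers
along the walk. -/
structure IsTrail (w : ℕ → Eis) (k : ℕ → ℤ) (N : ℕ) : Prop where
  step : ∀ i ≤ N, w (i + 1) = w i + dir (k i)
  turn : ∀ i < N, k (i + 1) = k i + 1 ∨ k (i + 1) = k i - 1
  col : ∀ i ≤ N + 1, colour (w i) ≠ 2

lemma IsTrail.mono {w : ℕ → Eis} {k : ℕ → ℤ} {N M : ℕ} (h : IsTrail w k N) (hM : M ≤ N) :
    IsTrail w k M :=
  ⟨fun i hi => h.step i (by omega), fun i hi => h.turn i (by omega), fun i hi => h.col i (by omega)⟩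

lemma IsTrail.shift {w : ℕ → Eis} {k : ℕ → ℤ} {N m M : ℕ} (h : IsTrail w k N) (hM : m + M ≤ N) :
    IsTrail (fun i => w (m + i)) (fun i => k (m + i)) M :=
  ⟨fun i hi => h.step (m + i) (by omega), fun i hi => h.turn (m + i) (by omega),
    fun i hi => h.col (m + i) (by omega)⟩

lemma IsTrail.norm_step {w : ℕ → Eis} {k : ℕ → ℤ} {N : ℕ} (h : IsTrail w k N) {i : ℕ}
    (hi : i ≤ N) : (w (i + 1) - w i).norm = 1 := by
  rw [h.step i hi, add_sub_cancel_left, norm_dir]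

/-- `angle_exchange` for two edges of a walk. -/
lemma IsTrail.exchange {w : ℕ → Eis} {k : ℕ → ℤ} {N : ℕ} (h : IsTrail w k N) {s t : ℕ}
    (hs : s ≤ N) (ht : t ≤ N) (h1 : w s ≠ w t) (h2 : w s ≠ w (t + 1)) (h3 : w (s + 1) ≠ w t)
    (h4 : w (s + 1) ≠ w (t + 1)) :
    angle (w t - w s) (w (t + 1) - w s) + angle (w (t + 1) - w s) (w (t + 1) - w (s + 1)) =
      angle (w t - w s) (w t - w (s + 1)) + angle (w t - w (s + 1)) (w (t + 1) - w (s + 1)) :=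
  angle_exchange (h.norm_step hs) (h.norm_step ht) (h.col s (by omega)) (h.col _ (by omega))
    (h.col t (by omega)) (h.col _ (by omega)) h1 h2 h3 h4

/-- The angles at the three vertices of two consecutive steps. -/
lemma IsTrail.corner {w : ℕ → Eis} {k : ℕ → ℤ} {N : ℕ} (h : IsTrail w k N) {i : ℕ} (hi : i < N) :
    angle (w (i + 1) - w i) (w (i + 2) - w i) + angle (w (i + 2) - w i) (w (i + 2) - w (i + 1)) =
      (k (i + 1) - k i) * (Real.pi / 3) := by
  have e1 := h.step i (by omega)
  have e2 : w (i + 2) = w (i + 1) + dir (k (i + 1)) := h.step (i + 1) (by omega)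
  obtain ⟨s, hs, hk⟩ : ∃ s : ℤ, (s = 1 ∨ s = -1) ∧ k (i + 1) = k i + s := by
    rcases h.turn i hi with h | h
    · exact ⟨1, Or.inl rfl, h⟩
    · exact ⟨-1, Or.inr rfl, h⟩
  rw [show w (i + 2) - w (i + 1) = dir (k (i + 1)) by rw [e2]; ring,
    show w (i + 2) - w i = dir (k i) + dir (k (i + 1)) by rw [e2, e1]; ring,
    show w (i + 1) - w i = dir (k i) by rw [e1]; ring, hk, (angle_add_angle_step hs).1]
  push_cast; ring

/-- Discrete form of Hopf's theorem on the rotation of the tangent: the total turning of a simple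
path is the angle swept by the rest of the path as seen from its starting point, plus the angle
swept by the path as seen from its end point. -/
theorem IsTrail.turning_eq {w : ℕ → Eis} {k : ℕ → ℤ} {N : ℕ} (h : IsTrail w k N)
    (inj : ∀ i j, i < j → j ≤ N + 1 → w i ≠ w j) :
    ∑ t ∈ Finset.range N, angle (w (t + 1) - w 0) (w (t + 2) - w 0) +
      ∑ s ∈ Finset.range N, angle (w (N + 1) - w s) (w (N + 1) - w (s + 1)) =
      (k N - k 0) * (Real.pi / 3) := by
  induction N with
  | zero => simp
  | succ N ih =>
    have ih := ih (h.mono (by omega)) (fun i j hij hj => inj i j hij (by omega))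
    have hc := h.corner (i := N) (by omega)
    have tele : ∑ s ∈ Finset.range N, (angle (w (N + 2) - w s) (w (N + 2) - w (s + 1)) -
        angle (w (N + 1) - w s) (w (N + 1) - w (s + 1))) =
        angle (w (N + 1) - w N) (w (N + 2) - w N) - angle (w (N + 1) - w 0) (w (N + 2) - w 0) := by
      rw [← Finset.sum_range_sub (fun s => angle (w (N + 1) - w s) (w (N + 2) - w s))]
      apply Finset.sum_congr rfl
      intro s hs
      have hs := Finset.mem_range.1 hs
      have := h.exchange (s := s) (t := N + 1) (by omega) (by omega)
        (inj _ _ (by omega) (by omega)) (inj _ _ (by omega) (by omega))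
        (inj _ _ (by omega) (by omega)) (inj _ _ (by omega) (by omega))
      simp only [add_assoc, Nat.reduceAdd] at this ⊢
      linarith
    rw [Finset.sum_sub_distrib] at tele
    rw [Finset.sum_range_succ, Finset.sum_range_succ]
    simp only [add_assoc, Nat.reduceAdd] at *
    linarith

/-- A walk from the boundary of the half-plane `0 < Re z` to a point that is extremal in the
direction of the last step makes at most half a turn in total. -/
theorem IsTrail.abs_turning_le {w : ℕ → Eis} {k : ℕ → ℤ} {N : ℕ} (h : IsTrail w k N)
    (inj : ∀ i j, i < j → j ≤ N + 1 → w i ≠ w j) (w0 : w 0 = 0) (k0 : k 0 = 0)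
    (hpos : ∀ i, 1 ≤ i → i ≤ N → 0 < abscissa (w i)) (hend : 0 ≤ abscissa (w (N + 1)))
    (hext : ∀ i, 1 ≤ i → i ≤ N → 0 < abscissa (dir (-k N) * (w (N + 1) - w i)))
    (hext0 : 0 ≤ abscissa (dir (-k N) * w (N + 1))) : |k N| ≤ 3 := by
  have hopf := h.turning_eq inj
  have w1 : w 1 = 1 := by rw [h.step 0 (by omega), w0, k0]; simp
  have hne : ∀ i, 1 ≤ i → i ≤ N + 1 → w i ≠ 0 := fun i h1 h2 => by
    rw [← w0]; exact (inj 0 i (by omega) h2).symm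
  have hu : toC (dir (k N)) ≠ 0 := toC_ne_zero (dir_ne_zero _)
  have hdiv : ∀ z, toC z / toC (dir (k N)) = toC (dir (-k N) * z) := by
    intro z
    rw [div_eq_iff hu, ← map_mul]
    congr 1
    linear_combination -z * dir_mul_neg (k N)
  have s1 : ∑ t ∈ Finset.range N, angle (w (t + 1) - w 0) (w (t + 2) - w 0) =
      (toC (w (N + 1))).arg := by
    have : (toC (w (N + 1))).arg = (toC (w (N + 1)) / 1).arg - (toC (w (0 + 1)) / 1).arg := by
      simp [w1]
    rw [this, ← Finset.sum_range_sub (fun t => (toC (w (t + 1)) / 1).arg)]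
    apply Finset.sum_congr rfl
    intro t ht
    have ht := Finset.mem_range.1 ht
    have p1 : 0 < (toC (w (t + 1)) / 1).re := by
      rw [div_one, toC_re]
      have : (0 : ℝ) < abscissa (w (t + 1)) := by exact_mod_cast hpos (t + 1) (by omega) (by omega)
      linarith
    have p2 : 0 ≤ (toC (w (t + 1 + 1)) / 1).re := by
      rw [div_one, toC_re]
      have : (0 : ℝ) ≤ abscissa (w (t + 1 + 1)) := by
        rcases Nat.lt_or_ge (t + 1) N with h | h
        · exact_mod_cast (hpos (t + 1 + 1) (by omega) (by omega)).le
        · rw [show t + 1 = N by omega]; exact_mod_cast hend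
      linarith
    rw [w0, sub_zero, sub_zero]
    exact angle_eq_sub_aux one_ne_zero (hne _ (by omega) (by omega)) (hne _ (by omega) (by omega))
      p1.le p2 (Or.inl p1)
  have s2 : ∑ s ∈ Finset.range N, angle (w (N + 1) - w s) (w (N + 1) - w (s + 1)) =
      - (toC (dir (-k N) * w (N + 1))).arg := by
    have : - (toC (dir (-k N) * w (N + 1))).arg =
        (toC (w (N + 1) - w N) / toC (dir (k N))).arg -
          (toC (w (N + 1) - w 0) / toC (dir (k N))).arg := by
      rw [h.step N le_rfl, add_sub_cancel_left, div_self hu, w0, sub_zero, hdiv]; simp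
    rw [this, ← Finset.sum_range_sub (fun s => (toC (w (N + 1) - w s) / toC (dir (k N))).arg)]
    apply Finset.sum_congr rfl
    intro s hs
    have hs := Finset.mem_range.1 hs
    have p1 : 0 ≤ (toC (w (N + 1) - w s) / toC (dir (k N))).re := by
      rw [hdiv, toC_re]
      have : (0 : ℝ) ≤ abscissa (dir (-k N) * (w (N + 1) - w s)) := by
        rcases Nat.eq_zero_or_pos s with rfl | h
        · rw [w0, sub_zero]; exact_mod_cast hext0
        · exact_mod_cast (hext s h (by omega)).le
      linarith
    have p2 : 0 < (toC (w (N + 1) - w (s + 1)) / toC (dir (k N))).re := by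
      rw [hdiv, toC_re]
      have : (0 : ℝ) < abscissa (dir (-k N) * (w (N + 1) - w (s + 1))) := by
        exact_mod_cast hext (s + 1) (by omega) (by omega)
      linarith
    exact angle_eq_sub_aux hu (sub_ne_zero.2 (inj _ _ (by omega) (by omega)).symm)
      (sub_ne_zero.2 (inj _ _ (by omega) (by omega)).symm) p1 p2.le (Or.inr p2)
  rw [s1, s2, k0] at hopf
  have b1 : |(toC (w (N + 1))).arg| ≤ Real.pi / 2 := by
    rw [Complex.abs_arg_le_pi_div_two_iff, toC_re]
    have : (0 : ℝ) ≤ abscissa (w (N + 1)) := by exact_mod_cast hend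
    linarith
  have b2 : |(toC (dir (-k N) * w (N + 1))).arg| ≤ Real.pi / 2 := by
    rw [Complex.abs_arg_le_pi_div_two_iff, toC_re]
    have : (0 : ℝ) ≤ abscissa (dir (-k N) * w (N + 1)) := by exact_mod_cast hext0
    linarith
  rw [abs_le] at b1 b2
  have hpi := Real.pi_pos
  have : |(k N : ℝ)| ≤ 3 := by
    rw [abs_le]
    push_cast at hopf
    constructor
    · by_contra! hlt; nlinarith
    · by_contra! hlt; nlinarith
  exact_mod_cast this

/-- If a walk starts at the boundary of the half-plane `0 < Re z` and stays inside it, then a loop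
that closes up at `w (N + 1) = w m` does not wind around the vertices visited before `w m`. -/
lemma IsTrail.winding_eq_zero {w : ℕ → Eis} {k : ℕ → ℤ} {N m : ℕ} (h : IsTrail w k N)
    (inj : ∀ i j, i < j → j ≤ N → w i ≠ w j) (w0 : w 0 = 0)
    (hpos : ∀ i, 1 ≤ i → i ≤ N → 0 < abscissa (w i)) (hm : 1 ≤ m) (hmN : m ≤ N)
    (hclose : w (N + 1) = w m) {j : ℕ} (hj : j < m) :
    ∑ t ∈ Finset.range (N + 1 - m), angle (w (m + t) - w j) (w (m + t + 1) - w j) = 0 := by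
  induction j with
  | zero =>
    have hp : ∀ i, 1 ≤ i → i ≤ N + 1 → 0 < (toC (w i) / 1).re := by
      intro i h1 h2
      rw [div_one, toC_re]
      have : (0 : ℝ) < abscissa (w i) := by
        rcases Nat.lt_or_ge N i with h | h
        · rw [show i = N + 1 by omega, hclose]; exact_mod_cast hpos m hm hmN
        · exact_mod_cast hpos i h1 h
      linarith
    have : ∀ t ∈ Finset.range (N + 1 - m), angle (w (m + t) - w 0) (w (m + t + 1) - w 0) =
        (fun t => (toC (w (m + t)) / 1).arg) (t + 1) - (fun t => (toC (w (m + t)) / 1).arg) t := by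
      intro t ht
      have ht := Finset.mem_range.1 ht
      rw [w0, sub_zero, sub_zero]
      exact angle_eq_sub (hp _ (by omega) (by omega)) (hp _ (by omega) (by omega))
    refine (Finset.sum_congr rfl this).trans
      ((Finset.sum_range_sub (fun t => (toC (w (m + t)) / 1).arg) _).trans ?_)
    simp only [add_zero]
    rw [show m + (N + 1 - m) = N + 1 by omega, hclose, sub_self]
  | succ j ih =>
    have ih := ih (by omega)
    have inj' : ∀ i t, i < m → t ≤ N + 1 → m ≤ t → w i ≠ w t := by
      intro i t hi ht hmt
      rcases Nat.lt_or_ge N t with h | h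
      · rw [show t = N + 1 by omega, hclose]; exact inj _ _ hi hmN
      · exact inj _ _ (by omega) h
    have : ∑ t ∈ Finset.range (N + 1 - m), (angle (w (m + t) - w (j + 1))
        (w (m + t + 1) - w (j + 1)) - angle (w (m + t) - w j) (w (m + t + 1) - w j)) = 0 := by
      have e : ∀ t ∈ Finset.range (N + 1 - m), angle (w (m + t) - w (j + 1))
          (w (m + t + 1) - w (j + 1)) - angle (w (m + t) - w j) (w (m + t + 1) - w j) =
          (fun t => angle (w (m + t) - w j) (w (m + t) - w (j + 1))) (t + 1) -
          (fun t => angle (w (m + t) - w j) (w (m + t) - w (j + 1))) t := by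
        intro t ht
        have ht := Finset.mem_range.1 ht
        have := h.exchange (s := j) (t := m + t) (by omega) (by omega)
          (inj' _ _ (by omega) (by omega) (by omega)) (inj' _ _ (by omega) (by omega) (by omega))
          (inj' _ _ (by omega) (by omega) (by omega)) (inj' _ _ (by omega) (by omega) (by omega))
        simp only [← add_assoc]
        linarith
      refine (Finset.sum_congr rfl e).trans ((Finset.sum_range_sub
        (fun t => angle (w (m + t) - w j) (w (m + t) - w (j + 1))) _).trans ?_)
      simp only [add_zero]
      rw [show m + (N + 1 - m) = N + 1 by omega, hclose, sub_self]
    rw [Finset.sum_sub_distrib, ih, sub_zero] at this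
    exact this

/-- The total turning along a loop that the end of a walk makes with the walk: if the walk turns
left when it visits `w m` for the first time and returns to `w m` in the end, then the loop is
clockwise, and counterclockwise if it turns right. The edge through which the walk first came to
`w m` lies outside the loop, because the walk starts at the boundary of a half-plane; this excludes
the opposite orientation. -/
theorem IsTrail.turning_loop {w : ℕ → Eis} {k : ℕ → ℤ} {N m : ℕ} (h : IsTrail w k N)
    (inj : ∀ i j, i < j → j ≤ N → w i ≠ w j) (w0 : w 0 = 0)
    (hpos : ∀ i, 1 ≤ i → i ≤ N → 0 < abscissa (w i)) (hm : 1 ≤ m) (hmN : m ≤ N)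
    (hclose : w (N + 1) = w m) {s : ℤ} (hs : s = 1 ∨ s = -1) (hturn : k m = k (m - 1) + s) :
    k N = k m - 5 * s := by
  obtain ⟨j, rfl⟩ : ∃ j, m = j + 1 := ⟨m - 1, by omega⟩
  simp only [Nat.add_sub_cancel] at hturn
  have stepP := h.step j (by omega)
  have stepQ := h.step (j + 1) (by omega)
  have stepR := h.step N le_rfl
  rw [hclose] at stepR
  -- The loop has at least two vertices besides its base point.
  have hlen : j + 3 ≤ N := by
    by_contra! hlt
    rcases Nat.lt_or_ge (j + 1) N with h1 | h1
    · obtain rfl : N = j + 2 := by omega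
      have h2 : dir (k (j + 1)) + dir (k (j + 2)) = 0 := by
        have e2 : w (j + 2) = w (j + 1) + dir (k (j + 1)) := stepQ
        rw [e2] at stepR
        linear_combination -stepR
      have h3 : dir (k (j + 2)) = dir (k (j + 1) + 3) := by
        rw [dir_add_three]; linear_combination h2
      have h4 := h.turn (j + 1) (by omega)
      simp only [add_assoc, Nat.reduceAdd] at h4
      rcases dir_cases (k (j + 2)) with ⟨a1, a2⟩ | ⟨a1, a2⟩ | ⟨a1, a2⟩ | ⟨a1, a2⟩ | ⟨a1, a2⟩ |
          ⟨a1, a2⟩ <;>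
        rcases dir_cases (k (j + 1) + 3) with ⟨b1, b2⟩ | ⟨b1, b2⟩ | ⟨b1, b2⟩ | ⟨b1, b2⟩ |
          ⟨b1, b2⟩ | ⟨b1, b2⟩ <;>
        first
        | omega
        | (rw [a2, b2, QuadraticAlgebra.ext_iff] at h3; norm_num at h3)
    · obtain rfl : N = j + 1 := by omega
      exact dir_ne_zero (k (j + 1)) (by linear_combination -stepR)
  -- The last step arrives from the third neighbour of the base point.
  have hR : dir (k N) = -dir (k j - s) := by
    have hne1 : dir (k N) ≠ dir (k j) := fun he => inj j N (by omega) le_rfl (by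
      rw [he, stepP] at stepR; exact add_right_cancel stepR)
    have hne2 : dir (k N) ≠ dir (k (j + 1) + 3) := fun he =>
      inj (j + 2) N (by omega) le_rfl (by
        have e2 : w (j + 2) = w (j + 1) + dir (k (j + 1)) := stepQ
        rw [he, dir_add_three] at stepR
        rw [e2, stepR]; ring)
    have c1 := colour_add_dir (w j) (k j)
    have c2 := colour_add_dir (w N) (k N)
    rw [← stepP] at c1
    rw [← stepR] at c2
    have d1 := h.col j (by omega)
    have d2 := h.col N (by omega)
    have d3 := h.col (j + 1) (by omega)
    have b1 := colour_lt_three (w j)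
    have b2 := colour_lt_three (w N)
    have b3 := colour_lt_three (w (j + 1))
    have hpar : k N % 2 = k j % 2 := by
      split_ifs at c1 c2 <;> omega
    have m1 : k N % 6 ≠ k j % 6 := fun he => hne1 (by rw [dir_emod, he, ← dir_emod])
    have m2 : k N % 6 ≠ (k (j + 1) + 3) % 6 := fun he => hne2 (by rw [dir_emod, he, ← dir_emod])
    rw [← dir_add_three, dir_emod (k N), dir_emod (k j - s + 3)]
    congr 1
    rcases hs with rfl | rfl <;> omega
  set v := w (j + 1) with hv
  set q := w (j + 2) with hq
  set p := w j with hp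
  set r := w N with hr
  have eqv : v - p = dir (k j) := by rw [stepP]; ring
  have eqq : q - v = dir (k j + s) := by
    rw [hturn] at stepQ; rw [stepQ]; ring
  have eqr : r - v = dir (k j - s) := by linear_combination -stepR - hR
  obtain ⟨n, rfl⟩ : ∃ n, N = j + 3 + n := ⟨N - (j + 3), by omega⟩
  -- `S` is the angle swept by the loop as seen from its base point.
  set S := ∑ t ∈ Finset.range (n + 1), angle (w (j + 2 + t) - v) (w (j + 2 + t + 1) - v) with hS
  have hS_eq : S = -(2 * s * (Real.pi / 3)) := by
    have wz := h.winding_eq_zero inj w0 hpos hm hmN hclose (j := j) (by omega)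
    rw [show j + 3 + n + 1 - (j + 1) = n + 3 by omega, Finset.sum_range_succ,
      Finset.sum_range_succ'] at wz
    have ex : ∑ t ∈ Finset.range (n + 1), (angle (w (j + 2 + t) - p) (w (j + 2 + t + 1) - p) -
        angle (w (j + 2 + t) - v) (w (j + 2 + t + 1) - v)) =
        angle (q - p) (q - v) - angle (r - p) (r - v) := by
      have e : ∀ t ∈ Finset.range (n + 1), angle (w (j + 2 + t) - p) (w (j + 2 + t + 1) - p) -
          angle (w (j + 2 + t) - v) (w (j + 2 + t + 1) - v) =
          (fun t => angle (w (j + 2 + t) - p) (w (j + 2 + t) - v)) t -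
          (fun t => angle (w (j + 2 + t) - p) (w (j + 2 + t) - v)) (t + 1) := by
        intro t ht
        have ht := Finset.mem_range.1 ht
        have := h.exchange (s := j) (t := j + 2 + t) (by omega) (by omega)
          (inj _ _ (by omega) (by omega)) (inj _ _ (by omega) (by omega))
          (inj _ _ (by omega) (by omega)) (inj _ _ (by omega) (by omega))
        simp only [← add_assoc]
        linarith
      refine (Finset.sum_congr rfl e).trans ((Finset.sum_range_sub' _ _).trans ?_)
      simp only [add_zero]
      rw [hr, show j + 3 + n = j + 2 + (n + 1) by ring]
    rw [Finset.sum_sub_distrib, ← hS] at ex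
    have reindex : ∑ t ∈ Finset.range (n + 1), angle (w (j + 1 + (t + 1)) - w j)
        (w (j + 1 + (t + 1) + 1) - w j) =
        ∑ t ∈ Finset.range (n + 1), angle (w (j + 2 + t) - p) (w (j + 2 + t + 1) - p) := by
      apply Finset.sum_congr rfl
      intro t _
      rw [show j + 1 + (t + 1) = j + 2 + t by ring]
    rw [reindex] at wz
    simp only [add_zero] at wz
    rw [show j + 1 + (n + 2) + 1 = j + 3 + n + 1 by ring, show j + 1 + (n + 2) = j + 3 + n by ring,
      hclose, show j + 1 + 1 = j + 2 by ring, ← hv, ← hp, ← hr, ← hq] at wz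
    have a1 := (angle_add_angle_step (k := k j) hs).1
    have a2 := (angle_add_angle_step (k := k j - s) hs).2
    rw [sub_add_cancel] at a2
    rw [show q - p = dir (k j) + dir (k j + s) by rw [← eqv, ← eqq]; ring,
      show r - p = dir (k j - s) + dir (k j) by rw [← eqv, ← eqr]; ring, eqq, eqr] at ex
    rw [show q - p = dir (k j) + dir (k j + s) by rw [← eqv, ← eqq]; ring,
      show r - p = dir (k j - s) + dir (k j) by rw [← eqv, ← eqr]; ring, eqv] at wz
    linarith
  -- Hopf's theorem for the loop without its first edge.
  have hopf := (h.shift (m := j + 2) (M := n + 1) (by omega)).turning_eq (by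
    intro a b hab hb
    rcases Nat.lt_or_ge (j + 2 + b) (j + 3 + n + 1) with h1 | h1
    · exact inj _ _ (by omega) (by omega)
    · rw [show j + 2 + b = j + 3 + n + 1 by omega, hclose]
      exact (inj _ _ (by omega) (by omega)).symm)
  simp only [add_zero] at hopf
  rw [show j + 2 + (n + 1 + 1) = j + 3 + n + 1 by ring, hclose, ← hq,
    show j + 2 + (n + 1) = j + 3 + n by ring] at hopf
  have hopf2 : ∑ t ∈ Finset.range (n + 1), angle (v - w (j + 2 + t)) (v - w (j + 2 + (t + 1))) =
      S := by
    apply Finset.sum_congr rfl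
    intro t _
    rw [← angle_neg_neg, neg_sub, neg_sub, ← add_assoc]
  rw [hopf2, Finset.sum_range_succ] at hopf
  rw [show j + 2 + (n + 1) = j + 3 + n by ring, show j + 2 + (n + 2) = j + 3 + n + 1 by ring,
    hclose, ← hr] at hopf
  have ex : ∑ t ∈ Finset.range n, (angle (w (j + 3 + t) - v) (w (j + 3 + t + 1) - v) -
      angle (w (j + 2 + (t + 1)) - q) (w (j + 2 + (t + 2)) - q)) =
      angle (w (j + 3) - v) (w (j + 3) - q) - angle (r - v) (r - q) := by
    have e : ∀ t ∈ Finset.range n, angle (w (j + 3 + t) - v) (w (j + 3 + t + 1) - v) -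
        angle (w (j + 2 + (t + 1)) - q) (w (j + 2 + (t + 2)) - q) =
        (fun t => angle (w (j + 3 + t) - v) (w (j + 3 + t) - q)) t -
        (fun t => angle (w (j + 3 + t) - v) (w (j + 3 + t) - q)) (t + 1) := by
      intro t ht
      have ht := Finset.mem_range.1 ht
      have := h.exchange (s := j + 1) (t := j + 3 + t) (by omega) (by omega)
        (inj _ _ (by omega) (by omega)) (inj _ _ (by omega) (by omega))
        (inj _ _ (by omega) (by omega)) (inj _ _ (by omega) (by omega))
      simp only [← add_assoc]
      rw [show j + 2 + t + 1 = j + 3 + t by ring, show j + 2 + t + 2 = j + 3 + t + 1 by ring]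
      rw [show j + 1 + 1 = j + 2 by ring] at this
      linarith
    refine (Finset.sum_congr rfl e).trans ((Finset.sum_range_sub' _ _).trans ?_)
    simp only [add_zero]
    rw [hr]
  rw [Finset.sum_sub_distrib] at ex
  have hS2 : S = angle (q - v) (w (j + 3) - v) +
      ∑ t ∈ Finset.range n, angle (w (j + 3 + t) - v) (w (j + 3 + t + 1) - v) := by
    rw [hS, Finset.sum_range_succ', add_comm]
    simp only [add_zero]
    congr 1
    apply Finset.sum_congr rfl
    intro t _
    rw [show j + 2 + (t + 1) = j + 3 + t by ring]
  have hcorner := h.corner (i := j + 1) (by omega)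
  rw [show j + 1 + 1 = j + 2 by ring, show j + 1 + 2 = j + 3 by ring, ← hv, ← hq] at hcorner
  have hdelta := (angle_add_angle_step (k := k j - s) (s := -s)
    (by rcases hs with rfl | rfl <;> simp)).1
  have hq' : v - q = dir (k j - s + -s) := by
    rw [← neg_sub, eqq, ← dir_sub_three]
    rcases hs with rfl | rfl
    · rw [← dir_add_six_mul _ 0]; congr 1; ring
    · rw [← dir_add_six_mul _ 1]; congr 1; ring
  rw [← hq', ← eqr, show r - v + (v - q) = r - q by ring] at hdelta
  have hfin : ((k (j + 3 + n) : ℝ) - k (j + 1)) * (Real.pi / 3) = (-5 * s) * (Real.pi / 3) := by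
    push_cast at hdelta
    linarith
  have h2 := mul_right_cancel₀ (by positivity : Real.pi / 3 ≠ 0) hfin
  have h3 : k (j + 3 + n) - k (j + 1) = -5 * s := by exact_mod_cast h2
  linarith

/-! ### From lists of turns to sequences of vertices -/

lemma take_add_one_eq {l : List Bool} {i : ℕ} (hi : i < l.length) :
    l.take (i + 1) = l.take i ++ [l[i]] := by
  simp

lemma getElem_visited {l : List Bool} {i : ℕ} (hi : i < l.length) :
    (visited l)[i]'(by simpa using hi) = head (l.take i) := by
  have h1 : visited l = visited (l.take i) ++ head (l.take i) ::
      ((visited (l.drop (i + 1))).map (fun z => 1 + dir (sgn l[i]) * z)).map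
        (fun z => pt (l.take i) + dir (turning (l.take i)) * z) := by
    conv_lhs => rw [← List.take_append_drop i l, List.drop_eq_getElem_cons hi, visited_append,
      visited_cons]
    simp [head]
  have h2 : (visited (l.take i)).length = i := by simp; omega
  simp only [h1]
  rw [List.getElem_append_right (by omega)]
  simp [h2]

/-- The vertices of the walk `l`, including the vertex `0` in front of the visited ones and the
vertex `head l` behind them. -/
def vertexSeq (l : List Bool) (i : ℕ) : Eis := pt ((l ++ [true]).take i)

lemma vertexSeq_zero (l : List Bool) : vertexSeq l 0 = 0 := by simp [vertexSeq]

lemma vertexSeq_succ {l : List Bool} {i : ℕ} (hi : i ≤ l.length) :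
    vertexSeq l (i + 1) = head (l.take i) := by
  rw [vertexSeq, take_add_one_eq (by simp; omega), pt_concat, List.take_append_of_le_length hi]

lemma vertexSeq_of_le {l : List Bool} {i : ℕ} (hi : i ≤ l.length) :
    vertexSeq l i = pt (l.take i) := by
  rw [vertexSeq, List.take_append_of_le_length hi]

lemma vertexSeq_head (l : List Bool) : vertexSeq l (l.length + 1) = head l := by
  rw [vertexSeq_succ le_rfl, List.take_length]

lemma vertexSeq_mem_visited {l : List Bool} {i : ℕ} (h1 : 1 ≤ i) (hi : i ≤ l.length) :
    vertexSeq l i ∈ visited l := by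
  obtain ⟨i, rfl⟩ : ∃ j, i = j + 1 := ⟨i - 1, by omega⟩
  rw [vertexSeq_succ (by omega), ← getElem_visited (by omega)]
  exact List.getElem_mem _

lemma isTrail_vertexSeq (l : List Bool) :
    IsTrail (vertexSeq l) (fun i => turning (l.take i)) l.length := by
  refine ⟨fun i hi => ?_, fun i hi => ?_, fun i hi => ?_⟩
  · rw [vertexSeq_succ hi, vertexSeq_of_le hi, head]
  · simp only [take_add_one_eq hi, turning_append, turning_cons, turning_nil, add_zero]
    rcases sgn_cases l[i] with h | h <;> rw [h]
    · left; rfl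
    · right; rfl
  · rw [vertexSeq, colour_pt]; omega

lemma SAW.vertexSeq_ne {l : List Bool} (h : SAW l) {i j : ℕ} (hi : 1 ≤ i) (hij : i < j)
    (hj : j ≤ l.length) : vertexSeq l i ≠ vertexSeq l j := by
  obtain ⟨i, rfl⟩ : ∃ m, i = m + 1 := ⟨i - 1, by omega⟩
  obtain ⟨j, rfl⟩ : ∃ m, j = m + 1 := ⟨j - 1, by omega⟩
  rw [vertexSeq_succ (by omega), vertexSeq_succ (by omega), ← getElem_visited (by omega),
    ← getElem_visited (by omega)]
  intro he
  have := (List.Nodup.getElem_inj_iff h).1 he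
  omega

/-! ### Walks in a domain -/

/-- The self-avoiding walks that visit only vertices of `Ω`. -/
def walks (Ω : Set Eis) : Set (List Bool) := {l | SAW l ∧ ∀ z ∈ visited l, z ∈ Ω}

lemma walks_mono {Ω Ω' : Set Eis} (h : Ω ⊆ Ω') : walks Ω ⊆ walks Ω' :=
  fun _ hl => ⟨hl.1, fun z hz => h (hl.2 z hz)⟩

lemma nil_mem_walks (Ω : Set Eis) : [] ∈ walks Ω := ⟨saw_nil, by simp⟩

lemma concat_mem_walks {Ω : Set Eis} {l : List Bool} {t : Bool} :
    l ++ [t] ∈ walks Ω ↔ l ∈ walks Ω ∧ head l ∈ Ω ∧ head l ∉ visited l := by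
  unfold walks
  simp only [Set.mem_ofPred_eq, saw_concat_iff, visited_concat, List.mem_append, List.mem_singleton]
  constructor
  · rintro ⟨⟨h1, h2⟩, h3⟩
    exact ⟨⟨h1, fun z hz => h3 z (Or.inl hz)⟩, h3 _ (Or.inr rfl), h2⟩
  · rintro ⟨⟨h1, h2⟩, h3, h4⟩
    refine ⟨⟨h1, h4⟩, ?_⟩
    rintro z (hz | rfl)
    exacts [h2 z hz, h3]

section Domain

variable {Ω : Set Eis} (hΩ : ∀ z ∈ Ω, 0 < abscissa z)
include hΩ

lemma vertexSeq_ne_of_mem_walks {l : List Bool} (hl : l ∈ walks Ω) {i j : ℕ} (hij : i < j)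
    (hj : j ≤ l.length) : vertexSeq l i ≠ vertexSeq l j := by
  rcases Nat.eq_zero_or_pos i with rfl | hi
  · intro he
    have := hΩ _ (hl.2 _ (vertexSeq_mem_visited (by omega) hj))
    rw [← he, vertexSeq_zero] at this
    simp at this
  · exact hl.1.vertexSeq_ne hi hij hj

/-- The turning of a loop that a walk from the boundary of a half-plane closes at its end. -/
lemma turning_of_head_eq {l₁ l₂ : List Bool} {t : Bool} (hl : l₁ ++ t :: l₂ ∈ walks Ω)
    (hh : head (l₁ ++ t :: l₂) = head l₁) : turning l₂ = -5 * sgn t := by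
  set l := l₁ ++ t :: l₂ with hldef
  have hlen : l.length = l₁.length + 1 + l₂.length := by simp [hldef]; omega
  have t1 : l.take l₁.length = l₁ := by simp [hldef]
  have t2 : l.take (l₁.length + 1) = l₁ ++ [t] := by
    rw [take_add_one_eq (by omega), t1]; simp [hldef]
  have := (isTrail_vertexSeq l).turning_loop (m := l₁.length + 1) (s := sgn t)
    (fun i j hij hj => vertexSeq_ne_of_mem_walks hΩ hl hij hj) (vertexSeq_zero l)
    (fun i h1 h2 => hΩ _ (hl.2 _ (vertexSeq_mem_visited h1 h2))) (by omega) (by omega)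
    (by rw [vertexSeq_head, vertexSeq_succ (by omega), t1, hh]) (sgn_cases t)
    (by simp only [Nat.add_sub_cancel, t1, t2]; simp)
  simp only [List.take_length, t2] at this
  rw [hldef] at this
  simp at this
  linarith

/-- A walk that leaves a domain at a point that is extremal in the direction of its last step makes
at most half a turn in total. -/
lemma abs_turning_le_of_extremal {l : List Bool} (hl : l ∈ walks Ω) (hh : head l ∉ Ω)
    (hh0 : head l ≠ 0) (hend : 0 ≤ abscissa (head l))
    (hext : ∀ z ∈ visited l, 0 < abscissa (dir (-turning l) * (head l - z)))
    (hext0 : 0 ≤ abscissa (dir (-turning l) * head l)) : |turning l| ≤ 3 := by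
  have key := (isTrail_vertexSeq l).abs_turning_le (fun i j hij hj => by
    rcases Nat.lt_or_ge l.length j with h | h
    · obtain rfl : j = l.length + 1 := by omega
      rw [vertexSeq_head]
      rcases Nat.eq_zero_or_pos i with rfl | hi
      · rw [vertexSeq_zero]; exact hh0.symm
      · intro he
        exact hh (he ▸ hl.2 _ (vertexSeq_mem_visited hi (by omega)))
    · exact vertexSeq_ne_of_mem_walks hΩ hl hij h) (vertexSeq_zero l) (by simp)
    (fun i h1 h2 => hΩ _ (hl.2 _ (vertexSeq_mem_visited h1 h2)))
    (by rw [vertexSeq_head]; exact hend)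
    (fun i h1 h2 => by
      simp only [List.take_length]
      rw [vertexSeq_head]; exact hext _ (vertexSeq_mem_visited h1 h2))
    (by simp only [List.take_length]; rw [vertexSeq_head]; exact hext0)
  simpa using key

/-- Running a terminal loop in the opposite direction yields a walk in the same domain with the same
terminal loop. -/
lemma flip_loop {l₁ l₂ : List Bool} {t : Bool} (hl : l₁ ++ t :: l₂ ∈ walks Ω)
    (hh : head (l₁ ++ t :: l₂) = head l₁) :
    l₁ ++ (!t) :: rev l₂ ∈ walks Ω ∧ head (l₁ ++ (!t) :: rev l₂) = head l₁ := by
  have ht := turning_of_head_eq hΩ hl hh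
  have eq1 : ∀ (u : Bool) (m : List Bool), l₁ ++ u :: m = (l₁ ++ [u]) ++ m := by simp
  have hdir : dir (turning l₁ + sgn t) * dir (turning l₂) = -dir (turning l₁ + sgn (!t)) := by
    rw [← dir_add, ht, ← dir_sub_three, sgn_not]
    rcases sgn_cases t with h | h <;> rw [h]
    · congr 1; ring
    · rw [← dir_add_six_mul (_ - 3) 1]; congr 1; ring
  rw [eq1, head_append, pt_concat, turning_append, turning_cons, turning_nil, add_zero] at hh
  have hvis : visited (l₁ ++ (!t) :: rev l₂) = visited l₁ ++ head l₁ ::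
      ((visited l₂).map (fun z => head l₁ + dir (turning l₁ + sgn t) * z)).reverse := by
    rw [eq1, visited_append, visited_concat, ← List.map_reverse, ← visited_rev, List.map_map,
      pt_concat]
    simp only [List.append_assoc, List.cons_append, List.nil_append, turning_append, turning_cons,
      turning_nil, add_zero, List.append_cancel_left_eq, List.cons.injEq, true_and]
    apply List.map_congr_left
    intro z _
    simp only [Function.comp_apply]
    linear_combination -hh + z * hdir
  have hvis' : visited (l₁ ++ t :: l₂) = visited l₁ ++ head l₁ ::
      ((visited l₂).map (fun z => head l₁ + dir (turning l₁ + sgn t) * z)) := by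
    rw [eq1, visited_append, visited_concat, pt_concat]
    simp
  have hperm : (visited (l₁ ++ (!t) :: rev l₂)).Perm (visited (l₁ ++ t :: l₂)) := by
    rw [hvis, hvis']
    exact List.Perm.append_left _ (List.Perm.cons _ (List.reverse_perm _))
  refine ⟨⟨hperm.nodup_iff.2 hl.1, fun z hz => hl.2 z (hperm.mem_iff.1 hz)⟩, ?_⟩
  rw [eq1, head_append, pt_concat, turning_append, turning_cons, turning_nil, add_zero]
  have h1 := pt_rev l₂
  have h2 : head (rev l₂) = pt (rev l₂) + dir (-turning l₂) := by rw [head, turning_rev]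
  have h3 := dir_mul_neg (turning l₂)
  have h4 : dir (turning l₂) * head (rev l₂) = head l₂ := by
    rw [h2]; linear_combination h3 - h1
  linear_combination -hh - dir (turning l₁ + sgn t) * h4 + head (rev l₂) * hdir

end Domain

/-- Reverses the terminal loop of a walk whose end `head l` is one of the vertices visited. -/
noncomputable def flipLoop (l : List Bool) : List Bool :=
  let i := (visited l).findIdx (fun z => Classical.propDecidable (z = head l) |>.decide)
  match l.drop i with
  | [] => l
  | t :: m => l.take i ++ (!t) :: rev m

lemma flipLoop_eq {l₁ l₂ : List Bool} {t : Bool} (hs : SAW (l₁ ++ t :: l₂))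
    (hh : head (l₁ ++ t :: l₂) = head l₁) :
    flipLoop (l₁ ++ t :: l₂) = l₁ ++ (!t) :: rev l₂ := by
  have hidx : (visited (l₁ ++ t :: l₂)).findIdx
      (fun z => (Classical.propDecidable (z = head (l₁ ++ t :: l₂))).decide) = l₁.length := by
    have e : l₁ ++ t :: l₂ = (l₁ ++ [t]) ++ l₂ := by simp
    have hs1 : head l₁ ∉ visited l₁ := by
      rw [e] at hs; exact (saw_concat_iff.1 hs.left).2
    rw [hh, List.findIdx_eq (by simp)]
    constructor
    · rw [getElem_visited (by simp)]; simp
    · intro j hj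
      simp only [decide_eq_false_iff_not]
      rw [getElem_visited (by simp; omega)]
      intro he
      apply hs1
      rw [List.take_append_of_le_length hj.le] at he
      rw [← he, ← getElem_visited hj]
      exact List.getElem_mem _
  simp only [flipLoop, hidx]
  simp

/-! ### The exit identity -/

/-- The walks of `S` that visit `n` vertices. -/
noncomputable def slice (S : Set (List Bool)) (n : ℕ) : Finset (List Bool) :=
  ((List.finite_length_eq Bool n).inter_of_left S).toFinset

lemma mem_slice {S : Set (List Bool)} {n : ℕ} {l : List Bool} :
    l ∈ slice S n ↔ l.length = n ∧ l ∈ S := by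
  simp [slice]

/-- The walks in `Ω` with `n` vertices. -/
noncomputable abbrev walksN (Ω : Set Eis) (n : ℕ) : Finset (List Bool) := slice (walks Ω) n

lemma mem_walksN {Ω : Set Eis} {n : ℕ} {l : List Bool} :
    l ∈ walksN Ω n ↔ l.length = n ∧ l ∈ walks Ω := mem_slice

/-- The weight of a walk in the real part of the parafermionic observable. The observable has the
phase `exp (-5 / 8 * I * W)`, where `W` is the total turning; it is multiplied by the direction of
the last step, of phase `exp (I * W)`, in the local relation. The angle `3 / 8 * W` remains. -/
noncomputable def obs (x : ℝ) (l : List Bool) : ℝ :=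
  Real.cos (turning l * (Real.pi / 8)) * x ^ l.length

open Classical in
/-- The walks with `n` vertices that can be continued inside `Ω`. -/
noncomputable def freshN (Ω : Set Eis) (n : ℕ) : Finset (List Bool) :=
  (walksN Ω n).filter (fun l => head l ∈ Ω ∧ head l ∉ visited l)

open Classical in
/-- The walks with `n` vertices whose last step leaves `Ω`. -/
noncomputable def exitN (Ω : Set Eis) (n : ℕ) : Finset (List Bool) :=
  (walksN Ω n).filter (fun l => head l ∉ Ω)

open Classical in
/-- The walks with `n` vertices whose last step leads to a vertex visited before. -/
noncomputable def trappedN (Ω : Set Eis) (n : ℕ) : Finset (List Bool) :=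
  (walksN Ω n).filter (fun l => head l ∈ visited l)

/-- A walk and its two one-step continuations: at the critical point, and for the phase of
the observable, the weight of the walk is distributed over its continuations. -/
lemma obs_add_obs {x : ℝ} (hx : 2 * x * Real.cos (Real.pi / 8) = 1) (l : List Bool) :
    obs x (l ++ [true]) + obs x (l ++ [false]) = obs x l := by
  simp only [obs, turning_append, turning_cons, sgn_true, sgn_false, turning_nil,
    List.length_append, List.length_singleton, pow_succ]
  push_cast
  rw [show ((turning l : ℝ) + 1) * (Real.pi / 8) =
      turning l * (Real.pi / 8) + Real.pi / 8 by ring,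
    show ((turning l : ℝ) + -1) * (Real.pi / 8) =
      turning l * (Real.pi / 8) - Real.pi / 8 by ring, Real.cos_add, Real.cos_sub]
  linear_combination Real.cos (turning l * (Real.pi / 8)) * x ^ l.length * hx

lemma sum_walksN_succ {x : ℝ} (hx : 2 * x * Real.cos (Real.pi / 8) = 1) (Ω : Set Eis) (n : ℕ) :
    ∑ l ∈ walksN Ω (n + 1), obs x l = ∑ l ∈ freshN Ω n, obs x l := by
  have : ∑ p ∈ freshN Ω n ×ˢ (Finset.univ : Finset Bool), obs x (p.1 ++ [p.2]) =
      ∑ l ∈ walksN Ω (n + 1), obs x l := by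
    refine Finset.sum_bij (fun p _ => p.1 ++ [p.2]) ?_ ?_ ?_ (fun _ _ => rfl)
    · rintro ⟨l, t⟩ h
      simp only [freshN, Finset.mem_product, Finset.mem_filter, mem_walksN] at h
      simp only [mem_walksN, concat_mem_walks, List.length_append, List.length_singleton]
      exact ⟨by omega, h.1.1.2, h.1.2⟩
    · rintro ⟨l, t⟩ _ ⟨l', t'⟩ _ he
      have := List.append_inj' he (by simp)
      simp only [List.cons.injEq, and_true] at this
      exact Prod.ext this.1 this.2
    · intro l hl
      rcases List.eq_nil_or_concat l with rfl | ⟨m, t, rfl⟩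
      · simp [mem_walksN] at hl
      · simp only [List.concat_eq_append] at hl ⊢
        simp only [mem_walksN, concat_mem_walks, List.length_append, List.length_singleton] at hl
        exact ⟨(m, t), by simp [freshN, mem_walksN, hl.2, show m.length = n by omega], rfl⟩
  rw [← this, Finset.sum_product]
  exact Finset.sum_congr rfl fun l _ => by rw [Fintype.sum_bool, obs_add_obs hx]

/-- The contributions of the two orientations of a terminal loop cancel. -/
lemma sum_trappedN {Ω : Set Eis} (hΩ : ∀ z ∈ Ω, 0 < abscissa z) (x : ℝ) (n : ℕ) :
    ∑ l ∈ trappedN Ω n, obs x l = 0 := by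
  have key : ∀ l ∈ trappedN Ω n, ∃ l₁ t l₂, l = l₁ ++ t :: l₂ ∧ l ∈ walks Ω ∧ l.length = n ∧
      head l = head l₁ ∧ flipLoop l = l₁ ++ (!t) :: rev l₂ := by
    intro l hl
    simp only [trappedN, Finset.mem_filter, mem_walksN] at hl
    obtain ⟨l₁, t, l₂, rfl, he⟩ := mem_visited_iff.1 hl.2
    exact ⟨l₁, t, l₂, rfl, hl.1.2, hl.1.1, he, flipLoop_eq hl.1.2.1 he⟩
  refine Finset.sum_involution (fun l _ => flipLoop l) ?_ ?_ ?_ ?_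
  · intro l hl
    obtain ⟨l₁, t, l₂, rfl, hw, hn, hh, hf⟩ := key l hl
    have ht := turning_of_head_eq hΩ hw hh
    rw [hf]
    simp only [obs, turning_append, turning_cons, turning_rev, ht, sgn_not, List.length_append,
      List.length_cons, length_rev]
    rw [← add_mul]
    push_cast
    have h2 : Real.cos (4 * sgn t * (Real.pi / 8)) = 0 := by
      rcases sgn_cases t with h | h <;> rw [h]
      · rw [show (4 * ((1 : ℤ) : ℝ) * (Real.pi / 8)) = Real.pi / 2 by push_cast; ring,
          Real.cos_pi_div_two]
      · rw [show (4 * ((-1 : ℤ) : ℝ) * (Real.pi / 8)) = -(Real.pi / 2) by push_cast; ring,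
          Real.cos_neg, Real.cos_pi_div_two]
    rw [show ((turning l₁ : ℝ) + (sgn t + -5 * sgn t)) * (Real.pi / 8) =
        turning l₁ * (Real.pi / 8) - 4 * sgn t * (Real.pi / 8) by ring,
      show ((turning l₁ : ℝ) + (-sgn t + -(-5 * sgn t))) * (Real.pi / 8) =
        turning l₁ * (Real.pi / 8) + 4 * sgn t * (Real.pi / 8) by ring,
      Real.cos_add, Real.cos_sub, h2]
    ring
  · intro l hl _ he
    obtain ⟨l₁, t, l₂, rfl, hw, hn, hh, hf⟩ := key l hl
    rw [hf] at he
    simp at he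
  · intro l hl
    obtain ⟨l₁, t, l₂, rfl, hw, hn, hh, hf⟩ := key l hl
    have h2 := flip_loop hΩ hw hh
    rw [hf]
    simp only [trappedN, Finset.mem_filter, mem_walksN]
    refine ⟨⟨by rw [← hn]; simp, h2.1⟩, ?_⟩
    exact mem_visited_iff.2 ⟨l₁, !t, rev l₂, rfl, h2.2⟩
  · intro l hl
    obtain ⟨l₁, t, l₂, rfl, hw, hn, hh, hf⟩ := key l hl
    have h2 := flip_loop hΩ hw hh
    simp only [hf]
    rw [flipLoop_eq h2.1.1 h2.2]
    simp

lemma sum_walksN {Ω : Set Eis} (hΩ : ∀ z ∈ Ω, 0 < abscissa z) (x : ℝ) (n : ℕ) :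
    ∑ l ∈ walksN Ω n, obs x l = ∑ l ∈ exitN Ω n, obs x l + ∑ l ∈ freshN Ω n, obs x l := by
  classical
  have h1 := Finset.sum_filter_add_sum_filter_not (walksN Ω n) (fun l => head l ∉ Ω) (obs x)
  have h2 := Finset.sum_filter_add_sum_filter_not ((walksN Ω n).filter (fun l => ¬ head l ∉ Ω))
    (fun l => head l ∉ visited l) (obs x)
  have e1 : ((walksN Ω n).filter (fun l => ¬ head l ∉ Ω)).filter (fun l => head l ∉ visited l) =
      freshN Ω n := by
    ext l; simp [freshN]; tauto
  have e2 : ((walksN Ω n).filter (fun l => ¬ head l ∉ Ω)).filter (fun l => ¬ head l ∉ visited l) =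
      trappedN Ω n := by
    ext l
    simp only [trappedN, Finset.mem_filter, mem_walksN, not_not]
    constructor
    · tauto
    · rintro ⟨h1, h2⟩; exact ⟨⟨h1, h1.2.2 _ h2⟩, h2⟩
  have e3 : (walksN Ω n).filter (fun l => head l ∉ Ω) = exitN Ω n := by
    ext l; simp [exitN]
  rw [e1, e2, sum_trappedN hΩ, add_zero] at h2
  rw [← h1, ← h2, e3]

/-- The sum of the local relations over all walks with fewer than `n` vertices: the observable is
carried from the starting point to the boundary of the domain, except for the part that belongs to
walks with exactly `n` vertices. -/
theorem sum_exitN_add {Ω : Set Eis} (hΩ : ∀ z ∈ Ω, 0 < abscissa z) {x : ℝ}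
    (hx : 2 * x * Real.cos (Real.pi / 8) = 1) (n : ℕ) :
    ∑ i ∈ Finset.range n, ∑ l ∈ exitN Ω i, obs x l + ∑ l ∈ walksN Ω n, obs x l = 1 := by
  induction n with
  | zero =>
    have : walksN Ω 0 = {[]} := by
      ext l
      simp only [mem_walksN, List.length_eq_zero_iff, Finset.mem_singleton]
      exact ⟨fun h => h.1, by rintro rfl; exact ⟨rfl, nil_mem_walks Ω⟩⟩
    simp [this, obs]
  | succ n ih =>
    rw [Finset.sum_range_succ, sum_walksN_succ hx, add_assoc, ← sum_walksN hΩ, ih]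

/-! ### Generating functions of sets of walks -/

/-- The generating function of a set of walks, by the number of vertices visited. -/
noncomputable def wt (S : Set (List Bool)) (x : ℝ≥0) : ℝ≥0∞ := ∑' l : S, (x : ℝ≥0∞) ^ l.1.length

lemma slice_subset {S T : Set (List Bool)} (h : S ⊆ T) (n : ℕ) : slice S n ⊆ slice T n :=
  fun _ hl => mem_slice.2 ⟨(mem_slice.1 hl).1, h (mem_slice.1 hl).2⟩

lemma wt_eq_tsum (S : Set (List Bool)) (x : ℝ≥0) :
    wt S x = ∑' n, ((slice S n).card : ℝ≥0∞) * (x : ℝ≥0∞) ^ n := by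
  rw [wt, ← (Equiv.sigmaFiberEquiv (fun l : S => l.1.length)).tsum_eq, ENNReal.tsum_sigma']
  refine tsum_congr fun n => ?_
  let e : {l : S // l.1.length = n} ≃ {l // l ∈ slice S n} :=
    { toFun := fun l => ⟨l.1.1, mem_slice.2 ⟨l.2, l.1.2⟩⟩
      invFun := fun l => ⟨⟨l.1, (mem_slice.1 l.2).2⟩, (mem_slice.1 l.2).1⟩
      left_inv := fun _ => rfl
      right_inv := fun _ => rfl }
  have h1 : ∀ l : {l : S // l.1.length = n},
      (x : ℝ≥0∞) ^ ((Equiv.sigmaFiberEquiv (fun l : S => l.1.length)) ⟨n, l⟩).1.length =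
        (fun l : {l // l ∈ slice S n} => (x : ℝ≥0∞) ^ n) (e l) := by
    intro l
    simp [Equiv.sigmaFiberEquiv, l.2]
  refine (tsum_congr h1).trans ((e.tsum_eq fun _ => (x : ℝ≥0∞) ^ n).trans ?_)
  rw [Finset.tsum_subtype (slice S n) (fun _ => (x : ℝ≥0∞) ^ n)]
  simp

lemma wt_mono {S T : Set (List Bool)} (h : S ⊆ T) (x : ℝ≥0) : wt S x ≤ wt T x :=
  ENNReal.tsum_mono_subtype (fun l : List Bool => (x : ℝ≥0∞) ^ l.length) h

lemma wt_union_le (S T : Set (List Bool)) (x : ℝ≥0) : wt (S ∪ T) x ≤ wt S x + wt T x :=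
  ENNReal.tsum_union_le (fun l : List Bool => (x : ℝ≥0∞) ^ l.length) S T

lemma wt_le_of_injective {S : Set (List Bool)} {x : ℝ≥0} {ι : Type*} (f : S → ι)
    (hf : Function.Injective f) (g : ι → ℝ≥0∞) (h : ∀ l, (x : ℝ≥0∞) ^ l.1.length ≤ g (f l)) :
    wt S x ≤ ∑' i, g i :=
  (ENNReal.tsum_le_tsum h).trans (ENNReal.tsum_comp_le_tsum_of_injective hf g)

/-- The generating function of concatenations. -/
lemma wt_image2_append_le (S T : Set (List Bool)) (x : ℝ≥0) :
    wt (Set.image2 (· ++ ·) S T) x ≤ wt S x * wt T x := by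
  have h : ∀ l : Set.image2 (· ++ ·) S T, ∃ p : S × T, p.1.1 ++ p.2.1 = l.1 := by
    rintro ⟨_, a, ha, b, hb, rfl⟩
    exact ⟨(⟨a, ha⟩, ⟨b, hb⟩), rfl⟩
  choose f hf using h
  have : wt S x * wt T x = ∑' p : S × T, (x : ℝ≥0∞) ^ (p.1.1.length + p.2.1.length) := by
    rw [wt, wt, ← ENNReal.tsum_mul_right, ENNReal.tsum_prod']
    refine tsum_congr fun a => ?_
    rw [← ENNReal.tsum_mul_left]
    exact tsum_congr fun b => (pow_add _ _ _).symm
  rw [this]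
  refine wt_le_of_injective f ?_ _ ?_
  · intro a b hab
    ext1
    rw [← hf a, ← hf b, hab]
  · intro l
    rw [← hf l, List.length_append]

lemma one_le_wt {S : Set (List Bool)} (h : [] ∈ S) (x : ℝ≥0) : 1 ≤ wt S x := by
  have := ENNReal.le_tsum (f := fun l : S => (x : ℝ≥0∞) ^ l.1.length) ⟨[], h⟩
  simpa [wt] using this

lemma hasSum_wt {S : Set (List Bool)} {x : ℝ≥0} (h : wt S x ≠ ∞) :
    HasSum (fun n => ((slice S n).card : ℝ) * (x : ℝ) ^ n) (wt S x).toReal := by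
  rw [wt_eq_tsum] at h ⊢
  have := ENNReal.hasSum_toReal h
  rw [← ENNReal.tsum_toReal_eq (fun n => ENNReal.ne_top_of_tsum_ne_top h n)] at this
  simpa using this

/-! ### Bridges and arches in a strip -/

/-- The vertices in a strip of `k` columns. -/
def strip (k : ℕ) : Set Eis := {z | 0 < abscissa z ∧ abscissa z ≤ 3 * k}

/-- The walks that cross a strip from its left to its right boundary. -/
def bridges (k : ℕ) : Set (List Bool) := {l | l ∈ walks (strip k) ∧ abscissa (head l) = 3 * k + 2}

/-- The walks that leave a strip through the left boundary, where they start. -/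
def arches (k : ℕ) : Set (List Bool) := {l | l ∈ walks (strip k) ∧ abscissa (head l) ≤ 0}

lemma pos_of_mem_strip {k : ℕ} : ∀ z ∈ strip k, 0 < abscissa z := fun _ h => h.1

lemma pt_mem_visited {l : List Bool} (h : l ≠ []) : pt l ∈ visited l := by
  rcases List.eq_nil_or_concat l with rfl | ⟨m, t, rfl⟩
  · exact absurd rfl h
  · rw [List.concat_eq_append, pt_concat, visited_concat]; simp

lemma abscissa_dir_mul_emod {c : ℤ} (hc : c % 2 = 0) (z : Eis) :
    abscissa (dir c * z) % 3 = abscissa z % 3 := by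
  rw [abscissa_emod, abscissa_emod, colour_dir_mul, if_pos hc]

/-- A line perpendicular to an edge direction, if crossed at the right place, is crossed in this
direction only. -/
lemma crossing {l : List Bool} {c : ℤ} {M : ℕ} (hc : c % 2 = 0)
    (h1 : abscissa (dir (-c) * pt l) ≤ 3 * M) (h2 : 3 * M < abscissa (dir (-c) * head l)) :
    (turning l - c) % 6 = 0 ∧ abscissa (dir (-c) * head l) = 3 * M + 2 := by
  have e : abscissa (dir (-c) * head l) = abscissa (dir (-c) * pt l) +
      abscissa (dir (turning l - c)) := by
    rw [head, mul_add, abscissa_add, ← dir_add, show -c + turning l = turning l - c by ring]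
  have r1 := abscissa_head_emod l
  have r2 := abscissa_pt_emod l
  rw [← abscissa_dir_mul_emod (c := -c) (by omega)] at r1 r2
  rcases abscissa_dir (turning l - c) with h | h | h | h | h | h <;> split_ifs at r1 r2 <;> omega

/-- The left boundary of the half-plane `0 < Re z` is crossed in the direction `-1` only, and not at
the starting point. -/
lemma crossing_left {l : List Bool} {Ω : Set Eis} (hΩ : ∀ z ∈ Ω, 0 < abscissa z) (hl : l ∈ walks Ω)
    (h2 : abscissa (head l) ≤ 0) :
    turning l % 6 = 3 ∧ abscissa (head l) = 0 ∧ head l ≠ 0 := by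
  have hne : l ≠ [] := by rintro rfl; simp at h2
  have h1 : 0 < abscissa (pt l) := hΩ _ (hl.2 _ (pt_mem_visited hne))
  have e : abscissa (head l) = abscissa (pt l) + abscissa (dir (turning l)) := by
    rw [head, abscissa_add]
  have r1 := abscissa_head_emod l
  have r2 := abscissa_pt_emod l
  have key : turning l % 6 = 3 ∧ abscissa (head l) = 0 := by
    rcases abscissa_dir (turning l) with h | h | h | h | h | h <;> split_ifs at r1 r2 <;> omega
  refine ⟨key.1, key.2, fun h0 => ?_⟩
  have hp : pt l = 1 := by
    have hd : dir (turning l) = -1 := by rw [dir_emod, key.1, dir_three]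
    rw [head, hd] at h0
    exact add_neg_eq_zero.1 h0
  rcases List.eq_nil_or_concat l with rfl | ⟨m, t, rfl⟩
  · exact hne rfl
  · rw [List.concat_eq_append] at *
    rw [pt_concat] at hp
    rcases m with _ | ⟨u, m⟩
    · have := key.1
      rcases sgn_cases t with h | h <;> simp [h] at this
    · apply (saw_concat_iff.1 hl.1).2
      rw [hp, visited_cons]; simp

lemma abs_turning_le_left {l : List Bool} {Ω : Set Eis} (hΩ : ∀ z ∈ Ω, 0 < abscissa z)
    (hl : l ∈ walks Ω) (h2 : abscissa (head l) ≤ 0) : |turning l| ≤ 3 := by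
  obtain ⟨ht, h0, hne⟩ := crossing_left hΩ hl h2
  have hd : dir (-turning l) = -1 := by
    rw [dir_emod, show (-turning l) % 6 = 3 by omega, dir_three]
  refine abs_turning_le_of_extremal hΩ hl (fun h => ?_) hne h0.ge (fun z hz => ?_) ?_
  · have := hΩ _ h; omega
  · have := hΩ _ (hl.2 z hz)
    rw [hd, neg_one_mul, abscissa_neg, abscissa_sub]; omega
  · rw [hd, neg_one_mul, abscissa_neg]; omega

lemma abs_turning_le_crossing {l : List Bool} {Ω : Set Eis} (hΩ : ∀ z ∈ Ω, 0 < abscissa z)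
    (hl : l ∈ walks Ω) {c : ℤ} {M : ℕ} (hc : c % 2 = 0)
    (hM : ∀ z ∈ Ω, abscissa (dir (-c) * z) ≤ 3 * M) (h0 : 0 < abscissa (head l))
    (h2 : 3 * M < abscissa (dir (-c) * head l)) : |turning l| ≤ 3 ∧ (turning l - c) % 6 = 0 := by
  by_cases hne : l = []
  · subst hne
    refine ⟨by simp, ?_⟩
    rcases Int.emod_two_eq_zero_or_one c with _ | _
    · have e : abscissa (dir (-c) * head []) = abscissa (dir (-c)) := by simp
      rw [e] at h2
      rcases abscissa_dir (-c) with h | h | h | h | h | h <;> simp <;> omega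
    · omega
  have h1 : abscissa (dir (-c) * pt l) ≤ 3 * M := hM _ (hl.2 _ (pt_mem_visited hne))
  obtain ⟨ht, hh⟩ := crossing hc h1 h2
  have hd : dir (-turning l) = dir (-c) := by
    rw [dir_emod, dir_emod (-c)]; congr 1; omega
  refine ⟨abs_turning_le_of_extremal hΩ hl (fun h => ?_) ?_ h0.le (fun z hz => ?_) ?_, ht⟩
  · have := hM _ h; omega
  · intro h; rw [h] at h0; simp at h0
  · have := hM _ (hl.2 z hz)
    rw [hd, mul_sub, abscissa_sub]; omega
  · rw [hd]; omega

lemma turning_of_mem_bridges {k : ℕ} {l : List Bool} (h : l ∈ bridges k) : turning l = 0 := by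
  have := abs_turning_le_crossing (c := 0) (M := k) pos_of_mem_strip h.1 (by norm_num)
    (fun z hz => by simpa using hz.2) (by rw [h.2]; omega) (by simp [h.2])
  rw [abs_le] at this
  omega

lemma turning_of_mem_arches {k : ℕ} {l : List Bool} (h : l ∈ arches k) :
    turning l = 3 ∨ turning l = -3 := by
  have h1 := abs_turning_le_left pos_of_mem_strip h.1 h.2
  have h2 := crossing_left pos_of_mem_strip h.1 h.2
  rw [abs_le] at h1
  omega

/-- A walk that leaves a strip is a bridge or an arch. -/
lemma mem_bridges_or_arches {k : ℕ} {l : List Bool} (hl : l ∈ walks (strip k))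
    (hh : head l ∉ strip k) : l ∈ bridges k ∨ l ∈ arches k := by
  by_cases h0 : abscissa (head l) ≤ 0
  · exact Or.inr ⟨hl, h0⟩
  · left
    refine ⟨hl, ?_⟩
    have h1 : 3 * (k : ℤ) < abscissa (head l) := by
      by_contra h1
      exact hh ⟨by omega, by omega⟩
    by_cases hne : l = []
    · subst hne
      simp at h1 ⊢
      omega
    have := crossing (l := l) (c := 0) (M := k) (by norm_num)
      (by simpa using (hl.2 _ (pt_mem_visited hne)).2) (by simpa using h1)
    simpa using this.2

/-- The part of a strip of `k` columns between the lines perpendicular to the directions `±2` at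
distance proportional to `L`. These are crossed outwards in the directions `±2` only, so that all
walks that leave a trapezoid turn by at most `3`. -/
def trapezoid (k L : ℕ) : Set Eis :=
  {z | z ∈ strip k ∧ abscissa (dir (-2) * z) ≤ 3 * L ∧ abscissa (dir (-(-2)) * z) ≤ 3 * L}

lemma abscissa_dir_two (z : Eis) : abscissa (dir (-(-2)) * z) = -z.re - 2 * z.im := by
  rw [neg_neg, dir_two]; simp [abscissa]; ring

lemma abscissa_dir_neg_two (z : Eis) : abscissa (dir (-2) * z) = z.im - z.re := by
  rw [show dir (-2) = ⟨0, -1⟩ by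
    have := dir_cases (-2); norm_num at this; exact this]
  simp [abscissa]; ring

lemma trapezoid_finite (k L : ℕ) : (trapezoid k L).Finite := by
  refine Set.Finite.of_finite_image (f := fun z : Eis => (z.re, z.im)) ?_ ?_
  · refine ((Set.finite_Icc (-(2 * k + 3 * L : ℤ)) (2 * k + 3 * L)).prod
      (Set.finite_Icc (-(2 * k + 3 * L : ℤ)) (2 * k + 3 * L))).subset ?_
    rintro _ ⟨z, ⟨⟨h1, h2⟩, h3, h4⟩, rfl⟩
    rw [abscissa_dir_neg_two] at h3
    rw [abscissa_dir_two] at h4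
    unfold abscissa at h1 h2
    simp only [Set.mem_prod, Set.mem_Icc]
    omega
  · intro z _ w _ h
    simp only [Prod.mk.injEq] at h
    exact QuadraticAlgebra.ext h.1 h.2

/-- The walks in a finite domain have bounded length. -/
lemma walksN_eq_empty {Ω : Set Eis} (h : Ω.Finite) {n : ℕ} (hn : h.toFinset.card < n) :
    walksN Ω n = ∅ := by
  classical
  rw [Finset.eq_empty_iff_forall_notMem]
  intro l hl
  rw [mem_walksN] at hl
  have h1 : (visited l).toFinset ⊆ h.toFinset := by
    intro z hz
    rw [List.mem_toFinset] at hz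
    exact h.mem_toFinset.2 (hl.2.2 z hz)
  have h2 := Finset.card_le_card h1
  rw [List.toFinset_card_of_nodup hl.2.1, length_visited] at h2
  omega

lemma exists_mem_walks_trapezoid {k : ℕ} {l : List Bool} (hl : l ∈ walks (strip k)) :
    ∃ L, l ∈ walks (trapezoid k L) := by
  classical
  refine ⟨(visited l).toFinset.sup (fun z => (abscissa (dir (-2) * z)).toNat +
    (abscissa (dir (-(-2)) * z)).toNat), hl.1, fun z hz => ⟨hl.2 z hz, ?_⟩⟩
  have := Finset.le_sup (f := fun z => (abscissa (dir (-2) * z)).toNat +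
    (abscissa (dir (-(-2)) * z)).toNat) (List.mem_toFinset.2 hz)
  omega

lemma trapezoid_mono (k : ℕ) {L M : ℕ} (h : L ≤ M) : trapezoid k L ⊆ trapezoid k M :=
  fun z hz => ⟨hz.1, by have := hz.2.1; omega, by have := hz.2.2; omega⟩

lemma cos_nonneg_of_turning {T : ℤ} (h : |T| ≤ 3) : 0 ≤ Real.cos (T * (Real.pi / 8)) := by
  have hT : |(T : ℝ)| ≤ 3 := by exact_mod_cast h
  rw [abs_le] at hT
  have hpi := Real.pi_pos
  apply Real.cos_nonneg_of_mem_Icc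
  constructor <;> nlinarith

lemma obs_nonneg_of_exit_trapezoid {k L n : ℕ} {l : List Bool} (hl : l ∈ exitN (trapezoid k L) n)
    {x : ℝ} (hx : 0 ≤ x) : 0 ≤ obs x l := by
  simp only [exitN, Finset.mem_filter, mem_walksN] at hl
  have hΩ : ∀ z ∈ trapezoid k L, 0 < abscissa z := fun z hz => hz.1.1
  refine mul_nonneg (cos_nonneg_of_turning ?_) (pow_nonneg hx _)
  by_cases h0 : abscissa (head l) ≤ 0
  · exact abs_turning_le_left hΩ hl.1.2 h0
  push Not at h0
  by_cases h1 : 3 * (k : ℤ) < abscissa (head l)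
  · exact (abs_turning_le_crossing (c := 0) (M := k) hΩ hl.1.2 (by norm_num)
      (fun z hz => by simpa using hz.1.2) h0 (by simpa using h1)).1
  by_cases h2 : 3 * (L : ℤ) < abscissa (dir (-2) * head l)
  · exact (abs_turning_le_crossing (c := 2) (M := L) hΩ hl.1.2 (by norm_num)
      (fun z hz => hz.2.1) h0 h2).1
  by_cases h3 : 3 * (L : ℤ) < abscissa (dir (-(-2)) * head l)
  · exact (abs_turning_le_crossing (c := -2) (M := L) hΩ hl.1.2 (by norm_num)
      (fun z hz => hz.2.2) h0 h3).1
  exact absurd ⟨⟨h0, by omega⟩, by omega, by omega⟩ hl.2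

/-- The critical generating function of bridges is at most one. All walks that leave a trapezoid
contribute a nonnegative amount to the exit identity, and a bridge contributes its weight. -/
theorem wt_bridges_le_one {x : ℝ≥0} (hx : 2 * (x : ℝ) * Real.cos (Real.pi / 8) = 1) (k : ℕ) :
    wt (bridges k) x ≤ 1 := by
  classical
  rw [wt, ENNReal.tsum_eq_iSup_sum]
  refine iSup_le fun F => ?_
  have hL : ∀ l : bridges k, ∃ L, l.1 ∈ walks (trapezoid k L) :=
    fun l => exists_mem_walks_trapezoid l.2.1
  choose L hL using hL
  set M := F.sup L with hM
  have hFM : ∀ l ∈ F, l.1 ∈ walks (trapezoid k M) := fun l hl =>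
    walks_mono (trapezoid_mono k (Finset.le_sup hl)) (hL l)
  set n := max ((trapezoid_finite k M).toFinset.card + 1) (F.sup (fun l => l.1.length) + 1) with hn
  have hid := sum_exitN_add (Ω := trapezoid k M) (fun z hz => hz.1.1) hx n
  rw [walksN_eq_empty (trapezoid_finite k M) (by omega), Finset.sum_empty, add_zero] at hid
  have hreal : ∑ l ∈ F, (x : ℝ) ^ l.1.length ≤ 1 := by
    rw [← hid, ← Finset.sum_fiberwise_of_maps_to (t := Finset.range n) (g := fun l => l.1.length)]
    · refine Finset.sum_le_sum fun i _ => ?_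
      have : ∑ l ∈ F with l.1.length = i, (x : ℝ) ^ l.1.length =
          ∑ l ∈ (F.filter (fun l => l.1.length = i)).map (Function.Embedding.subtype _),
            obs x l := by
        rw [Finset.sum_map]
        refine Finset.sum_congr rfl fun l _ => ?_
        simp [obs, turning_of_mem_bridges l.2]
      rw [this]
      refine Finset.sum_le_sum_of_subset_of_nonneg ?_ ?_
      · intro l hl
        simp only [Finset.mem_map, Finset.mem_filter, Function.Embedding.subtype_apply] at hl
        obtain ⟨l, ⟨h1, h2⟩, rfl⟩ := hl
        simp only [exitN, Finset.mem_filter, mem_walksN]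
        refine ⟨⟨h2, hFM l h1⟩, fun h => ?_⟩
        have h3 := h.1.2
        have h4 := l.2.2
        omega
      · exact fun l hl _ => obs_nonneg_of_exit_trapezoid hl x.2
    · intro l hl
      have := Finset.le_sup (f := fun l : bridges k => l.1.length) hl
      rw [Finset.mem_range]; omega
  have : (∑ l ∈ F, (x : ℝ≥0∞) ^ l.1.length) = ((∑ l ∈ F, x ^ l.1.length : ℝ≥0) : ℝ≥0∞) := by
    push_cast; rfl
  rw [this, ← ENNReal.coe_one, ENNReal.coe_le_coe, ← NNReal.coe_le_coe]
  push_cast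
  exact hreal

/-! ### Divergence at the critical point -/

lemma head_rev (l : List Bool) : dir (turning l) * head (rev l) = head l := by
  have h1 := pt_rev l
  have h2 : head (rev l) = pt (rev l) + dir (-turning l) := by rw [head, turning_rev]
  rw [h2]
  linear_combination dir_mul_neg (turning l) - h1

/-- The position of a vertex in the frame of the reversed walk. -/
lemma head_sub_mul_head_rev (l₁ l₂ : List Bool) (t : Bool) :
    head (l₁ ++ t :: l₂) - dir (turning (l₁ ++ t :: l₂)) * head (rev l₂) = head l₁ := by
  rw [show l₁ ++ t :: l₂ = (l₁ ++ [t]) ++ l₂ by simp, head_append, turning_append (l₁ ++ [t]),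
    dir_add, pt_concat]
  linear_combination -dir (turning (l₁ ++ [t])) * head_rev l₂

lemma dir_turning_of_mem_arches {k : ℕ} {l : List Bool} (h : l ∈ arches k) :
    dir (turning l) = -1 := by
  rw [dir_emod, show turning l % 6 = 3 by rcases turning_of_mem_arches h with h | h <;> omega,
    dir_three]

lemma rev_mem_arches {k : ℕ} {l : List Bool} (h : l ∈ arches k) : rev l ∈ arches k := by
  have hd := dir_turning_of_mem_arches h
  have h0 := (crossing_left pos_of_mem_strip h.1 h.2).2.1
  have hr := head_rev l
  rw [hd] at hr
  refine ⟨⟨saw_rev_iff.2 h.1.1, fun z hz => ?_⟩, ?_⟩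
  · have := h.1.2 _ (mem_visited_rev.1 hz)
    rw [hd] at this
    unfold strip at *
    simp only [Set.mem_ofPred_eq, abscissa_sub, neg_one_mul, abscissa_neg] at this ⊢
    omega
  · rw [← hr, neg_one_mul, abscissa_neg] at h0
    omega

/-- An arch that reaches the last column of a strip may be cut there, and continued through the
right boundary. -/
lemma bridge_of_arch {k : ℕ} {l₁ l₂ : List Bool} {t : Bool} (h : l₁ ++ t :: l₂ ∈ arches (k + 1))
    (hz : abscissa (head l₁) = 3 * k + 3) : l₁ ++ [!t] ∈ bridges (k + 1) := by
  have e1 : l₁ ++ t :: l₂ = (l₁ ++ [t]) ++ l₂ := by simp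
  have hw : l₁ ++ [t] ∈ walks (strip (k + 1)) :=
    ⟨(e1 ▸ h.1.1).left, fun z hz => h.1.2 z (e1 ▸ visited_subset_append _ _ hz)⟩
  have hw' : l₁ ++ [!t] ∈ walks (strip (k + 1)) := by
    rw [concat_mem_walks] at hw ⊢; exact hw
  have hpt : abscissa (pt l₁) ≤ 3 * k + 3 := by
    by_cases hne : l₁ = []
    · subst hne; simp; omega
    · have := (h.1.2 _ (visited_subset_append _ _ (pt_mem_visited hne))).2
      push_cast at this; omega
  have hstep : abscissa (head l₁) = abscissa (pt l₁) + abscissa (dir (turning l₁)) := by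
    rw [head, abscissa_add]
  have hnext : abscissa (head (l₁ ++ [t])) ≤ 3 * k + 3 := by
    rcases l₂ with _ | ⟨u, l₂⟩
    · have := h.2; omega
    · have : head (l₁ ++ [t]) ∈ visited (l₁ ++ t :: u :: l₂) :=
        mem_visited_iff.2 ⟨l₁ ++ [t], u, l₂, by simp, rfl⟩
      have := (h.1.2 _ this).2
      push_cast at this; omega
  have hcol := abscissa_head_emod l₁
  have hnx : ∀ u, abscissa (head (l₁ ++ [u])) =
      abscissa (head l₁) + abscissa (dir (turning l₁ + sgn u)) := by
    intro u; rw [head, pt_concat, abscissa_add]; simp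
  refine ⟨hw', ?_⟩
  rw [hnx] at hnext ⊢
  rw [sgn_not]
  push_cast
  have a0 := abscissa_dir (turning l₁)
  have a1 := abscissa_dir (turning l₁ + sgn t)
  have a2 := abscissa_dir (turning l₁ + -sgn t)
  rcases sgn_cases t with hs | hs <;> rw [hs] at a1 a2 hnext ⊢ <;> split_ifs at hcol <;> omega

/-- An arch that leaves a narrower strip decomposes into two bridges. -/
lemma exists_bridges_of_arch {k : ℕ} {l : List Bool} (h : l ∈ arches (k + 1)) (h' : l ∉ arches k) :
    ∃ l₁ t l₂, l = l₁ ++ t :: l₂ ∧ l₁ ++ [!t] ∈ bridges (k + 1) ∧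
      rev l₂ ++ [t] ∈ bridges (k + 1) := by
  obtain ⟨l₁, t, l₂, rfl, hz⟩ : ∃ l₁ t l₂, l = l₁ ++ t :: l₂ ∧ abscissa (head l₁) = 3 * k + 3 := by
    by_contra! hno
    apply h'
    refine ⟨⟨h.1.1, fun z hz => ⟨(h.1.2 z hz).1, ?_⟩⟩, h.2⟩
    by_contra! hgt
    have hle := (h.1.2 z hz).2
    push_cast at hle
    obtain ⟨l₁, t, l₂, rfl, rfl⟩ := mem_visited_iff.1 hz
    have hz1 := hno l₁ t l₂ rfl
    have hcol := abscissa_head_emod l₁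
    have hz2 : abscissa (head l₁) = 3 * k + 2 := by
      split_ifs at hcol <;> omega
    have hpar : turning l₁ % 2 = 0 := by
      by_contra hp; rw [if_neg hp] at hcol; omega
    have hstep : abscissa (head l₁) = abscissa (pt l₁) + abscissa (dir (turning l₁)) := by
      rw [head, abscissa_add]
    rcases abscissa_dir (turning l₁) with ha | ha | ha | ha | ha | ha
    · -- The walk moves on to the second vertex of the last column.
      have hnx : abscissa (head (l₁ ++ [t])) =
          abscissa (head l₁) + abscissa (dir (turning l₁ + sgn t)) := by
        rw [head, pt_concat, abscissa_add]; simp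
      have hn : abscissa (head (l₁ ++ [t])) = 3 * k + 3 := by
        have := abscissa_dir (turning l₁ + sgn t)
        rcases sgn_cases t with hs | hs <;> rw [hs] at this hnx <;> omega
      rcases l₂ with _ | ⟨u, l₂⟩
      · have := h.2; omega
      · exact hno (l₁ ++ [t]) u l₂ (by simp) hn
    · omega
    · -- The walk comes from the second vertex of the last column.
      rcases List.eq_nil_or_concat l₁ with rfl | ⟨m, u, rfl⟩
      · simp at ha
      · rw [List.concat_eq_append] at *
        exact hno m u (t :: l₂) (by simp) (by rw [← pt_concat m u]; omega)
    · rcases List.eq_nil_or_concat l₁ with rfl | ⟨m, u, rfl⟩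
      · simp at ha
      · rw [List.concat_eq_append] at *
        have hm : pt (m ++ [u]) ∈ visited (m ++ [u] ++ t :: l₂) :=
          visited_subset_append _ _ (pt_mem_visited (by simp))
        have := (h.1.2 _ hm).2
        push_cast at this
        omega
    · rcases List.eq_nil_or_concat l₁ with rfl | ⟨m, u, rfl⟩
      · simp at ha
      · rw [List.concat_eq_append] at *
        exact hno m u (t :: l₂) (by simp) (by rw [← pt_concat m u]; omega)
    · omega
  refine ⟨l₁, t, l₂, rfl, bridge_of_arch h hz, ?_⟩
  have hr := rev_mem_arches h
  have hd := dir_turning_of_mem_arches h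
  have h0 := (crossing_left pos_of_mem_strip h.1 h.2).2.1
  have hpos := head_sub_mul_head_rev l₁ l₂ t
  have e : rev (l₁ ++ t :: l₂) = rev l₂ ++ (!t) :: rev l₁ := by simp
  rw [e] at hr
  have hz' : abscissa (head (rev l₂)) = 3 * k + 3 := by
    rw [← hz, ← hpos, hd, abscissa_sub, neg_one_mul, abscissa_neg, h0]; ring
  simpa using bridge_of_arch hr hz'

lemma wt_arches_succ_le (k : ℕ) (x : ℝ≥0) :
    x * wt (arches (k + 1)) x ≤ x * wt (arches k) x + wt (bridges (k + 1)) x ^ 2 := by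
  have h1 : wt (arches (k + 1)) x ≤ wt (arches k) x + wt (arches (k + 1) \ arches k) x := by
    refine le_trans (wt_mono ?_ x) (wt_union_le _ _ x)
    intro l hl
    by_cases h : l ∈ arches k
    · exact Or.inl h
    · exact Or.inr ⟨hl, h⟩
  have h2 : x * wt (arches (k + 1) \ arches k) x ≤ wt (bridges (k + 1)) x ^ 2 := by
    have hex : ∀ l : ↥(arches (k + 1) \ arches k), ∃ p : List Bool × Bool × List Bool,
        l.1 = p.1 ++ p.2.1 :: p.2.2 ∧ p.1 ++ [!p.2.1] ∈ bridges (k + 1) ∧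
          rev p.2.2 ++ [p.2.1] ∈ bridges (k + 1) := by
      rintro ⟨l, hl⟩
      obtain ⟨l₁, t, l₂, h⟩ := exists_bridges_of_arch hl.1 hl.2
      exact ⟨(l₁, t, l₂), h⟩
    choose p hp hp1 hp2 using hex
    let f : ↥(arches (k + 1) \ arches k) → bridges (k + 1) × bridges (k + 1) :=
      fun l => (⟨_, hp1 l⟩, ⟨_, hp2 l⟩)
    have hf : Function.Injective f := by
      intro a b hab
      simp only [f, Prod.mk.injEq, Subtype.mk.injEq] at hab
      have i1 := List.append_inj' hab.1 (by simp)
      have i2 := List.append_inj' hab.2 (by simp)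
      have i3 : (p a).2.2 = (p b).2.2 := by rw [← rev_rev (p a).2.2, i2.1, rev_rev]
      have i4 : (p a).2.1 = (p b).2.1 := by simpa using i2.2
      ext1
      rw [hp a, hp b, i1.1, i3, i4]
    have hprod : wt (bridges (k + 1)) x ^ 2 = ∑' q : bridges (k + 1) × bridges (k + 1),
        (x : ℝ≥0∞) ^ q.1.1.length * (x : ℝ≥0∞) ^ q.2.1.length := by
      rw [sq, wt, ← ENNReal.tsum_mul_right, ENNReal.tsum_prod']
      exact tsum_congr fun a => ENNReal.tsum_mul_left.symm
    rw [hprod, wt, ← ENNReal.tsum_mul_left]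
    refine le_trans (le_of_eq (tsum_congr fun l => ?_))
      (ENNReal.tsum_comp_le_tsum_of_injective hf _)
    simp only [f]
    rw [← pow_succ', ← pow_add, hp l]
    congr 1
    simp; omega
  calc x * wt (arches (k + 1)) x ≤ x * (wt (arches k) x + wt (arches (k + 1) \ arches k) x) := by
        gcongr
    _ ≤ x * wt (arches k) x + wt (bridges (k + 1)) x ^ 2 := by rw [mul_add]; gcongr

/-- All self-avoiding walks. -/
def saws : Set (List Bool) := {l | SAW l}

lemma bridges_subset (k : ℕ) : bridges k ⊆ saws := fun _ h => h.1.1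
lemma arches_subset (k : ℕ) : arches k ⊆ saws := fun _ h => h.1.1

/-- The exit identity in a strip, if the walks with many vertices are negligible. -/
lemma strip_identity {x : ℝ≥0} (hx : 2 * (x : ℝ) * Real.cos (Real.pi / 8) = 1)
    (hfin : wt saws x ≠ ∞) (k : ℕ) :
    Real.cos (3 * (Real.pi / 8)) * (wt (arches k) x).toReal + (wt (bridges k) x).toReal = 1 := by
  have hA := hasSum_wt (ne_top_of_le_ne_top hfin (wt_mono (arches_subset k) x))
  have hB := hasSum_wt (ne_top_of_le_ne_top hfin (wt_mono (bridges_subset k) x))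
  have hS := hasSum_wt hfin
  have hsum := ((hA.mul_left (Real.cos (3 * (Real.pi / 8)))).add hB).tendsto_sum_nat
  have hexit : ∀ n, ∑ l ∈ exitN (strip k) n, obs x l =
      Real.cos (3 * (Real.pi / 8)) * (((slice (arches k) n).card : ℝ) * (x : ℝ) ^ n) +
        ((slice (bridges k) n).card : ℝ) * (x : ℝ) ^ n := by
    intro n
    classical
    have hunion : exitN (strip k) n = slice (arches k) n ∪ slice (bridges k) n := by
      ext l
      simp only [exitN, Finset.mem_filter, Finset.mem_union, mem_slice]
      constructor
      · rintro ⟨⟨h1, h2⟩, h3⟩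
        rcases mem_bridges_or_arches h2 h3 with h | h
        exacts [Or.inr ⟨h1, h⟩, Or.inl ⟨h1, h⟩]
      · rintro (⟨h1, h2⟩ | ⟨h1, h2⟩)
        · exact ⟨⟨h1, h2.1⟩, fun h => by have := h.1; have := h2.2; omega⟩
        · exact ⟨⟨h1, h2.1⟩, fun h => by have := h.2; have := h2.2; omega⟩
    have hdisj : Disjoint (slice (arches k) n) (slice (bridges k) n) := by
      rw [Finset.disjoint_left]
      intro l h1 h2
      have h3 := (mem_slice.1 h1).2.2
      have h4 := (mem_slice.1 h2).2.2
      omega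
    rw [hunion, Finset.sum_union hdisj]
    congr 1
    · rw [Finset.sum_congr rfl (g := fun _ => Real.cos (3 * (Real.pi / 8)) * (x : ℝ) ^ n)]
      · simp; ring
      · intro l hl
        rw [mem_slice] at hl
        rw [obs, hl.1]
        rcases turning_of_mem_arches hl.2 with h | h <;> rw [h]
        · norm_num
        · rw [← Real.cos_neg]; norm_num
    · rw [Finset.sum_congr rfl (g := fun _ => (x : ℝ) ^ n)]
      · simp
      · intro l hl
        rw [mem_slice] at hl
        rw [obs, hl.1, turning_of_mem_bridges hl.2]
        simp
  have hrem : Tendsto (fun n => ∑ l ∈ walksN (strip k) n, obs x l) atTop (𝓝 0) := by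
    refine squeeze_zero_norm (fun n => ?_) hS.summable.tendsto_atTop_zero
    refine (norm_sum_le _ _).trans ?_
    calc ∑ l ∈ walksN (strip k) n, ‖obs x l‖ ≤ ∑ l ∈ walksN (strip k) n, (x : ℝ) ^ n := by
          refine Finset.sum_le_sum fun l hl => ?_
          rw [mem_walksN] at hl
          rw [obs, hl.1, norm_mul, norm_pow, NNReal.norm_eq]
          exact mul_le_of_le_one_left (pow_nonneg x.2 _) (Real.abs_cos_le_one _)
      _ ≤ ∑ l ∈ slice saws n, (x : ℝ) ^ n :=
          Finset.sum_le_sum_of_subset_of_nonneg (slice_subset (fun _ h => h.1) n)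
            (fun _ _ _ => pow_nonneg x.2 _)
      _ = _ := by simp
  have hid : ∀ n, ∑ i ∈ Finset.range n,
      (Real.cos (3 * (Real.pi / 8)) * (((slice (arches k) i).card : ℝ) * (x : ℝ) ^ i) +
        ((slice (bridges k) i).card : ℝ) * (x : ℝ) ^ i) +
      ∑ l ∈ walksN (strip k) n, obs x l = 1 := by
    intro n
    have := sum_exitN_add (pos_of_mem_strip (k := k)) hx n
    simpa only [hexit] using this
  have hlim := hsum.add hrem
  simp only [hid, add_zero] at hlim
  exact (tendsto_nhds_unique hlim tendsto_const_nhds)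

lemma tsum_wt_bridges_le (x : ℝ≥0) : ∑' k, wt (bridges k) x ≤ wt saws x := by
  have : ∑' k, wt (bridges k) x = ∑' p : (Σ k, bridges k), (x : ℝ≥0∞) ^ p.2.1.length := by
    rw [ENNReal.tsum_sigma']; rfl
  rw [this, wt]
  let f : (Σ k, bridges k) → saws := fun p => ⟨p.2.1, p.2.2.1.1⟩
  have hf : Function.Injective f := by
    rintro ⟨k, l, hl⟩ ⟨m, l', hl'⟩ h
    obtain rfl : l = l' := congrArg Subtype.val h
    obtain rfl : k = m := by
      have h1 := hl.2
      have h2 := hl'.2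
      omega
    rfl
  exact ENNReal.tsum_comp_le_tsum_of_injective hf (fun l : saws => (x : ℝ≥0∞) ^ l.1.length)

/-- A positive sequence with `b k ≤ b (k + 1) * (1 + C * b (k + 1))` is not summable: it would
be bounded below by `b 0 * exp (-C * ∑ b)`. -/
lemma not_summable_of_le {b : ℕ → ℝ} {C : ℝ} (hC : 0 ≤ C) (hb : ∀ k, 0 ≤ b k) (h0 : 0 < b 0)
    (h : ∀ k, b k ≤ b (k + 1) + C * b (k + 1) ^ 2) : ¬ Summable b := by
  intro hs
  have hlow : ∀ n, b 0 ≤ b n * Real.exp (C * ∑ i ∈ Finset.range (n + 1), b i) := by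
    intro n
    induction n with
    | zero => exact le_mul_of_one_le_right h0.le (Real.one_le_exp (by simp; positivity))
    | succ n ih =>
      rw [Finset.sum_range_succ, mul_add, Real.exp_add]
      have h1 : b n ≤ b (n + 1) * Real.exp (C * b (n + 1)) := by
        have := Real.add_one_le_exp (C * b (n + 1))
        nlinarith [h n, hb (n + 1)]
      calc b 0 ≤ b n * Real.exp (C * ∑ i ∈ Finset.range (n + 1), b i) := ih
        _ ≤ (b (n + 1) * Real.exp (C * b (n + 1))) *
            Real.exp (C * ∑ i ∈ Finset.range (n + 1), b i) := by gcongr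
        _ = _ := by ring
  have hlow' : ∀ n, b 0 ≤ b n * Real.exp (C * ∑' i, b i) := fun n =>
    (hlow n).trans (by
      have := hs.sum_le_tsum (Finset.range (n + 1)) (fun i _ => hb i)
      have := hb n
      gcongr)
  have hlim := hs.tendsto_atTop_zero.mul_const (Real.exp (C * ∑' i, b i))
  rw [zero_mul] at hlim
  exact absurd (ge_of_tendsto' hlim hlow') (not_le.2 h0)

lemma pos_of_critical {x : ℝ≥0} (hx : 2 * (x : ℝ) * Real.cos (Real.pi / 8) = 1) :
    (0 : ℝ) < x := by
  rcases x.2.eq_or_lt with h | h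
  · rw [show (x : ℝ) = 0 from h.symm] at hx; norm_num at hx
  · exact h

/-- At the critical point the generating function of self-avoiding walks is infinite. -/
theorem wt_saws_critical {x : ℝ≥0} (hx : 2 * (x : ℝ) * Real.cos (Real.pi / 8) = 1) :
    wt saws x = ∞ := by
  by_contra hfin
  have hx0 := pos_of_critical hx
  have hc : 0 ≤ Real.cos (3 * (Real.pi / 8)) := by
    have := cos_nonneg_of_turning (T := 3) (by norm_num)
    exact_mod_cast this
  have hA : ∀ k, wt (arches k) x ≠ ∞ := fun k =>
    ne_top_of_le_ne_top hfin (wt_mono (arches_subset k) x)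
  have hB : ∀ k, wt (bridges k) x ≠ ∞ := fun k =>
    ne_top_of_le_ne_top hfin (wt_mono (bridges_subset k) x)
  have hsum : Summable (fun k => (wt (bridges k) x).toReal) :=
    ENNReal.summable_toReal (ne_top_of_le_ne_top hfin (tsum_wt_bridges_le x))
  refine not_summable_of_le (C := Real.cos (3 * (Real.pi / 8)) / x) (by positivity)
    (fun k => ENNReal.toReal_nonneg) ?_ (fun k => ?_) hsum
  · refine ENNReal.toReal_pos (fun h => ?_) (hB 0)
    have := one_le_wt (S := bridges 0) ⟨nil_mem_walks _, by simp⟩ x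
    rw [h] at this
    simp at this
  · have i1 := strip_identity hx hfin k
    have i2 := strip_identity hx hfin (k + 1)
    have i3 := wt_arches_succ_le k x
    have i4 : (x : ℝ) * (wt (arches (k + 1)) x).toReal ≤
        x * (wt (arches k) x).toReal + (wt (bridges (k + 1)) x).toReal ^ 2 := by
      have hr : (x : ℝ≥0∞) * wt (arches k) x + wt (bridges (k + 1)) x ^ 2 ≠ ∞ :=
        ENNReal.add_ne_top.2 ⟨ENNReal.mul_ne_top ENNReal.coe_ne_top (hA k),
          ENNReal.pow_ne_top (hB (k + 1))⟩
      have := ENNReal.toReal_mono hr i3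
      rw [ENNReal.toReal_add (ENNReal.mul_ne_top ENNReal.coe_ne_top (hA k))
        (ENNReal.pow_ne_top (hB (k + 1)))] at this
      simpa using this
    have i5 : (wt (arches (k + 1)) x).toReal - (wt (arches k) x).toReal ≤
        (wt (bridges (k + 1)) x).toReal ^ 2 / x := by
      rw [le_div_iff₀ hx0]; linarith
    have i6 := mul_le_mul_of_nonneg_left i5 hc
    rw [div_mul_eq_mul_div, ← mul_div_assoc'] at *
    linarith

/-! ### The decomposition of walks into bridges -/

/-- The last vertex visited with a given property. -/
lemma exists_last_visited {P : Eis → Prop} {l : List Bool} (h : ∃ z ∈ visited l, P z) :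
    ∃ l₁ t l₂, l = l₁ ++ t :: l₂ ∧ P (head l₁) ∧
      ∀ a u b, l₂ = a ++ u :: b → ¬ P (head (l₁ ++ t :: a)) := by
  induction l using List.reverseRecOn with
  | nil => simp at h
  | append_singleton m t ih =>
    by_cases hP : P (head m)
    · exact ⟨m, t, [], rfl, hP, by simp⟩
    · have h' : ∃ z ∈ visited m, P z := by
        obtain ⟨z, hz, hPz⟩ := h
        rw [visited_concat, List.mem_append, List.mem_singleton] at hz
        rcases hz with hz | rfl
        exacts [⟨z, hz, hPz⟩, absurd hPz hP]
      obtain ⟨l₁, t', l₂, rfl, h1, h2⟩ := ih h'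
      refine ⟨l₁, t', l₂ ++ [t], by simp, h1, fun a u b hab => ?_⟩
      rcases List.eq_nil_or_concat b with rfl | ⟨b, v, rfl⟩
      · rw [← (List.append_inj' hab (by simp)).1]; exact hP
      · have : l₂ ++ [t] = (a ++ u :: b) ++ [v] := by simpa using hab
        exact h2 a u b (List.append_inj' this (by simp)).1

lemma abscissa_head (l : List Bool) :
    abscissa (head l) = abscissa (pt l) + abscissa (dir (turning l)) := by
  rw [head, abscissa_add]

lemma abscissa_head_concat (l : List Bool) (t : Bool) :
    abscissa (head (l ++ [t])) = abscissa (head l) + abscissa (dir (turning l + sgn t)) := by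
  rw [abscissa_head, pt_concat]; simp

lemma head_mem_visited (l₁ : List Bool) (t : Bool) (l₂ : List Bool) :
    head l₁ ∈ visited (l₁ ++ t :: l₂) := mem_visited_iff.2 ⟨l₁, t, l₂, rfl, rfl⟩

lemma mem_visited_append_right {l₁ l₂ : List Bool} {z : Eis} (h : z ∈ visited l₂) :
    pt l₁ + dir (turning l₁) * z ∈ visited (l₁ ++ l₂) := by
  rw [visited_append, List.mem_append]
  exact Or.inr (List.mem_map_of_mem h)

/-- A walk in the closed half-plane `0 ≤ Re z` is a walk in the open half-plane, except for
its last vertex. -/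
lemma exists_append_of_nonneg {l : List Bool} (hl : ∀ z ∈ visited l, 0 ≤ abscissa z) :
    ∃ h e, l = h ++ e ∧ e.length ≤ 1 ∧ ∀ z ∈ visited h, 0 < abscissa z := by
  have key : ∀ a v b, l = a ++ v :: b → abscissa (head a) = 0 → b = [] := by
    rintro a v b rfl h0
    by_contra hb
    obtain ⟨u, b, rfl⟩ := List.exists_cons_of_ne_nil hb
    have h1 : 0 ≤ abscissa (pt a) := by
      by_cases ha : a = []
      · subst ha; simp
      · exact hl _ (visited_subset_append _ _ (pt_mem_visited ha))
    have h2 : 0 ≤ abscissa (head (a ++ [v])) := hl _ (by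
      have := head_mem_visited (a ++ [v]) u b; simpa using this)
    have h3 := abscissa_head a
    have h4 := abscissa_head_concat a v
    have h5 := abscissa_head_emod a
    have a0 := abscissa_dir (turning a)
    have a1 := abscissa_dir (turning a + sgn v)
    rcases sgn_cases v with hs | hs <;> rw [hs] at a1 h4 <;> split_ifs at h5 <;> omega
  by_cases hex : ∃ z ∈ visited l, abscissa z = 0
  · obtain ⟨z, hz, h0⟩ := hex
    obtain ⟨a, v, b, rfl, rfl⟩ := mem_visited_iff.1 hz
    obtain rfl := key a v b rfl h0
    refine ⟨a, [v], rfl, by simp, fun z hz => ?_⟩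
    have h1 := hl z (visited_subset_append _ _ hz)
    rcases h1.eq_or_lt with h | h
    · obtain ⟨c, w, d, rfl, rfl⟩ := mem_visited_iff.1 hz
      have := key c w (d ++ [v]) (by simp) h.symm
      simp at this
    · exact h
  · push Not at hex
    exact ⟨l, [], by simp, by simp, fun z hz => lt_of_le_of_ne (hl z hz) (hex z hz).symm⟩

/-- A self-avoiding walk, cut at the last visit to its rightmost vertices: the first part becomes
extremal at its end (after one modification of the last turn); the rest, up to one vertex at either
end, runs in the half-plane to the left of the cut. Rightmost vertices from which no edge leads
horizontally to the right can occur at the very end of the walk only. -/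
lemma exists_cut {l : List Bool} (hl : SAW l) {k : ℕ}
    (hle : ∀ z ∈ visited l, abscissa z ≤ 3 * k + 3) (hex : ∃ z ∈ visited l, 3 * k < abscissa z) :
    (∃ l₁ t, l = l₁ ++ [t] ∧ turning l₁ % 6 = 0 ∧ abscissa (head l₁) = 3 * k + 2 ∧
      ∀ z ∈ visited l₁, abscissa z ≤ 3 * k) ∨
    (∃ l₁ t s h e, l = l₁ ++ (s ++ (h ++ e)) ∧ turning (l₁ ++ [t]) % 6 = 0 ∧
      abscissa (head (l₁ ++ [t])) = 3 * k + 5 ∧ head l₁ ∉ visited l₁ ∧ head l₁ ∈ visited l ∧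
      s.length ≤ 2 ∧ e.length ≤ 1 ∧ SAW h ∧
      ∀ z ∈ visited h, 0 < abscissa z ∧ ∃ w ∈ visited l, abscissa z = 3 * k + 2 - abscissa w) := by
  by_cases hmax : ∃ z ∈ visited l, abscissa z = 3 * k + 3
  · right
    obtain ⟨l₁, t, l₂, rfl, hz, hlast⟩ := exists_last_visited hmax
    have hcol := abscissa_head_emod l₁
    have hodd : turning l₁ % 2 = 1 := by split_ifs at hcol <;> omega
    have hne : l₁ ≠ [] := by rintro rfl; simp at hodd
    have hpt := hle _ (visited_subset_append l₁ (t :: l₂) (pt_mem_visited hne))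
    have hst := abscissa_head l₁
    have hT : turning l₁ % 6 = 1 ∨ turning l₁ % 6 = 5 := by
      have := abscissa_dir (turning l₁); omega
    obtain ⟨t', ht'⟩ : ∃ t', turning (l₁ ++ [t']) % 6 = 0 := by
      rcases hT with h | h
      · exact ⟨false, by simp; omega⟩
      · exact ⟨true, by simp; omega⟩
    have hhd : abscissa (head (l₁ ++ [t'])) = 3 * k + 5 := by
      rw [abscissa_head, pt_concat, hz]
      have := abscissa_dir (turning (l₁ ++ [t'])); omega
    have e1 : ∀ m, l₁ ++ t :: m = (l₁ ++ [t]) ++ m := by simp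
    have hnv : head l₁ ∉ visited l₁ := by
      rw [e1] at hl; exact (saw_concat_iff.1 hl.left).2
    refine ⟨l₁, t', ?_⟩
    rcases l₂ with _ | ⟨u, l₃⟩
    · exact ⟨[t], [], [], by simp, ht', hhd, hnv, head_mem_visited _ _ _, by simp, by simp, saw_nil,
        by simp⟩
    have e2 : l₁ ++ t :: u :: l₃ = (l₁ ++ [t, u]) ++ l₃ := by simp
    have hl₃ : SAW l₃ := by rw [e2] at hl; exact hl.right
    -- The next vertex belongs to the same column.
    have hn1 : head (l₁ ++ [t]) ∈ visited (l₁ ++ t :: u :: l₃) := by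
      have := head_mem_visited (l₁ ++ [t]) u l₃; simpa using this
    have hn1' := hle _ hn1
    have hn2 := abscissa_head_concat l₁ t
    have hT2 : turning (l₁ ++ [t]) % 6 = 2 ∨ turning (l₁ ++ [t]) % 6 = 4 := by
      have := abscissa_dir (turning l₁ + sgn t)
      simp only [turning_append, turning_cons, turning_nil, add_zero]
      rcases sgn_cases t with hs | hs <;> rw [hs] at this hn2 ⊢ <;> omega
    have hpt2 : abscissa (pt (l₁ ++ [t, u])) = 3 * k + 2 := by
      rw [show l₁ ++ [t, u] = (l₁ ++ [t]) ++ [u] by simp, pt_concat, hn2, hz]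
      have := abscissa_dir (turning l₁ + sgn t)
      simp only [turning_append, turning_cons, turning_nil, add_zero] at hT2
      omega
    rcases l₃ with _ | ⟨v, l₄⟩
    · exact ⟨[t, u], [], [], by simp, ht', hhd, hnv, head_mem_visited _ _ _, by simp, by simp,
        saw_nil, by simp⟩
    -- The walk then leaves the column to the left.
    have hT3 : turning (l₁ ++ [t, u]) % 6 = 3 := by
      have h1 := hlast [u] v l₄ rfl
      have h2 : abscissa (head (l₁ ++ [t, u])) = abscissa (pt (l₁ ++ [t, u])) + _ := abscissa_head _
      have h3 := abscissa_dir (turning (l₁ ++ [t, u]))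
      have h4 : turning (l₁ ++ [t, u]) = turning (l₁ ++ [t]) + sgn u := by simp [add_assoc]
      rcases sgn_cases u with hs | hs <;> rw [hs] at h4 <;> omega
    have hd3 : dir (turning (l₁ ++ [t, u])) = -1 := by rw [dir_emod, hT3, dir_three]
    have hvis : ∀ z ∈ visited (v :: l₄), ∃ w ∈ visited (l₁ ++ t :: u :: v :: l₄),
        w = pt (l₁ ++ [t, u]) - z ∧ abscissa z = 3 * k + 2 - abscissa w := by
      intro z hz
      have := mem_visited_append_right (l₁ := l₁ ++ [t, u]) hz
      rw [← e2, hd3, neg_one_mul, ← sub_eq_add_neg] at this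
      refine ⟨_, this, rfl, ?_⟩
      rw [abscissa_sub, hpt2]; ring
    have hnn : ∀ z ∈ visited (v :: l₄), 0 ≤ abscissa z := by
      intro z hz
      obtain ⟨w, hw, hwz, hzw⟩ := hvis z hz
      have h1 := hle w hw
      have h2 : abscissa w ≠ 3 * k + 3 := by
        obtain ⟨a, y, b, hab, rfl⟩ := mem_visited_iff.1 hz
        have h3 := hlast (u :: a) y b (by rw [hab]; simp)
        have h4 : l₁ ++ t :: u :: a = (l₁ ++ [t, u]) ++ a := by simp
        rw [h4, head_append, hd3, neg_one_mul, ← sub_eq_add_neg, ← hwz] at h3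
        exact h3
      omega
    obtain ⟨h, e, hhe, he, hpos⟩ := exists_append_of_nonneg hnn
    refine ⟨[t, u], h, e, by rw [← hhe]; simp, ht', hhd, hnv, head_mem_visited _ _ _, by simp, he,
      ?_, fun z hz => ⟨hpos z hz, ?_⟩⟩
    · rw [hhe] at hl₃; exact hl₃.left
    · obtain ⟨w, hw, -, hzw⟩ := hvis z (hhe ▸ visited_subset_append _ _ hz)
      exact ⟨w, hw, hzw⟩
  · left
    push Not at hmax
    have hle' : ∀ z ∈ visited l, abscissa z ≤ 3 * k + 2 := fun z hz => by
      have := hle z hz; have := hmax z hz; omega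
    have key : ∀ a v b, l = a ++ v :: b → 3 * (k : ℤ) < abscissa (head a) →
        b = [] ∧ turning a % 6 = 0 ∧ abscissa (head a) = 3 * k + 2 := by
      rintro a v b rfl hgt
      have h1 := hle' _ (head_mem_visited a v b)
      have hcol := abscissa_head_emod a
      have h2 : abscissa (head a) = 3 * k + 2 ∧ turning a % 2 = 0 := by
        split_ifs at hcol <;> omega
      have hst := abscissa_head a
      have hT : turning a % 6 = 0 := by
        by_cases ha : a = []
        · subst ha; rfl
        · have h3 := hle' _ (visited_subset_append a (v :: b) (pt_mem_visited ha))
          have := abscissa_dir (turning a); omega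
      refine ⟨?_, hT, h2.1⟩
      by_contra hb
      obtain ⟨u, b, rfl⟩ := List.exists_cons_of_ne_nil hb
      have h4 : abscissa (head (a ++ [v])) ≤ 3 * k + 2 := hle' _ (by
        have := head_mem_visited (a ++ [v]) u b; simpa using this)
      have h5 := abscissa_head_concat a v
      have := abscissa_dir (turning a + sgn v)
      rcases sgn_cases v with hs | hs <;> rw [hs] at this h5 <;> omega
    obtain ⟨z, hz, hgt⟩ := hex
    obtain ⟨a, v, b, rfl, rfl⟩ := mem_visited_iff.1 hz
    obtain ⟨rfl, hT, hh⟩ := key a v b rfl hgt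
    refine ⟨a, v, rfl, hT, hh, fun z hz => ?_⟩
    by_contra! hgt
    obtain ⟨c, w, d, rfl, rfl⟩ := mem_visited_iff.1 hz
    have := (key c w (d ++ [v]) (by simp) hgt).1
    simp at this

/-! ### Convergence below the critical point -/

/-- The lists of at most `n` turns. -/
def short (n : ℕ) : Set (List Bool) := {l | l.length ≤ n}

lemma wt_short_ne_top (n : ℕ) (x : ℝ≥0) : wt (short n) x ≠ ∞ := by
  have : Finite (short n) := (List.finite_length_le Bool n).to_subtype
  have := Fintype.ofFinite (short n)
  rw [wt, tsum_fintype]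
  exact (ENNReal.sum_lt_top.2 fun l _ => ENNReal.pow_lt_top ENNReal.coe_lt_top).ne

lemma wt_mono_right (S : Set (List Bool)) {x y : ℝ≥0} (h : x ≤ y) : wt S x ≤ wt S y :=
  ENNReal.tsum_le_tsum fun l => by gcongr

/-- The walks of `S` without their last turn. -/
def cuts (S : Set (List Bool)) : Set (List Bool) := {l | ∃ t, l ++ [t] ∈ S}

lemma mul_wt_cuts_le (S : Set (List Bool)) (x : ℝ≥0) : x * wt (cuts S) x ≤ wt S x := by
  have h : ∀ l : cuts S, ∃ t, l.1 ++ [t] ∈ S := fun l => l.2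
  choose t ht using h
  rw [wt, ← ENNReal.tsum_mul_left]
  refine le_trans (le_of_eq (tsum_congr fun l => ?_)) (ENNReal.tsum_comp_le_tsum_of_injective
    (f := fun l : cuts S => (⟨_, ht l⟩ : S)) ?_ _)
  · simp [pow_succ']
  · intro a b hab
    exact Subtype.ext (List.append_inj' (congrArg Subtype.val hab) (by simp)).1

/-- The walks whose reversal belongs to `S`. -/
def reversals (S : Set (List Bool)) : Set (List Bool) := {l | rev l ∈ S}

lemma wt_reversals_le (S : Set (List Bool)) (x : ℝ≥0) : wt (reversals S) x ≤ wt S x := by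
  refine wt_le_of_injective (fun l => (⟨rev l.1, l.2⟩ : S)) (fun a b hab => ?_) _ (fun l => ?_)
  · have := congrArg (fun l : S => rev l.1) hab
    simpa using Subtype.ext_iff.2 (by simpa using this)
  · simp

/-- The cut at the last visit to the last column of a strip. -/
lemma walks_strip_succ_subset (k : ℕ) : walks (strip (k + 1)) ⊆
    walks (strip k) ∪ (Set.image2 (· ++ ·) (bridges k) (short 1) ∪
      Set.image2 (· ++ ·) (cuts (bridges (k + 1))) (Set.image2 (· ++ ·) (short 2)
        (Set.image2 (· ++ ·) (walks (strip k)) (short 1)))) := by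
  intro l hl
  by_cases hex : ∃ z ∈ visited l, 3 * (k : ℤ) < abscissa z
  · right
    have hle : ∀ z ∈ visited l, abscissa z ≤ 3 * k + 3 := fun z hz => by
      have := (hl.2 z hz).2; push_cast at this; omega
    rcases exists_cut hl.1 hle hex with ⟨l₁, t, rfl, hT, hh, h1⟩ |
        ⟨l₁, t, s, h, e, rfl, hT, hh, hnv, hv, hs, he, hh1, hh2⟩
    · left
      refine ⟨l₁, ⟨⟨hl.1.left, fun z hz => ⟨?_, h1 z hz⟩⟩, hh⟩, [t], by simp [short], rfl⟩
      exact (hl.2 z (visited_subset_append _ _ hz)).1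
    · right
      refine ⟨l₁, ⟨t, concat_mem_walks.2 ⟨⟨hl.1.left, fun z hz => ?_⟩, hl.2 _ hv, hnv⟩, ?_⟩, _,
        ⟨s, hs, _, ⟨h, ⟨hh1, fun z hz => ⟨(hh2 z hz).1, ?_⟩⟩, e, he, rfl⟩, rfl⟩, rfl⟩
      · exact hl.2 z (visited_subset_append _ _ hz)
      · rw [hh]; push_cast; ring
      · obtain ⟨h0, w, hw, hzw⟩ := hh2 z hz
        have h3 := (hl.2 w hw).1
        have h4 := abscissa_emod z
        have h5 := colour_of_mem_visited hz
        omega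
  · left
    push Not at hex
    exact ⟨hl.1, fun z hz => ⟨(hl.2 z hz).1, hex z hz⟩⟩

/-- The walks in the half-plane to the right of their starting point. -/
def halfPlaneWalks : Set (List Bool) := walks {z | 0 < abscissa z}

lemma rev_mem_halfPlaneWalks {l : List Bool} (hl : SAW l) (hT : turning l % 6 = 0)
    (h : ∀ z ∈ visited l, abscissa z < abscissa (head l)) : rev l ∈ halfPlaneWalks := by
  refine ⟨saw_rev_iff.2 hl, fun z hz => ?_⟩
  have h1 := h _ (mem_visited_rev.1 hz)
  rw [dir_emod, hT, dir_zero, one_mul, abscissa_sub] at h1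
  change 0 < abscissa z
  omega

/-- The cut of an arbitrary walk at the last visit to its rightmost vertices. -/
lemma saws_subset : saws ⊆ short 0 ∪
    (Set.image2 (· ++ ·) (reversals halfPlaneWalks) (short 1) ∪
      Set.image2 (· ++ ·) (cuts (reversals halfPlaneWalks)) (Set.image2 (· ++ ·) (short 2)
        (Set.image2 (· ++ ·) halfPlaneWalks (short 1)))) := by
  classical
  intro l hl
  by_cases hne : l = []
  · left; subst hne; simp [short]
  right
  have hbd : ∃ k : ℕ, ∀ z ∈ visited l, abscissa z ≤ 3 * k + 3 := by
    refine ⟨(visited l).toFinset.sup (fun z => (abscissa z).toNat), fun z hz => ?_⟩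
    have := Finset.le_sup (f := fun z => (abscissa z).toNat) (List.mem_toFinset.2 hz)
    omega
  obtain ⟨k, hle, hex⟩ : ∃ k : ℕ, (∀ z ∈ visited l, abscissa z ≤ 3 * k + 3) ∧
      ∃ z ∈ visited l, 3 * (k : ℤ) < abscissa z := by
    refine ⟨Nat.find hbd, Nat.find_spec hbd, ?_⟩
    rcases hk : Nat.find hbd with _ | j
    · refine ⟨1, ?_, by simp⟩
      obtain ⟨t, m, rfl⟩ := List.exists_cons_of_ne_nil hne
      simp [visited_cons]
    · have := Nat.find_min hbd (m := j) (by omega)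
      push Not at this
      obtain ⟨z, hz, h⟩ := this
      exact ⟨z, hz, by push_cast; omega⟩
  rcases exists_cut hl hle hex with ⟨l₁, t, rfl, hT, hh, h1⟩ |
      ⟨l₁, t, s, h, e, rfl, hT, hh, hnv, hv, hs, he, hh1, hh2⟩
  · left
    refine ⟨l₁, rev_mem_halfPlaneWalks (SAW.left hl) hT (fun z hz => ?_), [t], by simp [short], rfl⟩
    have := h1 z hz; omega
  · right
    refine ⟨l₁, ⟨t, rev_mem_halfPlaneWalks (saw_concat_iff.2 ⟨SAW.left hl, hnv⟩) hT
      (fun z hz => ?_)⟩, _, ⟨s, hs, _, ⟨h, ⟨hh1, fun z hz => (hh2 z hz).1⟩, e, he, rfl⟩, rfl⟩, rfl⟩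
    rw [visited_concat, List.mem_append, List.mem_singleton] at hz
    rcases hz with hz | rfl
    · have := hle z (visited_subset_append _ _ hz); omega
    · have := hle _ hv; omega

lemma abscissa_head_le (l : List Bool) : abscissa (head l) ≤ 2 + 2 * l.length := by
  induction l using List.reverseRecOn with
  | nil => simp
  | append_singleton l t ih =>
    have h := abscissa_head_concat l t
    have := abscissa_dir (turning l + sgn t)
    simp only [List.length_append, List.length_singleton]
    push_cast
    omega

lemma le_length_of_mem_bridges {k : ℕ} {l : List Bool} (h : l ∈ bridges k) : k ≤ l.length := by
  have h1 := abscissa_head_le l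
  have h2 := h.2
  omega

/-- Below the critical point the generating functions of bridges decay exponentially. -/
lemma wt_bridges_le_pow {x r y : ℝ≥0} (hx : 2 * (x : ℝ) * Real.cos (Real.pi / 8) = 1) (hr : r ≤ 1)
    (hy : y = r * x) (k : ℕ) : wt (bridges k) y ≤ (r : ℝ≥0∞) ^ k := by
  calc wt (bridges k) y ≤ ∑' l : bridges k, (r : ℝ≥0∞) ^ k * (x : ℝ≥0∞) ^ l.1.length := by
        refine ENNReal.tsum_le_tsum fun l => ?_
        rw [hy, ENNReal.coe_mul, mul_pow]
        gcongr ?_ * _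
        exact pow_le_pow_right_of_le_one' (by exact_mod_cast hr) (le_length_of_mem_bridges l.2)
    _ = (r : ℝ≥0∞) ^ k * wt (bridges k) x := by rw [ENNReal.tsum_mul_left, wt]
    _ ≤ (r : ℝ≥0∞) ^ k * 1 := by gcongr; exact wt_bridges_le_one hx k
    _ = _ := mul_one _

lemma wt_strip_zero (x : ℝ≥0) : wt (walks (strip 0)) x = 1 := by
  have : walks (strip 0) = {[]} := by
    ext l
    simp only [Set.mem_singleton_iff]
    constructor
    · rintro ⟨-, h⟩
      by_contra hne
      have := h _ (pt_mem_visited hne)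
      have h1 := this.1
      have h2 := this.2
      simp at h2
      omega
    · rintro rfl; exact nil_mem_walks _
  rw [this, wt, tsum_singleton [] (fun l : List Bool => (x : ℝ≥0∞) ^ l.length)]
  simp

/-- The Hammersley–Welsh bound for half-plane walks, strip by strip. -/
lemma exists_wt_strip_succ_le {y : ℝ≥0} (hy : 0 < y) : ∃ C : ℝ≥0, ∀ k,
    wt (walks (strip (k + 1))) y ≤
      wt (walks (strip k)) y * (1 + C * (wt (bridges k) y + wt (bridges (k + 1)) y)) := by
  have hy0 : (y : ℝ≥0∞) ≠ 0 := by exact_mod_cast hy.ne'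
  set c₁ := wt (short 1) y
  set c₂ := (y : ℝ≥0∞)⁻¹ * (wt (short 2) y * wt (short 1) y)
  have hc : c₁ + c₂ ≠ ∞ := ENNReal.add_ne_top.2 ⟨wt_short_ne_top 1 y, ENNReal.mul_ne_top
    (ENNReal.inv_ne_top.2 hy0) (ENNReal.mul_ne_top (wt_short_ne_top 2 y) (wt_short_ne_top 1 y))⟩
  refine ⟨(c₁ + c₂).toNNReal, fun k => ?_⟩
  rw [ENNReal.coe_toNNReal hc]
  set H := wt (walks (strip k)) y
  set b := wt (bridges k) y
  set b' := wt (bridges (k + 1)) y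
  have hH : 1 ≤ H := one_le_wt (nil_mem_walks _) y
  have hcut : wt (cuts (bridges (k + 1))) y ≤ (y : ℝ≥0∞)⁻¹ * b' := by
    rw [← ENNReal.mul_le_iff_le_inv hy0 ENNReal.coe_ne_top]
    exact mul_wt_cuts_le _ _
  calc wt (walks (strip (k + 1))) y
      ≤ H + (wt (Set.image2 (· ++ ·) (bridges k) (short 1)) y +
        wt (Set.image2 (· ++ ·) (cuts (bridges (k + 1))) (Set.image2 (· ++ ·) (short 2)
        (Set.image2 (· ++ ·) (walks (strip k)) (short 1)))) y) := by
        refine (wt_mono (walks_strip_succ_subset k) y).trans ((wt_union_le _ _ y).trans ?_)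
        gcongr
        exact wt_union_le _ _ y
    _ ≤ H + (b * c₁ + (y : ℝ≥0∞)⁻¹ * b' * (wt (short 2) y * (H * c₁))) := by
        gcongr
        · exact wt_image2_append_le _ _ _
        · refine (wt_image2_append_le _ _ _).trans ?_
          gcongr
          refine (wt_image2_append_le _ _ _).trans ?_
          gcongr
          exact wt_image2_append_le _ _ _
    _ = H + (b * c₁ * 1 + c₂ * b' * H) := by ring
    _ ≤ H + ((b + b') * (c₁ + c₂) * H) := by
        have : (b + b') * (c₁ + c₂) * H = b * c₁ * H + c₂ * b' * H + (b * c₂ + b' * c₁) * H := by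
          ring
        rw [this]
        exact add_le_add le_rfl
          ((add_le_add (mul_le_mul' le_rfl hH) le_rfl).trans le_self_add)
    _ = _ := by ring

lemma exists_wt_strip_le {y : ℝ≥0} (hy : 0 < y) {r : ℝ≥0} (hr : r < 1)
    (hb : ∀ k, wt (bridges k) y ≤ (r : ℝ≥0∞) ^ k) :
    ∃ D : ℝ≥0, ∀ k, wt (walks (strip k)) y ≤ D := by
  obtain ⟨C, hC⟩ := exists_wt_strip_succ_le hy
  have hgeo := summable_geometric_of_lt_one r.coe_nonneg (by exact_mod_cast hr)
  have main : ∀ k, wt (walks (strip k)) y ≤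
      ENNReal.ofReal (Real.exp (2 * C * ∑ i ∈ Finset.range k, (r : ℝ) ^ i)) := by
    intro k
    induction k with
    | zero => simp [wt_strip_zero]
    | succ k ih =>
      rw [Finset.sum_range_succ, mul_add, Real.exp_add, ENNReal.ofReal_mul (Real.exp_pos _).le]
      refine (hC k).trans (mul_le_mul' ih ?_)
      have h1 : wt (bridges k) y + wt (bridges (k + 1)) y ≤ 2 * (r : ℝ≥0∞) ^ k := by
        rw [two_mul]
        refine add_le_add (hb k) ((hb (k + 1)).trans ?_)
        exact pow_le_pow_right_of_le_one' (by exact_mod_cast hr.le) (Nat.le_succ k)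
      calc 1 + (C : ℝ≥0∞) * (wt (bridges k) y + wt (bridges (k + 1)) y)
          ≤ 1 + (C : ℝ≥0∞) * (2 * (r : ℝ≥0∞) ^ k) := by gcongr
        _ = ENNReal.ofReal (1 + 2 * C * (r : ℝ) ^ k) := by
            have : (1 + (C : ℝ≥0∞) * (2 * (r : ℝ≥0∞) ^ k)) =
                ((1 + 2 * C * r ^ k : ℝ≥0) : ℝ≥0∞) := by
              push_cast; ring
            rw [this, ← ENNReal.ofReal_coe_nnreal]
            push_cast; rfl
        _ ≤ _ := by
            apply ENNReal.ofReal_le_ofReal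
            have := Real.add_one_le_exp (2 * C * (r : ℝ) ^ k)
            linarith
  refine ⟨(Real.exp (2 * C * ∑' i, (r : ℝ) ^ i)).toNNReal, fun k => (main k).trans ?_⟩
  apply ENNReal.ofReal_le_ofReal
  have := hgeo.sum_le_tsum (Finset.range k) (fun i _ => pow_nonneg r.coe_nonneg i)
  gcongr

lemma wt_halfPlaneWalks_le {y D : ℝ≥0} (h : ∀ k, wt (walks (strip k)) y ≤ D) :
    wt halfPlaneWalks y ≤ D := by
  classical
  rw [wt, ENNReal.tsum_eq_iSup_sum]
  refine iSup_le fun F => ?_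
  set k := F.sup (fun l => (visited l.1).toFinset.sup (fun z => (abscissa z).toNat)) with hk
  have hF : ∀ l ∈ F, l.1 ∈ walks (strip k) := by
    intro l hl
    refine ⟨l.2.1, fun z hz => ⟨l.2.2 z hz, ?_⟩⟩
    have h1 := Finset.le_sup (f := fun z => (abscissa z).toNat) (List.mem_toFinset.2 hz)
    have h2 := Finset.le_sup (f := fun l : halfPlaneWalks =>
      (visited l.1).toFinset.sup (fun z => (abscissa z).toNat)) hl
    rw [← hk] at h2
    have h3 : (abscissa z).toNat ≤ k := h1.trans h2
    omega
  refine le_trans ?_ (h k)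
  have : ∑ l ∈ F, (y : ℝ≥0∞) ^ l.1.length =
      ∑ l ∈ F.attach, (fun l : walks (strip k) => (y : ℝ≥0∞) ^ l.1.length) ⟨l.1.1, hF l.1 l.2⟩ :=
    (Finset.sum_attach F (fun l => (y : ℝ≥0∞) ^ l.1.length)).symm
  rw [this, ← Finset.sum_image (s := F.attach)
    (g := fun l => (⟨l.1.1, hF l.1 l.2⟩ : walks (strip k)))
    (f := fun l : walks (strip k) => (y : ℝ≥0∞) ^ l.1.length)]
  · exact ENNReal.sum_le_tsum _
  · intro a _ b _ hab
    exact Subtype.ext (Subtype.ext (congrArg (fun l : walks (strip k) => l.1) hab))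

/-- Below the critical point the generating function of self-avoiding walks is finite. -/
theorem wt_saws_subcritical {x y : ℝ≥0} (hx : 2 * (x : ℝ) * Real.cos (Real.pi / 8) = 1)
    (hyx : y < x) : wt saws y ≠ ∞ := by
  wlog hy : 0 < y generalizing y
  · have hx0 : 0 < x := lt_of_le_of_lt (zero_le) hyx
    refine ne_top_of_le_ne_top (this (y := x / 2) (NNReal.half_lt_self hx0.ne') (half_pos hx0))
      (wt_mono_right _ ?_)
    rw [nonpos_iff_eq_zero.1 (not_lt.1 hy)]
    exact zero_le
  have hx0 : 0 < x := hy.trans hyx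
  have hy0 : (y : ℝ≥0∞) ≠ 0 := by exact_mod_cast hy.ne'
  obtain ⟨D, hD⟩ := exists_wt_strip_le hy (r := y / x) ((div_lt_one hx0).2 hyx)
    (wt_bridges_le_pow hx ((div_lt_one hx0).2 hyx).le (div_mul_cancel₀ y hx0.ne').symm)
  have hH : wt halfPlaneWalks y ≠ ∞ :=
    ne_top_of_le_ne_top ENNReal.coe_ne_top (wt_halfPlaneWalks_le hD)
  have hR : wt (reversals halfPlaneWalks) y ≠ ∞ := ne_top_of_le_ne_top hH (wt_reversals_le _ _)
  have hC : wt (cuts (reversals halfPlaneWalks)) y ≠ ∞ := by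
    intro h
    have := mul_wt_cuts_le (reversals halfPlaneWalks) y
    rw [h, ENNReal.mul_top hy0] at this
    exact hR (top_le_iff.1 this)
  have himg : ∀ {S T : Set (List Bool)}, wt S y ≠ ∞ → wt T y ≠ ∞ →
      wt (Set.image2 (· ++ ·) S T) y ≠ ∞ := fun hS hT =>
    ne_top_of_le_ne_top (ENNReal.mul_ne_top hS hT) (wt_image2_append_le _ _ _)
  have hun : ∀ {S T : Set (List Bool)}, wt S y ≠ ∞ → wt T y ≠ ∞ → wt (S ∪ T) y ≠ ∞ :=
    fun hS hT => ne_top_of_le_ne_top (ENNReal.add_ne_top.2 ⟨hS, hT⟩) (wt_union_le _ _ _)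
  refine ne_top_of_le_ne_top ?_ (wt_mono saws_subset y)
  exact hun (wt_short_ne_top 0 y) (hun (himg hR (wt_short_ne_top 1 y)) (himg hC
    (himg (wt_short_ne_top 2 y) (himg hH (wt_short_ne_top 1 y)))))

/-! ### Coordinates on the hexagonal lattice -/

/-- The position of a vertex of the hexagonal lattice as an Eisenstein integer. -/
def toEis (v : HexVertex) : Eis := ⟨2 * v.1 + v.2.1 + (if v.2.2 then 1 else 0), v.2.1 - v.1⟩

/-- The vertex at a given position, with a junk value at the centres of the faces. -/
def fromEis (z : Eis) : HexVertex :=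
  ((z.re - z.im) / 3, z.im + (z.re - z.im) / 3, decide (colour z = 1))

lemma colour_toEis (v : HexVertex) : colour (toEis v) = if v.2.2 then 1 else 0 := by
  obtain ⟨a, b, c⟩ := v
  cases c <;> simp [colour, toEis] <;> omega

lemma colour_toEis_ne (v : HexVertex) : colour (toEis v) ≠ 2 := by
  rw [colour_toEis]; split_ifs <;> norm_num

lemma toEis_fromEis {z : Eis} (h : colour z ≠ 2) : toEis (fromEis z) = z := by
  have h1 := colour_lt_three z
  unfold toEis fromEis
  ext
  · simp only [decide_eq_true_eq]
    unfold colour at *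
    split_ifs <;> omega
  · simp

lemma fromEis_toEis (v : HexVertex) : fromEis (toEis v) = v := by
  obtain ⟨a, b, c⟩ := v
  unfold fromEis
  rw [colour_toEis]
  cases c <;> simp [toEis] <;> omega

lemma norm_of_rel {u v : HexVertex} (h : u.2.2 = false ∧ v.2.2 = true ∧
      ((v.1 = u.1 ∧ v.2.1 = u.2.1) ∨ (v.1 = u.1 - 1 ∧ v.2.1 = u.2.1) ∨
        (v.1 = u.1 ∧ v.2.1 = u.2.1 - 1))) : (toEis v - toEis u).norm = 1 := by
  obtain ⟨a, b, c⟩ := u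
  obtain ⟨a', b', c'⟩ := v
  simp only at h
  obtain ⟨rfl, rfl, ⟨rfl, rfl⟩ | ⟨rfl, rfl⟩ | ⟨rfl, rfl⟩⟩ := h <;>
    simp [norm_eq, toEis] <;> ring

/-- Two vertices are adjacent if and only if their positions are at distance one. -/
lemma adj_iff {u v : HexVertex} : hexLattice.Adj u v ↔ (toEis v - toEis u).norm = 1 := by
  rw [hexLattice, SimpleGraph.fromRel_adj]
  constructor
  · rintro ⟨-, h | h⟩
    · exact norm_of_rel h
    · rw [← QuadraticAlgebra.norm_neg, neg_sub]; exact norm_of_rel h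
  · intro h
    have hne : u ≠ v := by rintro rfl; simp at h
    refine ⟨hne, ?_⟩
    obtain ⟨r, -, -, hr⟩ := exists_dir_of_norm_eq_one h 0
    rw [zero_add] at hr
    obtain ⟨a, b, c⟩ := u
    obtain ⟨a', b', c'⟩ := v
    rcases dir_cases r with h' | h' | h' | h' | h' | h' <;> rw [h'.2] at hr <;>
      cases c <;> cases c' <;>
      simp [toEis, QuadraticAlgebra.ext_iff] at hr ⊢ <;> omega

lemma colour_add (z w : Eis) : colour (z + w) = (colour z + colour w) % 3 := by
  unfold colour
  simp only [QuadraticAlgebra.re_add, QuadraticAlgebra.im_add]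
  omega

/-- The placement of walks on the hexagonal lattice that maps the starting point `0` of the standard
frame to `u` and the first vertex visited to the neighbour of `u` in the direction `k`. This
neighbour has to be a vertex of the lattice, that is, `colour (toEis u + dir k) ≠ 2`. -/
def place (u : HexVertex) (k : ℤ) (z : Eis) : HexVertex := fromEis (toEis u + dir k * z)

section Placement

variable {u : HexVertex} {k : ℤ} (hk : colour (toEis u + dir k) ≠ 2)
include hk

lemma toEis_place {z : Eis} (hz : colour z ≠ 2) : toEis (place u k z) = toEis u + dir k * z := by
  refine toEis_fromEis ?_
  rw [colour_add_dir] at hk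
  rw [colour_add, colour_dir_mul]
  have h1 := colour_lt_three z
  have h2 := colour_toEis u
  split_ifs at * <;> omega

lemma place_injOn {z w : Eis} (hz : colour z ≠ 2) (hw : colour w ≠ 2)
    (h : place u k z = place u k w) : z = w := by
  have := congrArg toEis h
  rw [toEis_place hk hz, toEis_place hk hw] at this
  exact dir_affine_injective _ _ this

lemma place_adj {z w : Eis} (hz : colour z ≠ 2) (hw : colour w ≠ 2) (h : (w - z).norm = 1) :
    hexLattice.Adj (place u k z) (place u k w) := by
  rw [adj_iff, toEis_place hk hz, toEis_place hk hw,
    show toEis u + dir k * w - (toEis u + dir k * z) = dir k * (w - z) by ring, map_mul, norm_dir,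
    h, one_mul]

end Placement

lemma place_zero (u : HexVertex) (k : ℤ) : place u k 0 = u := by
  rw [place, mul_zero, add_zero, fromEis_toEis]

lemma place_one {u v : HexVertex} {k : ℤ} (h : toEis v = toEis u + dir k) : place u k 1 = v := by
  rw [place, mul_one, ← h, fromEis_toEis]

/-- Every vertex is at a position of the frame of any directed edge. -/
lemma exists_place_eq {u : HexVertex} {k : ℤ} (hk : colour (toEis u + dir k) ≠ 2) (y : HexVertex) :
    ∃ z, colour z ≠ 2 ∧ place u k z = y ∧ toEis y = toEis u + dir k * z := by
  have e : toEis u + dir k * (dir (-k) * (toEis y - toEis u)) = toEis y := by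
    linear_combination (toEis y - toEis u) * dir_mul_neg k
  refine ⟨dir (-k) * (toEis y - toEis u), ?_, by rw [place, e, fromEis_toEis], e.symm⟩
  have h1 := colour_add (toEis u) (dir k * (dir (-k) * (toEis y - toEis u)))
  rw [e, colour_dir_mul] at h1
  have h2 := colour_toEis u
  have h3 := colour_toEis y
  have h4 := colour_lt_three (dir (-k) * (toEis y - toEis u))
  rw [colour_add_dir] at hk
  split_ifs at * <;> omega

lemma exists_dir_of_adj {u v : HexVertex} (h : hexLattice.Adj u v) :
    ∃ k, toEis v = toEis u + dir k := by
  obtain ⟨r, -, -, hr⟩ := exists_dir_of_norm_eq_one (adj_iff.1 h) 0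
  exact ⟨0 + r, by rw [← hr]; ring⟩

/-- A vertex adjacent to the head of a walk that does not lead back is reached by a left or a right
turn. -/
lemma exists_turn {l : List Bool} {z : Eis} (hz : colour z ≠ 2) (h1 : (z - head l).norm = 1)
    (hne : z ≠ pt l) : ∃ t, z = head (l ++ [t]) := by
  obtain ⟨r, hr1, hr2, hr⟩ := exists_dir_of_norm_eq_one h1 (turning l)
  have hz' : z = head l + dir (turning l + r) := by rw [← hr]; ring
  have hr3 : r ≠ 3 := by
    rintro rfl
    apply hne
    rw [hz', dir_add_three, head]; ring
  have hc := colour_add_dir (head l) (turning l + r)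
  rw [← hz', colour_head] at hc
  have hp := turning_emod_two l
  have hb := colour_lt_three z
  have hh : ∀ t, head (l ++ [t]) = head l + dir (turning l + sgn t) := by
    intro t; rw [head, pt_concat]; simp
  have hcase : r = 1 ∨ r = -1 := by split_ifs at hc <;> omega
  rcases hcase with rfl | rfl
  · exact ⟨true, by rw [hh, hz', sgn_true]⟩
  · exact ⟨false, by rw [hh, hz', sgn_false]⟩

lemma vertexSeq_concat {l : List Bool} {t : Bool} {i : ℕ} (hi : i ≤ l.length + 1) :
    vertexSeq (l ++ [t]) i = vertexSeq l i := by
  rcases Nat.lt_or_ge l.length i with h | h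
  · obtain rfl : i = l.length + 1 := by omega
    rw [vertexSeq_head, vertexSeq_succ (by simp)]; simp
  · rw [vertexSeq_of_le h, vertexSeq_of_le (by simp; omega), List.take_append_of_le_length h]

lemma colour_vertexSeq (l : List Bool) (i : ℕ) : colour (vertexSeq l i) ≠ 2 := by
  rw [vertexSeq, colour_pt]; omega

/-- Every sequence of consecutive vertices without immediate returns is a list of turns. -/
lemma exists_list_of_seq {u : HexVertex} {k : ℤ} (hk : colour (toEis u + dir k) ≠ 2)
    {f : ℕ → HexVertex} (f0 : f 0 = u) (f1 : f 1 = place u k 1) (n : ℕ)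
    (hadj : ∀ i ≤ n, hexLattice.Adj (f i) (f (i + 1))) (hne : ∀ i < n, f (i + 2) ≠ f i) :
    ∃ l : List Bool, l.length = n ∧ ∀ i ≤ n + 1, place u k (vertexSeq l i) = f i := by
  induction n with
  | zero =>
    refine ⟨[], rfl, fun i hi => ?_⟩
    interval_cases i
    · rw [vertexSeq_zero, place_zero, f0]
    · rw [f1, vertexSeq_succ (by simp)]; simp
  | succ n ih =>
    obtain ⟨l, hl, hf⟩ := ih (fun i hi => hadj i (by omega)) (fun i hi => hne i (by omega))
    obtain ⟨z, hz, hzp, hze⟩ := exists_place_eq hk (f (n + 2))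
    have hn1 := hf (n + 1) le_rfl
    rw [← hl, vertexSeq_head] at hn1
    have hch : colour (head l) ≠ 2 := by rw [colour_head]; omega
    have ha := adj_iff.1 (hadj (n + 1) le_rfl)
    rw [← hl, ← hn1, toEis_place hk hch, hl, hze, show toEis u + dir k * z -
      (toEis u + dir k * head l) = dir k * (z - head l) by ring, map_mul, norm_dir, one_mul] at ha
    have hnp : z ≠ pt l := by
      rintro rfl
      apply hne n (by omega)
      rw [← hzp, ← hf n (by omega), vertexSeq_of_le hl.ge, ← hl, List.take_length]
    obtain ⟨t, rfl⟩ := exists_turn hz ha hnp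
    refine ⟨l ++ [t], by simp [hl], fun i hi => ?_⟩
    rcases Nat.lt_or_ge (n + 1) i with h | h
    · obtain rfl : i = n + 2 := by omega
      rw [← hzp, ← vertexSeq_head]; simp [hl]
    · rw [vertexSeq_concat (by omega), hf i h]

lemma eq_of_vertexSeq_eq {l m : List Bool} (hlen : l.length = m.length)
    (h : ∀ i ≤ l.length + 1, vertexSeq l i = vertexSeq m i) : l = m := by
  induction l using List.reverseRecOn generalizing m with
  | nil => exact (List.length_eq_zero_iff.1 hlen.symm).symm
  | append_singleton l t ih =>
    rcases List.eq_nil_or_concat m with rfl | ⟨m, t', rfl⟩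
    · simp at hlen
    rw [List.concat_eq_append] at *
    have hlen' : l.length = m.length := by simpa using hlen
    obtain rfl := ih hlen' (fun i hi => by
      have := h i (by simp; omega)
      rwa [vertexSeq_concat hi, vertexSeq_concat (by omega)] at this)
    have h1 := h ((l ++ [t]).length + 1) le_rfl
    rw [vertexSeq_head, show (l ++ [t]).length = (l ++ [t']).length by simp, vertexSeq_head, head,
      head, pt_concat, pt_concat] at h1
    have h2 : dir (turning (l ++ [t])) = dir (turning (l ++ [t'])) := add_left_cancel h1
    simp only [turning_append, turning_cons, turning_nil, add_zero, dir_add] at h2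
    have h3 := dir_mul_left_injective _ h2
    cases t <;> cases t' <;> first | rfl | (
      exfalso
      have h4 := congrArg QuadraticAlgebra.im h3
      have h5 : dir (-1) = ⟨1, -1⟩ := by
        have := dir_cases (-1); norm_num at this; exact this
      simp [h5] at h4
      try omega)

lemma saw_of_vertexSeq_ne {l : List Bool}
    (h : ∀ i j, 1 ≤ i → i < j → j ≤ l.length → vertexSeq l i ≠ vertexSeq l j) : SAW l := by
  rw [SAW, List.Nodup, List.pairwise_iff_getElem]
  intro i j hi hj hij
  rw [length_visited] at hi hj
  rw [getElem_visited hi, getElem_visited hj, ← vertexSeq_succ hi.le, ← vertexSeq_succ hj.le]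
  exact h _ _ (by omega) (by omega) (by omega)

lemma vertexSeq_add_two_ne {l : List Bool} {i : ℕ} (hi : i < l.length) :
    vertexSeq l (i + 2) ≠ vertexSeq l i := by
  have ht := isTrail_vertexSeq l
  have e1 := ht.step i hi.le
  have e2 : vertexSeq l (i + 2) = _ := ht.step (i + 1) hi
  rw [e2, e1]
  intro h
  have h1 : dir (turning (l.take i)) + dir (turning (l.take (i + 1))) = 0 := by
    linear_combination h
  have h2 := abscissa_dir 1
  rcases ht.turn i hi with h3 | h3 <;> rw [h3] at h1
  · rw [dir_add, ← mul_one_add] at h1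
    have := dir_mul_left_injective _ (h1.trans (mul_zero (dir (turning (l.take i)))).symm)
    have := congrArg QuadraticAlgebra.re this
    simp at this
  · rw [sub_eq_add_neg, dir_add, ← mul_one_add] at h1
    have := dir_mul_left_injective _ (h1.trans (mul_zero (dir (turning (l.take i)))).symm)
    have := congrArg abscissa this
    have := abscissa_dir (-1)
    simp at *
    omega

/-! ### Walks between mid-edges -/

section Placement

variable {u : HexVertex} {k : ℤ} (hk : colour (toEis u + dir k) ≠ 2)
include hk

lemma place_vertexSeq_adj {l : List Bool} {i : ℕ} (hi : i ≤ l.length) :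
    hexLattice.Adj (place u k (vertexSeq l i)) (place u k (vertexSeq l (i + 1))) :=
  place_adj hk (colour_vertexSeq l _) (colour_vertexSeq l _) ((isTrail_vertexSeq l).norm_step hi)

/-- The walk from the mid-edge `a` given by a list of turns, in the frame where `a` lies between
the positions `0` and `1`. -/
def midEdgeSAWOfList {a : hexLattice.edgeSet}
    (ha : (a : Sym2 HexVertex) = s(place u k 0, place u k 1)) (l : List Bool) (hl : SAW l) :
    MidEdgeSAW a where
  length := l.length
  vertex i := place u k (vertexSeq l (i + 1))
  midEdge i := ⟨s(place u k (vertexSeq l i), place u k (vertexSeq l (i + 1))),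
    (SimpleGraph.mem_edgeSet _).2 (place_vertexSeq_adj hk (by omega))⟩
  midEdge_zero := by
    apply Subtype.ext
    rw [ha]
    simp [vertexSeq_zero, vertexSeq_succ]
  mem_castSucc i := by simp
  mem_succ i := by simp
  castSucc_ne_succ i h := by
    have h1 := congrArg Subtype.val h
    simp only [Fin.val_castSucc, Fin.val_succ] at h1
    rw [Sym2.eq_swap, Sym2.congr_right] at h1
    exact vertexSeq_add_two_ne i.2
      (place_injOn hk (colour_vertexSeq _ _) (colour_vertexSeq _ _) h1.symm)
  vertex_injective i j h := by
    have h1 := place_injOn hk (colour_vertexSeq _ _) (colour_vertexSeq _ _) h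
    rcases lt_trichotomy i.1 j.1 with hlt | heq | hlt
    · exact absurd h1 (hl.vertexSeq_ne (by omega) (by omega) (by omega))
    · exact Fin.ext heq
    · exact absurd h1.symm (hl.vertexSeq_ne (by omega) (by omega) (by omega))

lemma midEdgeSAWOfList_injective {a : hexLattice.edgeSet}
    (ha : (a : Sym2 HexVertex) = s(place u k 0, place u k 1)) :
    Function.Injective (fun l : saws => midEdgeSAWOfList hk ha l.1 l.2) := by
  rintro ⟨l, hl⟩ ⟨m, hm⟩ h
  have hlen : l.length = m.length := congrArg MidEdgeSAW.length h
  have hedge : ∀ i ≤ l.length, s(place u k (vertexSeq l i), place u k (vertexSeq l (i + 1))) =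
      s(place u k (vertexSeq m i), place u k (vertexSeq m (i + 1))) := by
    intro i hi
    have := congrArg (fun γ : MidEdgeSAW a => if h : i < γ.length + 1 then
      (γ.midEdge ⟨i, h⟩ : Sym2 HexVertex) else s((0, 0, true), (0, 0, true))) h
    simpa [midEdgeSAWOfList, Nat.lt_succ_of_le hi, ← hlen] using this
  have hvert : ∀ i ≤ l.length + 1, place u k (vertexSeq l i) = place u k (vertexSeq m i) := by
    intro i
    induction i with
    | zero => intro _; rw [vertexSeq_zero, vertexSeq_zero]
    | succ i ih =>
      intro hi
      have h1 := hedge i (by omega)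
      rwa [ih (by omega), Sym2.congr_right] at h1
  exact Subtype.ext (eq_of_vertexSeq_eq hlen fun i hi =>
    place_injOn hk (colour_vertexSeq _ _) (colour_vertexSeq _ _) (hvert i hi))

lemma exists_list_of_midEdgeSAW {a : hexLattice.edgeSet}
    (ha : (a : Sym2 HexVertex) = s(place u k 0, place u k 1)) (γ : MidEdgeSAW a)
    (hfirst : ∀ h : 0 < γ.length, γ.vertex ⟨0, h⟩ = place u k 1) :
    ∃ l, SAW l ∧ l.length = γ.length ∧
      (∀ (i : ℕ) (h : i < γ.length), γ.vertex ⟨i, h⟩ = place u k (vertexSeq l (i + 1))) ∧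
      ∀ (i : ℕ) (h : i < γ.length + 1), (γ.midEdge ⟨i, h⟩ : Sym2 HexVertex) =
        s(place u k (vertexSeq l i), place u k (vertexSeq l (i + 1))) := by
  have ha' : (γ.midEdge ⟨0, by omega⟩ : Sym2 HexVertex) = s(place u k 0, place u k 1) := by
    rw [← ha]; exact congrArg Subtype.val γ.midEdge_zero
  obtain ⟨y, hy⟩ : ∃ y, (γ.midEdge (Fin.last γ.length) : Sym2 HexVertex) =
      s(if h : 0 < γ.length then γ.vertex ⟨γ.length - 1, by omega⟩ else place u k 0, y) := by
    by_cases h : 0 < γ.length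
    · simp only [h, ↓reduceDIte]
      have hm := γ.mem_succ ⟨γ.length - 1, by omega⟩
      rw [show (⟨γ.length - 1, by omega⟩ : Fin γ.length).succ = Fin.last γ.length from
        Fin.ext (by simp; omega)] at hm
      obtain ⟨y, hy⟩ := hm
      exact ⟨y, hy⟩
    · simp only [h, ↓reduceDIte]
      rw [show Fin.last γ.length = ⟨0, by omega⟩ from Fin.ext (by simp; omega), ha']
      exact ⟨_, rfl⟩
  -- The sequence of all vertices of the walk, including both ends.
  let f : ℕ → HexVertex := fun i => match i with
    | 0 => u
    | i + 1 => if h : i < γ.length then γ.vertex ⟨i, h⟩ else y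
  have hfs : ∀ (i : ℕ) (h : i < γ.length), f (i + 1) = γ.vertex ⟨i, h⟩ := fun i h => by
    simp [f, h]
  have hfl : f (γ.length + 1) = y := by simp [f]
  have hedge : ∀ (i : ℕ) (h : i < γ.length + 1), (γ.midEdge ⟨i, h⟩ : Sym2 HexVertex) =
      s(f i, f (i + 1)) := by
    intro i h
    rcases Nat.lt_or_ge i γ.length with hlt | hge
    · rcases i with _ | j
      · rw [ha', hfs 0 hlt, hfirst hlt, place_zero]
      · rw [hfs j (by omega), hfs (j + 1) hlt, ← Sym2.mem_and_mem_iff]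
        · exact ⟨γ.mem_succ ⟨j, by omega⟩, γ.mem_castSucc ⟨j + 1, hlt⟩⟩
        · intro he
          have := γ.vertex_injective he
          simp at this
    · obtain rfl : i = γ.length := by omega
      rw [hfl]
      have h1 := hy
      rw [show (⟨γ.length, h⟩ : Fin (γ.length + 1)) = Fin.last γ.length from rfl, h1]
      congr 2
      by_cases h0 : 0 < γ.length
      · have h2 := hfs (γ.length - 1) (by omega)
        rw [show γ.length - 1 + 1 = γ.length by omega] at h2
        simp only [h0, ↓reduceDIte]
        exact h2.symm
      · simp only [h0, ↓reduceDIte]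
        rw [show γ.length = 0 by omega, place_zero]
  have f1 : f 1 = place u k 1 := by
    by_cases h0 : 0 < γ.length
    · rw [hfs 0 h0, hfirst h0]
    · have h1 := hedge 0 (by omega)
      rw [ha', place_zero] at h1
      exact (Sym2.congr_right.1 h1).symm
  obtain ⟨l, hl, hlf⟩ := exists_list_of_seq hk (f := f) rfl f1 γ.length
    (fun i hi => by
      have h1 := (γ.midEdge ⟨i, by omega⟩).2
      rwa [hedge, SimpleGraph.mem_edgeSet] at h1)
    (fun i hi he => by
      apply γ.castSucc_ne_succ ⟨i, hi⟩
      apply Subtype.ext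
      change (γ.midEdge ⟨i, by omega⟩ : Sym2 HexVertex) = γ.midEdge ⟨i + 1, by omega⟩
      rw [hedge, hedge, he, Sym2.eq_swap])
  refine ⟨l, saw_of_vertexSeq_ne fun i j h1 hij hj he => ?_, hl, fun i h => ?_, fun i h => ?_⟩
  · obtain ⟨i, rfl⟩ : ∃ m, i = m + 1 := ⟨i - 1, by omega⟩
    obtain ⟨j, rfl⟩ : ∃ m, j = m + 1 := ⟨j - 1, by omega⟩
    have h2 := congrArg (place u k) he
    rw [hlf _ (by omega), hlf _ (by omega), hfs i (by omega), hfs j (by omega)] at h2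
    have := γ.vertex_injective h2
    simp at this
    omega
  · rw [hlf _ (by omega), hfs i h]
  · rw [hedge i h, hlf _ (by omega), hlf _ (by omega)]

end Placement

lemma midEdgeSAW_ext {a : hexLattice.edgeSet} {γ γ' : MidEdgeSAW a} (hlen : γ.length = γ'.length)
    (hv : ∀ (i : ℕ) (h : i < γ.length) (h' : i < γ'.length), γ.vertex ⟨i, h⟩ = γ'.vertex ⟨i, h'⟩)
    (he : ∀ (i : ℕ) (h : i < γ.length + 1) (h' : i < γ'.length + 1),
      γ.midEdge ⟨i, h⟩ = γ'.midEdge ⟨i, h'⟩) : γ = γ' := by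
  obtain ⟨n, v, e, _, _, _, _, _⟩ := γ
  obtain ⟨n', v', e', _, _, _, _, _⟩ := γ'
  obtain rfl : n = n' := hlen
  obtain rfl : v = v' := funext fun i => hv i.1 i.2 i.2
  obtain rfl : e = e' := funext fun i => he i.1 i.2 i.2
  rfl

/-- Both directions of the starting edge give rise to a frame. -/
lemma exists_frames (a : hexLattice.edgeSet) : ∃ (u : Bool → HexVertex) (k : Bool → ℤ),
    (∀ b, colour (toEis (u b) + dir (k b)) ≠ 2) ∧
    (∀ b, (a : Sym2 HexVertex) = s(place (u b) (k b) 0, place (u b) (k b) 1)) ∧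
    ∀ y ∈ (a : Sym2 HexVertex), ∃ b, y = place (u b) (k b) 1 := by
  obtain ⟨a, ha⟩ := a
  induction a using Sym2.ind with
  | _ p q =>
    rw [SimpleGraph.mem_edgeSet] at ha
    obtain ⟨k, hk⟩ := exists_dir_of_adj ha
    have hk' : toEis p = toEis q + dir (k + 3) := by rw [hk, dir_add_three]; ring
    refine ⟨fun b => if b then p else q, fun b => if b then k else k + 3, ?_, ?_, ?_⟩
    · rintro (_ | _)
      · simpa [← hk'] using colour_toEis_ne p
      · simpa [← hk] using colour_toEis_ne q
    · rintro (_ | _)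
      · simp [place_zero, place_one hk', Sym2.eq_swap]
      · simp [place_zero, place_one hk]
    · intro y hy
      rw [Sym2.mem_iff] at hy
      rcases hy with rfl | rfl
      · exact ⟨false, by simp [place_one hk']⟩
      · exact ⟨true, by simp [place_one hk]⟩

lemma wt_saws_le_hexPartition (a : hexLattice.edgeSet) (x : ℝ≥0) :
    wt saws x ≤ hexPartition a x := by
  obtain ⟨u, k, hk, ha, -⟩ := exists_frames a
  exact wt_le_of_injective _ (midEdgeSAWOfList_injective (hk true) (ha true)) _ fun l => le_rfl

lemma hexPartition_le (a : hexLattice.edgeSet) (x : ℝ≥0) :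
    hexPartition a x ≤ 2 * wt saws x := by
  obtain ⟨u, k, hk, ha, hor⟩ := exists_frames a
  have h : ∀ γ : MidEdgeSAW a, ∃ p : Bool × saws, p.2.1.length = γ.length ∧
      (∀ (i : ℕ) (h : i < γ.length),
        γ.vertex ⟨i, h⟩ = place (u p.1) (k p.1) (vertexSeq p.2.1 (i + 1))) ∧
      ∀ (i : ℕ) (h : i < γ.length + 1), (γ.midEdge ⟨i, h⟩ : Sym2 HexVertex) =
        s(place (u p.1) (k p.1) (vertexSeq p.2.1 i),
          place (u p.1) (k p.1) (vertexSeq p.2.1 (i + 1))) := by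
    intro γ
    obtain ⟨b, hb⟩ : ∃ b, ∀ h : 0 < γ.length, γ.vertex ⟨0, h⟩ = place (u b) (k b) 1 := by
      by_cases h0 : 0 < γ.length
      · have hm := γ.mem_castSucc ⟨0, h0⟩
        have e : (⟨0, h0⟩ : Fin γ.length).castSucc = 0 := rfl
        rw [e, γ.midEdge_zero] at hm
        obtain ⟨b, hb⟩ := hor _ hm
        exact ⟨b, fun _ => hb⟩
      · exact ⟨true, fun h => absurd h h0⟩
    obtain ⟨l, hl, hlen, hv, he⟩ := exists_list_of_midEdgeSAW (hk b) (ha b) γ hb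
    exact ⟨(b, ⟨l, hl⟩), hlen, hv, he⟩
  choose p hlen hv he using h
  have hp : Function.Injective p := by
    intro γ γ' h
    refine midEdgeSAW_ext (by rw [← hlen γ, ← hlen γ', h]) (fun i h1 h2 => ?_) fun i h1 h2 => ?_
    · rw [hv γ, hv γ', h]
    · apply Subtype.ext
      rw [he γ, he γ', h]
  have hsum : 2 * wt saws x = ∑' q : Bool × saws, (x : ℝ≥0∞) ^ q.2.1.length := by
    rw [ENNReal.tsum_prod', tsum_fintype]
    simp [wt, two_mul]
  rw [hsum, hexPartition]
  refine le_trans (le_of_eq (tsum_congr fun γ => ?_))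
    (ENNReal.tsum_comp_le_tsum_of_injective hp _)
  rw [hlen]

/-! ### Counting paths of the hexagonal lattice -/

/-- The paths counted by `hexSAWCount v n`. -/
def paths (v : HexVertex) (n : ℕ) : Set (Σ w : HexVertex, hexLattice.Walk v w) :=
  {p | p.2.IsPath ∧ p.2.length = n}

lemma exists_walk_of_seq (f : ℕ → HexVertex) (n : ℕ)
    (h : ∀ i < n, hexLattice.Adj (f i) (f (i + 1))) :
    ∃ p : hexLattice.Walk (f 0) (f n), p.length = n ∧ ∀ i ≤ n, p.getVert i = f i := by
  induction n generalizing f with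
  | zero =>
    refine ⟨.nil, rfl, fun i hi => ?_⟩
    obtain rfl : i = 0 := by omega
    simp
  | succ n ih =>
    obtain ⟨p, hp, hpf⟩ := ih (fun i => f (i + 1)) fun i hi => h (i + 1) (by omega)
    refine ⟨.cons (h 0 (by omega)) p, by simp [hp], fun i hi => ?_⟩
    rcases i with _ | i
    · simp
    · rw [SimpleGraph.Walk.getVert_cons_succ, hpf i (by omega)]

lemma sigma_walk_ext {v : HexVertex} {p q : Σ w : HexVertex, hexLattice.Walk v w}
    (hlen : p.2.length = q.2.length) (h : ∀ i ≤ p.2.length, p.2.getVert i = q.2.getVert i) :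
    p = q := by
  obtain ⟨w, p⟩ := p
  obtain ⟨w', q⟩ := q
  simp only at hlen h
  obtain rfl : w = w' := by
    rw [← p.getVert_length, h _ le_rfl, hlen, q.getVert_length]
  rw [SimpleGraph.Walk.ext_getVert_le_length hlen h]

/-- Two frames at every vertex, with different starting points. -/
lemma exists_two_frames (v : HexVertex) : ∃ (u : Bool → HexVertex) (k : Bool → ℤ),
    u true ≠ u false ∧ ∀ b, toEis v = toEis (u b) + dir (k b) := by
  obtain ⟨u, hu, h⟩ : ∃ u : Bool → HexVertex, u true ≠ u false ∧
      ∀ b, hexLattice.Adj (u b) v := by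
    obtain ⟨a, b, c⟩ := v
    cases c
    · exact ⟨fun t => if t then (a, b, true) else (a - 1, b, true), by simp; omega,
        by simp [hexLattice]⟩
    · exact ⟨fun t => if t then (a, b, false) else (a + 1, b, false), by simp,
        by simp [hexLattice]⟩
  choose k hk using fun b => exists_dir_of_adj (h b)
  exact ⟨u, k, hu, hk⟩

/-- A path of `n` steps from `v` is a list of `n` turns in one of two frames. One more turn is
appended because the last vertex of a walk given by turns is not visited. -/
lemma exists_injOn_paths (v : HexVertex) (n : ℕ) :
    ∃ F : (Σ w : HexVertex, hexLattice.Walk v w) → Bool × List Bool,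
      Set.MapsTo F (paths v n) ((Finset.univ : Finset Bool) ×ˢ slice saws (n + 1) :
        Finset (Bool × List Bool)) ∧ Set.InjOn F (paths v n) := by
  obtain ⟨u, k, hu, hv⟩ := exists_two_frames v
  have hk : ∀ b, colour (toEis (u b) + dir (k b)) ≠ 2 := fun b => hv b ▸ colour_toEis_ne v
  have h : ∀ p : Σ w : HexVertex, hexLattice.Walk v w, ∃ q : Bool × List Bool, p ∈ paths v n →
      q.2 ∈ slice saws (n + 1) ∧
        ∀ i ≤ n, p.2.getVert i = place (u q.1) (k q.1) (vertexSeq q.2 (i + 1)) := by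
    intro p
    by_cases hp : p ∈ paths v n
    swap
    · exact ⟨(true, []), fun h => absurd h hp⟩
    obtain ⟨hpath, hlen⟩ := hp
    obtain ⟨b, hb⟩ : ∃ b, p.2.getVert 1 ≠ u b := by
      by_contra! hc
      exact hu ((hc true).symm.trans (hc false))
    obtain ⟨l, hl, hlf⟩ := exists_list_of_seq (hk b)
      (f := fun i => match i with | 0 => u b | i + 1 => p.2.getVert i) rfl
      (by simp [place_one (hv b)]) n
      (fun i hi => by
        rcases i with _ | i
        · simp only [SimpleGraph.Walk.getVert_zero]
          rw [adj_iff, hv b, add_sub_cancel_left, norm_dir]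
        · exact p.2.adj_getVert_succ (by omega))
      (fun i hi => by
        rcases i with _ | i
        · exact hb
        · intro he
          have := hpath.getVert_injOn (show i + 2 ≤ p.2.length by omega)
            (show i ≤ p.2.length by omega) he
          omega)
    refine ⟨(b, l ++ [true]), fun _ => ⟨mem_slice.2 ⟨by simp [hl], ?_⟩, fun i hi => ?_⟩⟩
    · refine saw_of_vertexSeq_ne fun i j h1 hij hj he => ?_
      simp only [List.length_append, List.length_singleton] at hj
      obtain ⟨i, rfl⟩ : ∃ m, i = m + 1 := ⟨i - 1, by omega⟩
      obtain ⟨j, rfl⟩ : ∃ m, j = m + 1 := ⟨j - 1, by omega⟩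
      rw [vertexSeq_concat (by omega), vertexSeq_concat (by omega)] at he
      have h2 := congrArg (place (u b) (k b)) he
      rw [hlf _ (by omega), hlf _ (by omega)] at h2
      have := hpath.getVert_injOn (show i ≤ p.2.length by omega)
        (show j ≤ p.2.length by omega) h2
      omega
    · rw [vertexSeq_concat (by omega), hlf _ (by omega)]
  choose F hF using h
  refine ⟨F, fun p hp => ?_, fun p hp q hq he => ?_⟩
  · simpa using (hF p hp).1
  · refine sigma_walk_ext (hp.2.trans hq.2.symm) fun i hi => ?_
    rw [hp.2] at hi
    rw [(hF p hp).2 i hi, (hF q hq).2 i hi, he]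

lemma finite_paths (v : HexVertex) (n : ℕ) : (paths v n).Finite := by
  obtain ⟨F, h1, h2⟩ := exists_injOn_paths v n
  exact Set.Finite.of_injOn h1 h2 (Finset.finite_toSet _)

lemma hexSAWCount_le (v : HexVertex) (n : ℕ) :
    hexSAWCount v n ≤ 2 * (slice saws (n + 1)).card := by
  obtain ⟨F, h1, h2⟩ := exists_injOn_paths v n
  have := Set.ncard_le_ncard_of_injOn F h1 h2 (Finset.finite_toSet _)
  rwa [Set.ncard_coe_finset, Finset.card_product, Finset.card_univ, Fintype.card_bool] at this

lemma card_saws_le (v : HexVertex) (n : ℕ) :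
    (slice saws (n + 1)).card ≤ 2 * hexSAWCount v n := by
  obtain ⟨u, k, -, hv⟩ := exists_two_frames v
  have hk : colour (toEis (u true) + dir (k true)) ≠ 2 := hv true ▸ colour_toEis_ne v
  have h : ∀ l : List Bool, ∃ p : Σ w : HexVertex, hexLattice.Walk v w,
      l ∈ slice saws (n + 1) → p ∈ paths v n ∧
        ∀ i ≤ n, p.2.getVert i = place (u true) (k true) (vertexSeq l (i + 1)) := by
    intro l
    by_cases hl : l ∈ slice saws (n + 1)
    swap
    · exact ⟨⟨v, .nil⟩, fun h => absurd h hl⟩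
    obtain ⟨hlen, hsaw⟩ := mem_slice.1 hl
    obtain ⟨p, hp, hpf⟩ := exists_walk_of_seq
      (fun i => place (u true) (k true) (vertexSeq l (i + 1))) n
      fun i hi => place_vertexSeq_adj hk (by omega)
    have h0 : place (u true) (k true) (vertexSeq l (0 + 1)) = v := by
      rw [vertexSeq_succ (by simp)]
      simpa using place_one (hv true)
    refine ⟨⟨_, p.copy h0 rfl⟩, fun _ => ⟨⟨?_, by simpa using hp⟩, fun i hi => ?_⟩⟩
    · rw [SimpleGraph.Walk.isPath_copy, ← SimpleGraph.Walk.IsPath.getVert_injOn_iff]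
      intro i hi j hj he
      simp only [Set.mem_ofPred_eq, hp] at hi hj
      rw [hpf i hi, hpf j hj] at he
      have h1 := place_injOn hk (colour_vertexSeq _ _) (colour_vertexSeq _ _) he
      rcases lt_trichotomy i j with hlt | heq | hlt
      · exact absurd h1 (SAW.vertexSeq_ne hsaw (by omega) (by omega) (by omega))
      · exact heq
      · exact absurd h1.symm (SAW.vertexSeq_ne hsaw (by omega) (by omega) (by omega))
    · simpa using hpf i hi
  choose F hF using h
  have hcard := Set.ncard_le_ncard_of_injOn
    (s := (slice saws (n + 1) : Set (List Bool))) (t := paths v n ×ˢ (Set.univ : Set Bool))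
    (fun l => (F l, l.getLastD true))
    (fun l hl => ⟨(hF l hl).1, trivial⟩)
    (fun l hl m hm he => by
      simp only [Prod.mk.injEq] at he
      have hl1 := (mem_slice.1 hl).1
      have hm1 := (mem_slice.1 hm).1
      rcases List.eq_nil_or_concat l with rfl | ⟨l, t, rfl⟩
      · simp at hl1
      rcases List.eq_nil_or_concat m with rfl | ⟨m, t', rfl⟩
      · simp at hm1
      rw [List.concat_eq_append] at *
      rw [List.concat_eq_append] at *
      simp only [List.length_append, List.length_singleton, add_left_inj] at hl1 hm1
      obtain rfl : t = t' := by simpa using he.2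
      congr 1
      refine eq_of_vertexSeq_eq (hl1.trans hm1.symm) fun i hi => ?_
      rcases i with _ | i
      · rw [vertexSeq_zero, vertexSeq_zero]
      have h1 := (hF _ hl).2 i (by omega)
      rw [he.1, (hF _ hm).2 i (by omega), vertexSeq_concat (by omega),
        vertexSeq_concat (by omega)] at h1
      exact (place_injOn hk (colour_vertexSeq _ _) (colour_vertexSeq _ _) h1).symm)
    ((finite_paths v n).prod Set.finite_univ)
  rw [Set.ncard_coe_finset, Set.ncard_prod, Set.ncard_univ, Nat.card_eq_fintype_card,
    Fintype.card_bool, mul_comm] at hcard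
  exact hcard

/-! ### The connective constant -/

lemma card_saws_add_le (m n : ℕ) :
    (slice saws (m + n)).card ≤ (slice saws m).card * (slice saws n).card := by
  rw [← Finset.card_product]
  refine Finset.card_le_card_of_injOn (fun l => (l.take m, l.drop m)) (fun l hl => ?_)
    fun l _ l' _ h => ?_
  · obtain ⟨hlen, hl⟩ := mem_slice.1 hl
    have hl' : SAW (l.take m ++ l.drop m) := by rwa [List.take_append_drop]
    simp only [Finset.coe_product, Set.mem_prod, Finset.mem_coe, mem_slice, List.length_take,
      List.length_drop]
    exact ⟨⟨by omega, hl'.left⟩, by omega, hl'.right⟩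
  · rw [← List.take_append_drop m l, ← List.take_append_drop m l']
    simp only [Prod.mk.injEq] at h
    rw [h.1, h.2]

/-- The growth rate of a submultiplicative sequence is the inverse of the radius of convergence of
its generating function. -/
lemma tendsto_log_div_of_radius {g : ℕ → ℕ} (hpos : ∀ n, 0 < g n)
    (hmul : ∀ m n, g (m + n) ≤ g m * g n) {r : ℝ} (hr : 0 < r)
    (hdiv : ¬ Summable fun n => (g n : ℝ) * r ^ n)
    (hconv : ∀ y : ℝ, 0 ≤ y → y < r → Summable fun n => (g n : ℝ) * y ^ n) :
    Tendsto (fun n : ℕ => Real.log (g n) / n) atTop (𝓝 (-Real.log r)) := by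
  have hpos' : ∀ n, (0 : ℝ) < g n := fun n => by exact_mod_cast hpos n
  have hsub : Subadditive fun n => Real.log (g n) := by
    intro m n
    rw [← Real.log_mul (hpos' m).ne' (hpos' n).ne']
    exact Real.log_le_log (hpos' _) (by exact_mod_cast hmul m n)
  have hbdd : BddBelow (Set.range fun n : ℕ => Real.log (g n) / n) := by
    refine ⟨0, ?_⟩
    rintro _ ⟨n, rfl⟩
    exact div_nonneg (Real.log_natCast_nonneg _) (Nat.cast_nonneg _)
  have hlim := hsub.tendsto_lim hbdd
  have hterm : ∀ (t : ℝ) (n : ℕ), (g n : ℝ) * Real.exp t ^ n =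
      Real.exp (Real.log (g n) + n * t) := by
    intro t n
    rw [Real.exp_add, Real.exp_log (hpos' n), Real.exp_nat_mul]
  suffices h : hsub.lim = -Real.log r by rwa [h] at hlim
  rcases lt_trichotomy hsub.lim (-Real.log r) with h | h | h
  · exfalso
    apply hdiv
    obtain ⟨M, h1, h2⟩ := exists_between h
    have hM : Real.exp (M + Real.log r) < 1 := by rw [Real.exp_lt_one_iff]; linarith
    refine Summable.of_norm_bounded_eventually_nat
      (summable_geometric_of_lt_one (Real.exp_nonneg _) hM) ?_
    filter_upwards [hlim.eventually (gt_mem_nhds h1), eventually_gt_atTop 0] with n hn hn0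
    have hn0' : (0 : ℝ) < n := by exact_mod_cast hn0
    rw [div_lt_iff₀ hn0'] at hn
    rw [Real.norm_of_nonneg (mul_nonneg (hpos' n).le (pow_nonneg hr.le n)), ← Real.exp_nat_mul]
    conv_lhs => rw [← Real.exp_log hr, hterm]
    exact Real.exp_le_exp.2 (by linarith)
  · exact h
  · exfalso
    have hs := hconv (Real.exp (-hsub.lim)) (Real.exp_nonneg _)
      (by rw [← Real.lt_log_iff_exp_lt hr]; linarith)
    have h0 := hs.tendsto_atTop_zero
    obtain ⟨n, hn, hn0⟩ := ((h0.eventually (gt_mem_nhds zero_lt_one)).and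
      (eventually_gt_atTop 0)).exists
    rw [hterm, Real.exp_lt_one_iff] at hn
    have h1 := hsub.lim_le_div hbdd hn0.ne'
    have hn0' : (0 : ℝ) < n := by exact_mod_cast hn0
    rw [le_div_iff₀ hn0'] at h1
    linarith

lemma not_summable_card_saws {x : ℝ≥0} (hx : 2 * (x : ℝ) * Real.cos (Real.pi / 8) = 1) :
    ¬ Summable fun n => ((slice saws n).card : ℝ) * (x : ℝ) ^ n := by
  intro hs
  have h1 := wt_saws_critical hx
  rw [wt_eq_tsum] at h1
  have h2 : Summable fun n => ((slice saws n).card : ℝ≥0) * x ^ n := by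
    rw [← NNReal.summable_coe]; simpa using hs
  apply ENNReal.tsum_coe_ne_top_iff_summable.2 h2
  simpa using h1

lemma card_saws_pos {x : ℝ≥0} (hx : 2 * (x : ℝ) * Real.cos (Real.pi / 8) = 1) (n : ℕ) :
    0 < (slice saws n).card := by
  by_contra h0
  have h0' : (slice saws n).card = 0 := by omega
  apply not_summable_card_saws hx
  refine summable_of_ne_finset_zero (s := Finset.range n) fun m hm => ?_
  rw [Finset.mem_range, not_lt] at hm
  have := card_saws_add_le n (m - n)
  rw [Nat.add_sub_cancel' hm, h0', zero_mul] at this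
  rw [Nat.le_zero.1 this, Nat.cast_zero, zero_mul]

lemma tendsto_log_card_saws {x : ℝ≥0} (hx : 2 * (x : ℝ) * Real.cos (Real.pi / 8) = 1) :
    Tendsto (fun n : ℕ => Real.log (slice saws n).card / n) atTop (𝓝 (-Real.log x)) := by
  refine tendsto_log_div_of_radius (card_saws_pos hx) card_saws_add_le (pos_of_critical hx)
    (not_summable_card_saws hx) fun y hy hyx => ?_
  lift y to ℝ≥0 using hy
  exact (hasSum_wt (wt_saws_subcritical hx (by exact_mod_cast hyx))).summable

lemma tendsto_hexSAWCount (v : HexVertex) {x : ℝ≥0}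
    (hx : 2 * (x : ℝ) * Real.cos (Real.pi / 8) = 1) :
    Tendsto (fun n : ℕ => (hexSAWCount v n : ℝ) ^ (1 / (n : ℝ))) atTop (𝓝 (x : ℝ)⁻¹) := by
  have hg : ∀ n, (0 : ℝ) < (slice saws n).card := fun n => by exact_mod_cast card_saws_pos hx n
  have hle : ∀ n, ((slice saws (n + 1)).card : ℝ) ≤ 2 * hexSAWCount v n := fun n => by
    exact_mod_cast card_saws_le v n
  have hge : ∀ n, (hexSAWCount v n : ℝ) ≤ 2 * (slice saws (n + 1)).card := fun n => by
    exact_mod_cast hexSAWCount_le v n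
  have hc : ∀ n, (0 : ℝ) < hexSAWCount v n := fun n => by linarith [hg (n + 1), hle n]
  have hlog : ∀ n : ℕ, |Real.log (hexSAWCount v n) - Real.log (slice saws (n + 1)).card| ≤
      Real.log 2 := by
    intro n
    have h1 := Real.log_le_log (hg _) (hle n)
    have h2 := Real.log_le_log (hc _) (hge n)
    rw [Real.log_mul two_ne_zero (hc n).ne'] at h1
    rw [Real.log_mul two_ne_zero (hg _).ne'] at h2
    rw [abs_le]
    constructor <;> linarith
  have h1 : Tendsto (fun n : ℕ => Real.log (slice saws (n + 1)).card / (n + 1 : ℕ) *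
      (1 + 1 / (n : ℝ))) atTop (𝓝 (-Real.log x * (1 + 0))) :=
    ((tendsto_log_card_saws hx).comp (tendsto_add_atTop_nat 1)).mul
      (tendsto_const_nhds.add tendsto_one_div_atTop_nhds_zero_nat)
  have h2 : Tendsto (fun n : ℕ => (Real.log (hexSAWCount v n) -
      Real.log (slice saws (n + 1)).card) / (n : ℝ)) atTop (𝓝 0) := by
    refine squeeze_zero_norm (fun n => ?_) (tendsto_const_div_atTop_nhds_zero_nat (Real.log 2))
    rw [norm_div, Real.norm_natCast, Real.norm_eq_abs]
    exact div_le_div_of_nonneg_right (hlog n) (Nat.cast_nonneg n)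
  have h3 := (Real.continuous_exp.tendsto _).comp (h1.add h2)
  rw [add_zero, add_zero, mul_one, Real.exp_neg, Real.exp_log (pos_of_critical hx)] at h3
  refine h3.congr' ?_
  filter_upwards [eventually_gt_atTop 0] with n hn
  have hn' : (n : ℝ) ≠ 0 := by exact_mod_cast hn.ne'
  rw [Real.rpow_def_of_pos (hc n), Function.comp_apply]
  congr 1
  push_cast
  field_simp
  ring

end Honeycomb

theorem theorem1 :
    (∀ v : HexVertex,
      Tendsto (fun n : ℕ => (hexSAWCount v n : ℝ) ^ (1 / (n : ℝ))) atTop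
        (𝓝 (Real.sqrt (2 + Real.sqrt 2)))) ∧
    (∀ (a : hexLattice.edgeSet) (x : ℝ≥0),
      (1 / Real.sqrt (2 + Real.sqrt 2) ≤ (x : ℝ) → hexPartition a x = ∞) ∧
      ((x : ℝ) < 1 / Real.sqrt (2 + Real.sqrt 2) → hexPartition a x < ∞)) := by
  have hpos : 0 < Real.sqrt (2 + Real.sqrt 2) := by positivity
  let c : ℝ≥0 := ⟨1 / Real.sqrt (2 + Real.sqrt 2), by positivity⟩
  have hcc : (c : ℝ) = 1 / Real.sqrt (2 + Real.sqrt 2) := rfl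
  have hc : 2 * (c : ℝ) * Real.cos (Real.pi / 8) = 1 := by
    rw [hcc, Real.cos_pi_div_eight]; field_simp
  refine ⟨fun v => ?_, fun a x => ⟨fun hx => ?_, fun hx => ?_⟩⟩
  · simpa [hcc] using Honeycomb.tendsto_hexSAWCount v hc
  · rw [← hcc, NNReal.coe_le_coe] at hx
    refine top_le_iff.1 (le_trans ?_ (Honeycomb.wt_saws_le_hexPartition a x))
    rw [← Honeycomb.wt_saws_critical hc]
    exact Honeycomb.wt_mono_right _ hx
  · rw [← hcc, NNReal.coe_lt_coe] at hx
    exact (Honeycomb.hexPartition_le a x).trans_lt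
      (ENNReal.mul_lt_top (by simp) (Honeycomb.wt_saws_subcritical hc hx).lt_top)
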